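/- **Setting.** A complete unit is $(M^*,C,A,X,U)$ with $M^*\in\mathbb R$ (outcome), $C\in\mathbb R^d$ (regressors), $A\in\{0,1\}$ (annotation indicator), $X\in\mathbb R^k$, $U\in\mathbb R^\ell$. One observes $W=(M,C,A,X,U)$ with $M=AM^*$; let $P$ be the law of $W$. Assume: - *Missing at random:* $(U,M^*)\perp A\mid X$ and $C\perp A\mid (X,U,M^*)$. - *Known annotation score:* $\pi(X)=P(A=1\mid X)$ for a known measurable $\pi$ with $\pi(x)\in[\eta,1]$ for all $x$, where $0<\eta<1$. - *Linear model:* $M^*=C^{\mathtt T}\theta+\varepsilon$, $E[\varepsilon\mid C]=0$, with $M^*$ integrable and $C$ square integrable. - *Residualized regressor:* $C_j^\perp=C_j-b_0-\sum_{r\ne j}b_rC_r$ is the residual of the linear projection of $C_j$ on $1$ and the $C_r$, $r\neq j$ (that is, $E[C_j^\perp]=0$ and $E[C_j^\perp C_r]=0$ for $r\ne j$). The coefficients $b_0,b_r$ are known and $C_j^\perp$ is almost surely bounded, with $\theta_{j,\mathrm{den}}:=E[(C_j^\perp)^2]>0$ and $E[(C_j^\perp M^*)^2]<\infty$. Let $\tilde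 X=(X,U,C)$ and $\mu(\tilde x)=E[M\mid A=1,\tilde X=\tilde x]$. Let $\hat\mu_m$ be a (jointly measurable) function of an i.i.d. training sample of size $m=|\mathcal I'|$ from $P$, with $E\big[\int(\hat\mu_m-\mu)^2\,dP_{\tilde X}\big]\to0$ as $m\to\infty$. On an independent i.i.d. estimation sample $(W_i)_{i\in\mathcal I}$ from $P$, $|\mathcal I|=n$, define $$\hat\theta_j=\frac{\sum_{i\in\mathcal I}C_{i,j}^\perp\big[\hat\mu_m(\tilde X_i)+\frac{A_i}{\pi(X_i)}(M_i-\hat\mu_m(\tilde X_i))\big]}{\sum_{i\in\mathcal I}(C_{i,j}^\perp)^2}.$$ Put $\theta_{j,\mathrm{num}}=E[C_j^\perp\mu(\tilde X)]$, $\varphi_{\mathrm{num}}(W)=C_j^\perp\big[\mu(\tilde X)+\frac{A}{\pi(X)}(M-\mu(\tilde X))\big]-\theta_{j,\mathrm{num}}$, $\varphi_{\mathrm{den}}(W)=(C_j^\perp)^2-\theta_{j,\mathrm{den}}$ and $\varphi_j=\theta_{j,\mathrm{den}}^{-1}(\varphi_{\mathrm{num}}-\theta_j\varphi_{\mathrm{den}})$.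 **The model.** Let $\mathcal P_\pi$ be the set of all laws $Q$ of $W$ with $Q(A=1\mid X,U,C)=\pi(X)$ and $M=0$ on $\{A=0\}$ such that $E_Q|M|<\infty$, $E_Q[(C_j^\perp M)^2]<\infty$, $E_Q[(C_j^\perp)^4]<\infty$ and $E_Q[(C_j^\perp)^2]>0$. On $\mathcal P_\pi$ consider the functional $\psi(Q)=E_Q[(C_j^\perp)^2]^{-1}E_Q[C_j^\perp\,\mu_Q(\tilde X)]$, where $\mu_Q(\tilde x)=E_Q[M\mid A=1,\tilde X=\tilde x]$ and $C_j^\perp$ is the same known function of $C$ for every $Q$. A regular submodel is a path $t\mapsto Q_t\in\mathcal P_\pi$ with $Q_0=P$ that is differentiable in quadratic mean as $t\downarrow0$, with a score $h\in L^2(P)$, and along which $E_{Q_t}[(C_j^\perp M)^2]$ and $E_{Q_t}[(C_j^\perp)^4]$ are bounded for small $t>0$. **Proposition.** 1. $\theta_j=E[(C_j^\perp)^2]^{-1}E[C_j^\perp M^*]=\theta_{j,\mathrm{den}}^{-1}\theta_{j,\mathrm{num}}=\psi(P)$. 2. As $|\mathcal I|,|\mathcal I'|\to\infty$, $\sqrt{|\mathcal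 I|}\,(\hat\theta_j-\theta_j)\xrightarrow{d}N(0,\mathrm{Var}(\varphi_j(W)))$. 3. $P\in\mathcal P_\pi$, and $\varphi_j$ is the efficient influence function of $\psi$ at $P$ in $\mathcal P_\pi$: it is in $L^2(P)$, $\frac{d}{dt}\psi(Q_t)\big|_{t=0^+}=E_P[\varphi_jh]$ for every regular submodel with score $h$, and $\varphi_j$ lies in the closed linear span of the scores in $L^2(P)$. 4. $\hat\theta_j$ is efficient (relative to its estimation sample): - it is asymptotically linear with influence function $\varphi_j$: $\sqrt{|\mathcal I|}(\hat\theta_j-\theta_j)-|\mathcal I|^{-1/2}\sum_{i\in\mathcal I}\varphi_j(W_i)\to0$ in probability; - it is regular: for every regular submodel, if both samples are drawn from $Q_{1/\sqrt{n+m}}$, then $\sqrt{n}\,(\hat\theta_j-\psi(Q_{1/\sqrt{n+m}}))\xrightarrow{d}N(0,\mathrm{Var}_P(\varphi_j))$; - the influence function $\phi$ of any estimator sequence of $\psi$ based on $n$ i.i.d. observations that is regular (for all regular submodels, $\sqrt n(T_n-\psi(Q_{1/\sqrt n}))\xrightarrow{d}N(0,\mathrm{Var}_P(\phi))$ under $Q_{1/\sqrt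 n}$) and asymptotically linear at $P$ satisfies $\mathrm{Var}_P(\varphi_j)\le\mathrm{Var}_P(\phi)$. -/

import Mathlib

open MeasureTheory ProbabilityTheory Filter Topology
open scoped ENNReal

noncomputable section

/-! ## Semiparametric efficiency -/

section Efficiency

variable {𝒲 : Type*} [MeasurableSpace 𝒲]

/-- The path `t ↦ Q t` is differentiable in quadratic mean at `t = 0+`, with score `h` at `P`:
`∫ ((√dQ_t - √dP) / t - (h / 2) √dP)² → 0` as `t ↓ 0`.
Densities are taken with respect to the dominating measure `P + Q t`;
the integral does not depend on the choice of the dominating measure. -/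
def DiffInQuadraticMean (P : ProbabilityMeasure 𝒲) (Q : ℝ → ProbabilityMeasure 𝒲)
    (h : 𝒲 → ℝ) : Prop :=
  Tendsto
    (fun t : ℝ =>
      let ν : Measure 𝒲 := (P : Measure 𝒲) + (Q t : Measure 𝒲)
      let p : 𝒲 → ℝ := fun w => ((P : Measure 𝒲).rnDeriv ν w).toReal
      let q : 𝒲 → ℝ := fun w => ((Q t : Measure 𝒲).rnDeriv ν w).toReal
      ∫⁻ w, ENNReal.ofReal (((√(q w) - √(p w)) / t - h w / 2 * √(p w)) ^ 2) ∂ν)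
    (𝓝[>] 0) (𝓝 0)

/-- A class of (one-dimensional) parametric submodels through a distribution:
`S Q h` says that the path `Q` belongs to the class and has score `h`. -/
abbrev SubmodelClass (𝒲 : Type*) [MeasurableSpace 𝒲] :=
  (ℝ → ProbabilityMeasure 𝒲) → (𝒲 → ℝ) → Prop

/-- `φ` is the efficient influence function at `P` of the functional `ψ`:
`ψ` is differentiable along every submodel with derivative `E[φ h]`, for `h` the score of the
submodel, and `φ` lies in the tangent space, the closed linear span of the scores in `L²(P)`. -/
structure IsEfficientInfluenceFunction (S : SubmodelClass 𝒲) (ψ : ProbabilityMeasure 𝒲 → ℝ)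
    (P : ProbabilityMeasure 𝒲) (φ : 𝒲 → ℝ) : Prop where
  memLp : MemLp φ 2 (P : Measure 𝒲)
  pathwise : ∀ Q h, S Q h →
    Tendsto (fun t : ℝ => (ψ (Q t) - ψ P) / t) (𝓝[>] 0)
      (𝓝 (∫ w, φ w * h w ∂(P : Measure 𝒲)))
  mem_tangent : ∀ ε : ℝ≥0∞, 0 < ε →
    ∃ g ∈ Submodule.span ℝ {h : 𝒲 → ℝ | ∃ Q, S Q h}, eLpNorm (φ - g) 2 (P : Measure 𝒲) < ε

/-- The joint law of `n` independent draws from `P`. -/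
abbrev iidLaw (P : ProbabilityMeasure 𝒲) (n : ℕ) : Measure (Fin n → 𝒲) :=
  Measure.pi (fun _ => (P : Measure 𝒲))

/-- The estimator sequence `T n` of `ψ`, based on `n` i.i.d. draws, is regular and asymptotically
linear at `P` with influence function `ϕ`. -/
structure IsRAL (S : SubmodelClass 𝒲) (ψ : ProbabilityMeasure 𝒲 → ℝ)
    (P : ProbabilityMeasure 𝒲) (T : (n : ℕ) → (Fin n → 𝒲) → ℝ) (ϕ : 𝒲 → ℝ) : Prop where
  measurable : ∀ n, Measurable (T n)
  memLp : MemLp ϕ 2 (P : Measure 𝒲)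
  integral_eq_zero : ∫ w, ϕ w ∂(P : Measure 𝒲) = 0
  asymptotically_linear : ∀ ε : ℝ, 0 < ε →
    Tendsto (fun n : ℕ => iidLaw P n
      {s | ε < |√(n : ℝ) * (T n s - ψ P) - (√(n : ℝ))⁻¹ * ∑ i, ϕ (s i)|}) atTop (𝓝 0)
  regular : ∀ Q h, S Q h →
    TendstoInDistribution
      (fun (n : ℕ) (s : Fin n → 𝒲) => √(n : ℝ) * (T n s - ψ (Q (1 / √(n : ℝ))))) atTop
      (id : ℝ → ℝ) (fun n => iidLaw (Q (1 / √(n : ℝ))) n)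
      (gaussianReal 0 (Var[ϕ; (P : Measure 𝒲)]).toNNReal)

end Efficiency

/-! ## Missing-at-random structured outcomes in linear regression -/

section Model

variable {d k l : ℕ}

/-- A complete unit `(M*, C, A, X, U)`: ground-truth outcome, regressors, annotation indicator,
observed covariates, unstructured data. -/
abbrev FullData (d k l : ℕ) : Type :=
  ℝ × (Fin d → ℝ) × Bool × (Fin k → ℝ) × (Fin l → ℝ)

/-- An observed unit `W = (M, C, A, X, U)`. -/
abbrev ObsData (d k l : ℕ) : Type :=
  ℝ × (Fin d → ℝ) × Bool × (Fin k → ℝ) × (Fin l → ℝ)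

/-- The features `X̃ = (X, U, C)`. -/
abbrev Feat (d k l : ℕ) : Type := (Fin k → ℝ) × (Fin l → ℝ) × (Fin d → ℝ)

/-- The first coordinate: `M*` for a complete unit, `M` for an observed unit. -/
def outcome (w : ObsData d k l) : ℝ := w.1

/-- `C`. -/
def regr (w : ObsData d k l) : Fin d → ℝ := w.2.1

/-- `A` (as a Boolean). -/
def annot (w : ObsData d k l) : Bool := w.2.2.1

/-- `A` as a real number, `0` or `1`. -/
def annotR (w : ObsData d k l) : ℝ := if annot w = true then 1 else 0

/-- `X`. -/
def covar (w : ObsData d k l) : Fin k → ℝ := w.2.2.2.1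

/-- `U`. -/
def unstr (w : ObsData d k l) : Fin l → ℝ := w.2.2.2.2

/-- `X̃ = (X, U, C)`. -/
def feat (w : ObsData d k l) : Feat d k l := (covar w, unstr w, regr w)

lemma measurable_outcome : Measurable (outcome : ObsData d k l → ℝ) := measurable_fst

lemma measurable_regr : Measurable (regr : ObsData d k l → Fin d → ℝ) :=
  measurable_fst.comp measurable_snd

lemma measurable_annot : Measurable (annot : ObsData d k l → Bool) :=
  measurable_fst.comp (measurable_snd.comp measurable_snd)

lemma measurable_annotR : Measurable (annotR : ObsData d k l → ℝ) :=
  Measurable.ite (measurable_annot (measurableSet_singleton true)) measurable_const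
    measurable_const

lemma measurable_covar : Measurable (covar : ObsData d k l → Fin k → ℝ) :=
  measurable_fst.comp (measurable_snd.comp (measurable_snd.comp measurable_snd))

lemma measurable_unstr : Measurable (unstr : ObsData d k l → Fin l → ℝ) :=
  measurable_snd.comp (measurable_snd.comp (measurable_snd.comp measurable_snd))

lemma measurable_feat : Measurable (feat : ObsData d k l → Feat d k l) :=
  measurable_covar.prodMk (measurable_unstr.prodMk measurable_regr)

/-- Consistency of potential outcomes: the observed unit is `(A M*, C, A, X, U)`. -/
def observe (z : FullData d k l) : ObsData d k l :=
  (annotR z * outcome z, regr z, annot z, covar z, unstr z)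

lemma measurable_observe : Measurable (observe : FullData d k l → ObsData d k l) :=
  (measurable_annotR.mul measurable_outcome).prodMk
    (measurable_regr.prodMk
      (measurable_annot.prodMk (measurable_covar.prodMk measurable_unstr)))

/-- The law `P` of the observed unit. -/
def obsLaw (Pfull : ProbabilityMeasure (FullData d k l)) : ProbabilityMeasure (ObsData d k l) :=
  Pfull.map measurable_observe.aemeasurable

/-- Missing at random: `(U, M*) ⫫ A | X`, and `C ⫫ A | (X, U, M*)`. -/
structure MissingAtRandom (Pfull : ProbabilityMeasure (FullData d k l)) : Prop where
  outcome_indep :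
    CondIndepFun (MeasurableSpace.comap covar inferInstance) measurable_covar.comap_le
      (fun z => (unstr z, outcome z)) annot (Pfull : Measure (FullData d k l))
  regr_indep :
    CondIndepFun
      (MeasurableSpace.comap (fun z => (covar z, unstr z, outcome z)) inferInstance)
      (measurable_covar.prodMk (measurable_unstr.prodMk measurable_outcome)).comap_le
      regr annot (Pfull : Measure (FullData d k l))

/-- `π(X) = P(A = 1 | X)`, with `π(x) ∈ [η, 1]` for all `x`, where `0 < η < 1`. -/
structure IsAnnotationScore (Pfull : ProbabilityMeasure (FullData d k l))
    (π : (Fin k → ℝ) → ℝ) (η : ℝ) : Prop where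
  measurable : Measurable π
  pos : 0 < η
  lt_one : η < 1
  mem_Icc : ∀ x, π x ∈ Set.Icc η 1
  eq_condProb :
    (Pfull : Measure (FullData d k l))[annotR | MeasurableSpace.comap covar inferInstance]
      =ᵐ[(Pfull : Measure (FullData d k l))] fun z => π (covar z)

/-- The linear model `M* = Cᵀ θ + ε`, `E[ε | C] = 0`. -/
structure LinearModel (Pfull : ProbabilityMeasure (FullData d k l)) (θ : Fin d → ℝ) : Prop where
  integrable : Integrable outcome (Pfull : Measure (FullData d k l))
  memLp : ∀ r, MemLp (fun z : FullData d k l => regr z r) 2 (Pfull : Measure (FullData d k l))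
  condExp_error :
    (Pfull : Measure (FullData d k l))[fun z => outcome z - ∑ r, regr z r * θ r |
      MeasurableSpace.comap regr inferInstance] =ᵐ[(Pfull : Measure (FullData d k l))] 0

/-- The residual `c ↦ c_j - b₀ - ∑_{r ≠ j} b_r c_r`. -/
def resid (j : Fin d) (b₀ : ℝ) (b : Fin d → ℝ) (c : Fin d → ℝ) : ℝ :=
  c j - (b₀ + ∑ r ∈ Finset.univ.erase j, b r * c r)

/-- `b₀ + ∑_{r ≠ j} b_r C_r` is the population linear projection of `C_j` on the constant and the
other regressors (normal equations); so `resid j b₀ b C` is `C_j^⊥`. -/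
structure IsLinearProjection (Pfull : ProbabilityMeasure (FullData d k l)) (j : Fin d)
    (b₀ : ℝ) (b : Fin d → ℝ) : Prop where
  orthogonal_const : ∫ z, resid j b₀ b (regr z) ∂(Pfull : Measure (FullData d k l)) = 0
  orthogonal : ∀ r, r ≠ j →
    ∫ z, resid j b₀ b (regr z) * regr z r ∂(Pfull : Measure (FullData d k l)) = 0

/-- The regression function `μ_Q(x̃) = E_Q[M | A = 1, X̃ = x̃]` of an observed law `Q`. -/
def regressionFun (Q : ProbabilityMeasure (ObsData d k l)) (x : Feat d k l) : ℝ :=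
  ∫ m, m ∂(condDistrib outcome feat
    (ProbabilityTheory.cond (Q : Measure (ObsData d k l)) {w | annot w = true}) x)

variable (π : (Fin k → ℝ) → ℝ) (cperp : (Fin d → ℝ) → ℝ)

/-- The numerator functional `Q ↦ E_Q[C^⊥ μ_Q(X̃)]`. -/
def thetaNum (Q : ProbabilityMeasure (ObsData d k l)) : ℝ :=
  ∫ w, cperp (regr w) * regressionFun Q (feat w) ∂(Q : Measure (ObsData d k l))

/-- The denominator functional `Q ↦ E_Q[(C^⊥)²]`. -/
def thetaDen (Q : ProbabilityMeasure (ObsData d k l)) : ℝ :=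
  ∫ w, cperp (regr w) ^ 2 ∂(Q : Measure (ObsData d k l))

/-- The target functional `Q ↦ E_Q[(C^⊥)²]⁻¹ E_Q[C^⊥ μ_Q(X̃)]`, the function `C^⊥` being known
(it does not vary with `Q`). -/
def thetaRatio (Q : ProbabilityMeasure (ObsData d k l)) : ℝ :=
  (thetaDen cperp Q)⁻¹ * thetaNum cperp Q

/-- `φ_num(W) = C^⊥ (μ(X̃) + A / π(X) (M - μ(X̃))) - θ_num`. -/
def phiNum (P : ProbabilityMeasure (ObsData d k l)) (w : ObsData d k l) : ℝ :=
  cperp (regr w) * (regressionFun P (feat w)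
    + annotR w / π (covar w) * (outcome w - regressionFun P (feat w))) - thetaNum cperp P

/-- `φ_den(W) = (C^⊥)² - θ_den`. -/
def phiDen (P : ProbabilityMeasure (ObsData d k l)) (w : ObsData d k l) : ℝ :=
  cperp (regr w) ^ 2 - thetaDen cperp P

/-- `φ_j(W) = θ_den⁻¹ (φ_num(W) - θ_j φ_den(W))`. -/
def phiRatio (P : ProbabilityMeasure (ObsData d k l)) (w : ObsData d k l) : ℝ :=
  (thetaDen cperp P)⁻¹ * (phiNum π cperp P w - thetaRatio cperp P * phiDen cperp P w)

/-- The semiparametric model induced by a known annotation score `π`: observed laws with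
`P(A = 1 | X, U, C) = π(X)` and `M = 0` for units that are not annotated, otherwise unrestricted
except for the moments that the target functional and its influence function need. -/
structure InModel (Q : ProbabilityMeasure (ObsData d k l)) : Prop where
  outcome_eq_zero : ∀ᵐ w ∂(Q : Measure (ObsData d k l)), annot w = false → outcome w = 0
  annotation_score :
    (Q : Measure (ObsData d k l))[annotR | MeasurableSpace.comap feat inferInstance]
      =ᵐ[(Q : Measure (ObsData d k l))] fun w => π (covar w)
  integrable_outcome : Integrable outcome (Q : Measure (ObsData d k l))
  memLp_num : MemLp (fun w => cperp (regr w) * outcome w) 2 (Q : Measure (ObsData d k l))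
  memLp_den : MemLp (fun w => cperp (regr w) ^ 2) 2 (Q : Measure (ObsData d k l))
  den_pos : 0 < thetaDen cperp Q

/-- The regular parametric submodels through `P` of the model with known annotation score: paths
in the model, differentiable in quadratic mean at `P`, along which the second moments of `C^⊥ M`
and `(C^⊥)²` stay bounded near `P` (the standard condition for means of unbounded variables to be
differentiable along a path). -/
structure IsRegularSubmodel (P : ProbabilityMeasure (ObsData d k l))
    (Q : ℝ → ProbabilityMeasure (ObsData d k l)) (h : ObsData d k l → ℝ) : Prop where
  at_zero : Q 0 = P
  mem_model : ∀ t, InModel π cperp (Q t)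
  measurable_score : Measurable h
  memLp_score : MemLp h 2 (P : Measure (ObsData d k l))
  diff : DiffInQuadraticMean P Q h
  moments_bounded : ∃ K : ℝ, ∀ᶠ t in 𝓝[>] (0 : ℝ),
    ∫ w, (cperp (regr w) * outcome w) ^ 2 ∂(Q t : Measure (ObsData d k l)) ≤ K ∧
    ∫ w, (cperp (regr w) ^ 2) ^ 2 ∂(Q t : Measure (ObsData d k l)) ≤ K

/-- The pseudo-outcome `μ̂(X̃) + A / π(X) (M - μ̂(X̃))`. -/
def pseudoOutcome (f : Feat d k l → ℝ) (w : ObsData d k l) : ℝ :=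
  f (feat w) + annotR w / π (covar w) * (outcome w - f (feat w))

/-- The residualized regression of the pseudo-outcome, on an estimation sample `s` of size `n`, the
imputation function `μ̂_m` being learned from a training sample `s'` of size `m`. -/
def thetaHat (muHat : (m : ℕ) → (Fin m → ObsData d k l) → Feat d k l → ℝ) (n m : ℕ)
    (s : (Fin n → ObsData d k l) × (Fin m → ObsData d k l)) : ℝ :=
  (∑ i, cperp (regr (s.1 i)) * pseudoOutcome π (muHat m s.2) (s.1 i))
    / ∑ i, cperp (regr (s.1 i)) ^ 2

/-- The joint law of independent i.i.d. estimation and training samples, of sizes `n` and `m`. -/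
abbrev splitLaw (P : ProbabilityMeasure (ObsData d k l)) (n m : ℕ) :
    Measure ((Fin n → ObsData d k l) × (Fin m → ObsData d k l)) :=
  (iidLaw P n).prod (iidLaw P m)

/-- Mean-square consistency of the imputation function:
`E[∫ (μ̂_m(x̃) - μ(x̃))² dP_X̃(x̃)] → 0` as the size `m` of the training sample tends to infinity. -/
def MSEConsistent (P : ProbabilityMeasure (ObsData d k l))
    (muHat : (m : ℕ) → (Fin m → ObsData d k l) → Feat d k l → ℝ) : Prop :=
  Tendsto (fun m : ℕ => ∫⁻ s', ∫⁻ x, ENNReal.ofReal ((muHat m s' x - regressionFun P x) ^ 2)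
      ∂((P : Measure (ObsData d k l)).map feat) ∂(iidLaw P m)) atTop (𝓝 0)

end Model

end

open MeasureTheory ProbabilityTheory Filter Topology
open scoped ENNReal

noncomputable section

/-! ## Square-root densities and differentiability in quadratic mean -/

section QuadraticMean

variable {𝒲 : Type*} [MeasurableSpace 𝒲]

/-! Identification. `C_j` and `C^⊥` differ by a combination of `1` and the other regressors, to
which `C^⊥` is orthogonal, so `E[C^⊥ M*] = θ_j E[(C^⊥)²]` (`LinearModel.coefficient_eq`). The two
conditional independences combine to `E[A | X, U, M*, C] = π(X)` (`MissingAtRandom.condExp_annotR`),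
and weighting by `A / π(X)` then recovers `E[C^⊥ M*]` from observed data.

Gradient. In the model `E_Q[M | X̃] = π(X) μ_Q(X̃)`, so the numerator of the functional equals
`E_Q[C^⊥ M / π(X)]`, the mean of a function that does not depend on `Q` (`InModel.thetaNum_eq`).
Means are differentiable along paths that are differentiable in quadratic mean with bounded second
moments (`DiffInQuadraticMean.tendsto_integral_sub_div`). The influence function contains in
addition the augmentation `C^⊥ μ (1 - A / π)`; functions of the form `f(X̃) (1 - A / π)` are
orthogonal to all scores because, when bounded, they have mean zero under every law of the model.
The quotient rule finishes (`IsRegularSubmodel.tendsto_thetaRatio`).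

Tangent space. `φ_j` is a centred function of `X̃` plus a function that vanishes when `A = 0` and is
centred given `X̃`. Each piece is an `L²` limit of bounded functions `g` of the same kind, and the
densities `1 + t g` stay in the model and have score `g` (`InModel.phiRatio_mem_tangent`).

Asymptotic linearity. The error of the ratio is an explicit algebraic expression in normalized sums.
Given the training sample, an error in `μ̂` enters only through `C^⊥ (μ̂ - μ)(1 - A / π)`, which has
mean zero whatever `μ̂` is, since `π` is known; Chebyshev bounds its normalized sum by the mean
squared error of `μ̂` (`InModel.tendsto_linearization`).

Regularity. Product laws along a path at distance `t` with `n t² ≤ 1` are contiguous to those of `P`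
(`DiffInQuadraticMean.tendsto_pi_zero`), so the linear expansion survives under local alternatives.
There the normalized sum of `φ_j` is shifted by `√n t E[φ_j h]`
(`DiffInQuadraticMean.tendsto_integral_exp_iid`), which is exactly how far `√n ψ(Q_t)` moves.
Asymptotic normality under `P` is the case of the constant path.

Variance bound. For a regular asymptotically linear estimator with influence function `ϕ`, the shift
`E[ϕ h]` must cancel the derivative of `ψ`, so `ϕ - φ_j` is orthogonal to all scores, hence to
`φ_j`, and Pythagoras applies (`IsEfficientInfluenceFunction.variance_le`). -/

/-- The Cauchy-Schwarz inequality for square-integrable real functions. -/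
lemma abs_integral_mul_le_sqrt {ν : Measure 𝒲} {f g : 𝒲 → ℝ} (hf : MemLp f 2 ν)
    (hg : MemLp g 2 ν) :
    |∫ w, f w * g w ∂ν| ≤ √(∫ w, f w ^ 2 ∂ν) * √(∫ w, g w ^ 2 ∂ν) := by
  have h2 : ENNReal.ofReal 2 = 2 := by norm_num
  have h := integral_mul_norm_le_Lp_mul_Lq (μ := ν) (f := f) (g := g) (p := 2) (q := 2)
    Real.HolderConjugate.two_two (by rwa [h2]) (by rwa [h2])
  simp only [Real.rpow_two, Real.norm_eq_abs, sq_abs, ← Real.sqrt_eq_rpow] at h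
  refine le_trans ?_ h
  refine (abs_integral_le_integral_abs).trans_eq ?_
  simp only [abs_mul]

/-- The square root of the density of `R` with respect to `ν`. -/
def sqrtDensity (R ν : Measure 𝒲) (w : 𝒲) : ℝ := √((R.rnDeriv ν w).toReal)

lemma measurable_sqrtDensity (R ν : Measure 𝒲) : Measurable (sqrtDensity R ν) :=
  (Measure.measurable_rnDeriv R ν).ennreal_toReal.sqrt

lemma sqrtDensity_nonneg (R ν : Measure 𝒲) (w : 𝒲) : 0 ≤ sqrtDensity R ν w :=
  Real.sqrt_nonneg _

lemma sq_sqrtDensity (R ν : Measure 𝒲) (w : 𝒲) :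
    sqrtDensity R ν w ^ 2 = (R.rnDeriv ν w).toReal := Real.sq_sqrt ENNReal.toReal_nonneg

section

variable {R ν : Measure 𝒲} [IsFiniteMeasure R] [IsFiniteMeasure ν]

/-- Change of measure: it lets two laws be compared inside one space `L²(ν)`, where Cauchy-Schwarz
is available. -/
lemma integrable_sq_sqrtDensity_mul_iff (h : R ≪ ν) {f : 𝒲 → ℝ} :
    Integrable (fun w => sqrtDensity R ν w ^ 2 * f w) ν ↔ Integrable f R := by
  simp only [sq_sqrtDensity]
  exact integrable_toReal_rnDeriv_mul_iff h

lemma integral_sq_sqrtDensity_mul (h : R ≪ ν) (f : 𝒲 → ℝ) :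
    ∫ w, sqrtDensity R ν w ^ 2 * f w ∂ν = ∫ w, f w ∂(R) := by
  simp only [sq_sqrtDensity]
  exact integral_toReal_rnDeriv_mul h

lemma memLp_mul_sqrtDensity (h : R ≪ ν) {f : 𝒲 → ℝ} (hfm : Measurable f) (hf : MemLp f 2 R) :
    MemLp (fun w => f w * sqrtDensity R ν w) 2 ν := by
  refine (memLp_two_iff_integrable_sq
    (hfm.mul (measurable_sqrtDensity R ν)).aestronglyMeasurable).2 ?_
  have := (integrable_sq_sqrtDensity_mul_iff h).2 hf.integrable_sq
  refine this.congr (ae_of_all _ fun w => ?_)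
  simp only [Pi.mul_apply]; ring

lemma integral_sq_mul_sqrtDensity (h : R ≪ ν) (f : 𝒲 → ℝ) :
    ∫ w, (f w * sqrtDensity R ν w) ^ 2 ∂ν = ∫ w, f w ^ 2 ∂(R) := by
  rw [← integral_sq_sqrtDensity_mul h]
  exact integral_congr_ae (ae_of_all _ fun w => by simp only; ring)

lemma memLp_sqrtDensity (h : R ≪ ν) : MemLp (sqrtDensity R ν) 2 ν := by
  simpa using memLp_mul_sqrtDensity h measurable_const (memLp_const (1 : ℝ))

end

/-- The remainder in the definition of differentiability in quadratic mean. -/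
def dqmRemainder (P R : ProbabilityMeasure 𝒲) (h : 𝒲 → ℝ) (t : ℝ) (w : 𝒲) : ℝ :=
  (sqrtDensity R (P + R : Measure 𝒲) w - sqrtDensity P (P + R : Measure 𝒲) w) / t
    - h w / 2 * sqrtDensity P (P + R : Measure 𝒲) w

/-- The squared Hellinger distance. -/
def sqHellinger (P R : ProbabilityMeasure 𝒲) : ℝ :=
  ∫ w, (sqrtDensity R (P + R : Measure 𝒲) w - sqrtDensity P (P + R : Measure 𝒲) w) ^ 2
    ∂(P + R : Measure 𝒲)

/-! ### Two laws compared through their root densities -/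

section Pair

variable (P R : ProbabilityMeasure 𝒲)

lemma absolutelyContinuous_add_left : (P : Measure 𝒲) ≪ (P + R : Measure 𝒲) :=
  Measure.AbsolutelyContinuous.rfl.add_right _

lemma absolutelyContinuous_add_right : (R : Measure 𝒲) ≪ (P + R : Measure 𝒲) :=
  Measure.absolutelyContinuous_of_le (Measure.le_add_left le_rfl)

lemma memLp_sqrtDensity_sub :
    MemLp (fun w => sqrtDensity R (P + R : Measure 𝒲) w
      - sqrtDensity P (P + R : Measure 𝒲) w) 2 (P + R : Measure 𝒲) :=
  (memLp_sqrtDensity (absolutelyContinuous_add_right P R)).sub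
    (memLp_sqrtDensity (absolutelyContinuous_add_left P R))

variable {P R} {h : 𝒲 → ℝ} (hhm : Measurable h) (hh : MemLp h 2 (P : Measure 𝒲))

include hhm hh in
lemma memLp_dqmRemainder (t : ℝ) :
    MemLp (dqmRemainder P R h t) 2 (P + R : Measure 𝒲) := by
  have h1 := (memLp_sqrtDensity_sub P R).mul_const t⁻¹
  have h2 := (memLp_mul_sqrtDensity (absolutelyContinuous_add_left P R) hhm hh).const_mul (1 / 2)
  refine (h1.sub h2).ae_eq (ae_of_all _ fun w => ?_)
  simp only [dqmRemainder, Pi.sub_apply]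
  ring

include hhm hh in
/-- The square of the difference of the root densities is controlled by the remainder and the
score. -/
lemma setIntegral_sq_sqrtDensity_sub_le {t : ℝ} (ht : t ≠ 0) {B : Set 𝒲} (hB : MeasurableSet B) :
    ∫ w in B, (sqrtDensity R (P + R : Measure 𝒲) w
        - sqrtDensity P (P + R : Measure 𝒲) w) ^ 2 ∂(P + R : Measure 𝒲)
      ≤ t ^ 2 * (2 * ∫ w, dqmRemainder P R h t w ^ 2 ∂(P + R : Measure 𝒲)
        + ∫ w in B, h w ^ 2 ∂(P : Measure 𝒲)) := by
  set ν := (P + R : Measure 𝒲)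
  have hac := absolutelyContinuous_add_left P R
  have hr := (memLp_dqmRemainder (R := R) hhm hh t).integrable_sq
  have hs := (memLp_mul_sqrtDensity hac hhm hh).integrable_sq
  have e1 : ∫ w in B, h w ^ 2 ∂(P : Measure 𝒲)
      = ∫ w in B, (h w * sqrtDensity P ν w) ^ 2 ∂ν := by
    rw [← integral_indicator hB, ← integral_indicator hB, ← integral_sq_sqrtDensity_mul hac]
    refine integral_congr_ae (ae_of_all _ fun w => ?_)
    by_cases hw : w ∈ B <;> simp [hw]; ring
  have e2 : ∫ w in B, dqmRemainder P R h t w ^ 2 ∂ν ≤ ∫ w, dqmRemainder P R h t w ^ 2 ∂ν :=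
    setIntegral_le_integral hr (ae_of_all _ fun w => sq_nonneg _)
  calc _ ≤ ∫ w in B, (t ^ 2 * (2 * dqmRemainder P R h t w ^ 2)
        + t ^ 2 * (h w * sqrtDensity P ν w) ^ 2) ∂ν := by
        refine setIntegral_mono_on (memLp_sqrtDensity_sub P R).integrable_sq.integrableOn
          (((hr.const_mul 2).const_mul _).add (hs.const_mul _)).integrableOn hB fun w _ => ?_
        -- The definition of the remainder solved for the difference of the roots; what follows is
        -- `(a + b)² ≤ 2a² + 2b²`, with the factor `1/2` of the score term given away.
        have : sqrtDensity R ν w - sqrtDensity P ν w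
            = t * (dqmRemainder P R h t w + h w / 2 * sqrtDensity P ν w) := by
          simp only [dqmRemainder]; field_simp; ring
        rw [this, mul_pow, ← mul_add]
        refine mul_le_mul_of_nonneg_left ?_ (sq_nonneg _)
        nlinarith [sq_nonneg (dqmRemainder P R h t w - h w / 2 * sqrtDensity P ν w),
          sq_nonneg (h w * sqrtDensity P ν w)]
    _ = t ^ 2 * (2 * ∫ w in B, dqmRemainder P R h t w ^ 2 ∂ν
        + ∫ w in B, (h w * sqrtDensity P ν w) ^ 2 ∂ν) := by
        rw [integral_add ((hr.const_mul 2).const_mul _).integrableOn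
          (hs.const_mul _).integrableOn, integral_const_mul, integral_const_mul,
          integral_const_mul]
        ring
    _ ≤ _ := by
        rw [e1]; gcongr

include hhm hh in
-- Along a differentiable path the squared Hellinger distance is `O(t²)`, so `n` observations with
-- `n t² ≤ 1` accumulate only a bounded amount of it.
lemma sqHellinger_le {t : ℝ} (ht : t ≠ 0) :
    sqHellinger P R ≤ t ^ 2 * (2 * ∫ w, dqmRemainder P R h t w ^ 2 ∂(P + R : Measure 𝒲)
        + ∫ w, h w ^ 2 ∂(P : Measure 𝒲)) := by
  simpa [sqHellinger] using setIntegral_sq_sqrtDensity_sub_le (R := R) hhm hh ht MeasurableSet.univ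

/-- Meant for `k` the sum and the difference of the two root densities: `(a ± b)² ≤ 2(a² + b²)`. -/
lemma integral_sq_mul_sqrtDensity_le {g k : 𝒲 → ℝ} (hgm : Measurable g)
    (hgP : MemLp g 2 (P : Measure 𝒲)) (hgR : MemLp g 2 (R : Measure 𝒲))
    (hk : ∀ w, k w ^ 2 ≤ 2 * (sqrtDensity R (P + R : Measure 𝒲) w ^ 2
      + sqrtDensity P (P + R : Measure 𝒲) w ^ 2)) (hkm : Measurable k) :
    MemLp (fun w => g w * k w) 2 (P + R : Measure 𝒲) ∧
    ∫ w, (g w * k w) ^ 2 ∂(P + R : Measure 𝒲)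
      ≤ 2 * (∫ w, g w ^ 2 ∂(R : Measure 𝒲) + ∫ w, g w ^ 2 ∂(P : Measure 𝒲)) := by
  set ν := (P + R : Measure 𝒲)
  have i1 := (memLp_mul_sqrtDensity (absolutelyContinuous_add_left P R) hgm hgP).integrable_sq
  have i2 := (memLp_mul_sqrtDensity (absolutelyContinuous_add_right P R) hgm hgR).integrable_sq
  have hle : ∀ w, (g w * k w) ^ 2
      ≤ 2 * ((g w * sqrtDensity R ν w) ^ 2 + (g w * sqrtDensity P ν w) ^ 2) := fun w => by
    have := mul_le_mul_of_nonneg_left (hk w) (sq_nonneg (g w))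
    simp only [mul_pow]; linarith
  have i3 : Integrable (fun w => (g w * k w) ^ 2) ν := by
    refine ((i2.add i1).const_mul 2).mono' ((hgm.mul hkm).pow_const 2).aestronglyMeasurable
      (ae_of_all _ fun w => ?_)
    rw [Real.norm_of_nonneg (sq_nonneg _)]
    exact hle w
  refine ⟨(memLp_two_iff_integrable_sq (hgm.mul hkm).aestronglyMeasurable).2 i3, ?_⟩
  refine (integral_mono i3 ((i2.add i1).const_mul 2) hle).trans_eq ?_
  rw [integral_const_mul]
  congr 1
  rw [← integral_sq_mul_sqrtDensity (absolutelyContinuous_add_left P R),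
    ← integral_sq_mul_sqrtDensity (absolutelyContinuous_add_right P R)]
  exact integral_add i2 i1

include hhm hh in
/-- Quantitative differentiability of expectations along a path. -/
lemma abs_integral_sub_div_sub_le {t : ℝ} {g : 𝒲 → ℝ} (hgm : Measurable g)
    (hgP : MemLp g 2 (P : Measure 𝒲)) (hgR : MemLp g 2 (R : Measure 𝒲))
    {B : Set 𝒲} (hB : MeasurableSet B) {M : ℝ} (hM : 0 ≤ M) (hgB : ∀ w ∉ B, |g w| ≤ M) :
    |(∫ w, g w ∂(R : Measure 𝒲) - ∫ w, g w ∂(P : Measure 𝒲)) / t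
        - ∫ w, g w * h w ∂(P : Measure 𝒲)|
      ≤ √(2 * (∫ w, g w ^ 2 ∂(R : Measure 𝒲) + ∫ w, g w ^ 2 ∂(P : Measure 𝒲)))
          * (√(∫ w, dqmRemainder P R h t w ^ 2 ∂(P + R : Measure 𝒲))
            + √(∫ w in B, h w ^ 2 ∂(P : Measure 𝒲)))
        + M * √(sqHellinger P R) * √(∫ w, h w ^ 2 ∂(P : Measure 𝒲)) := by
  set ν := (P + R : Measure 𝒲) with hν
  set sp := sqrtDensity P ν with hsp
  set sq := sqrtDensity R ν with hsq
  set r := dqmRemainder P R h t with hr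
  have hacP := absolutelyContinuous_add_left P R
  have hacR := absolutelyContinuous_add_right P R
  have msp : Measurable sp := measurable_sqrtDensity _ _
  have msq : Measurable sq := measurable_sqrtDensity _ _
  obtain ⟨m1, b1⟩ := integral_sq_mul_sqrtDensity_le (P := P) (R := R) (k := fun w => sq w + sp w)
    hgm hgP hgR (fun w => by nlinarith [sq_nonneg (sq w - sp w)]) (msq.add msp)
  obtain ⟨m2, b2⟩ := integral_sq_mul_sqrtDensity_le (P := P) (R := R) (k := fun w => sq w - sp w)
    hgm hgP hgR (fun w => by nlinarith [sq_nonneg (sq w + sp w)]) (msq.sub msp)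
  have mr : MemLp r 2 ν := memLp_dqmRemainder hhm hh t
  have m3 : MemLp (fun w => B.indicator h w * sp w) 2 ν :=
    memLp_mul_sqrtDensity hacP (hhm.indicator hB) (hh.indicator hB)
  have m4 : MemLp (fun w => h w * sp w) 2 ν := memLp_mul_sqrtDensity hacP hhm hh
  have md : MemLp (fun w => sq w - sp w) 2 ν := memLp_sqrtDensity_sub P R
  have hle5 : ∀ w, |Bᶜ.indicator g w * (sq w - sp w)| ≤ M * |sq w - sp w| := fun w => by
    rw [abs_mul]
    refine mul_le_mul_of_nonneg_right ?_ (abs_nonneg _)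
    by_cases hw : w ∈ B
    · simpa [hw] using hM
    · simpa [hw] using hgB w hw
  have m5 : MemLp (fun w => Bᶜ.indicator g w * (sq w - sp w)) 2 ν :=
    md.of_le_mul (c := M) ((hgm.indicator hB.compl).mul (msq.sub msp)).aestronglyMeasurable
      (ae_of_all _ hle5)
  have b5 : ∫ w, (Bᶜ.indicator g w * (sq w - sp w)) ^ 2 ∂ν ≤ M ^ 2 * sqHellinger P R := by
    rw [sqHellinger, ← integral_const_mul]
    refine integral_mono m5.integrable_sq (md.integrable_sq.const_mul _) fun w => ?_
    have := pow_le_pow_left₀ (abs_nonneg _) (hle5 w) 2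
    simpa only [sq_abs, mul_pow] using this
  have b3 : ∫ w, (B.indicator h w * sp w) ^ 2 ∂ν = ∫ w in B, h w ^ 2 ∂(P : Measure 𝒲) := by
    rw [integral_sq_mul_sqrtDensity hacP, ← integral_indicator hB]
    refine integral_congr_ae (ae_of_all _ fun w => ?_)
    by_cases hw : w ∈ B <;> simp [hw]
  have b4 := integral_sq_mul_sqrtDensity hacP h
  have iP := (integrable_sq_sqrtDensity_mul_iff hacP).2 (hgP.integrable one_le_two)
  have iR := (integrable_sq_sqrtDensity_mul_iff hacR).2 (hgR.integrable one_le_two)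
  have ih : Integrable (fun w => sp w ^ 2 * (g w * h w)) ν :=
    (integrable_sq_sqrtDensity_mul_iff hacP).2 (hgP.integrable_mul hh)
  have iD : Integrable (fun w => (sq w ^ 2 * g w - sp w ^ 2 * g w) / t) ν :=
    (iR.sub iP).div_const t
  have i1 : Integrable (fun w => (g w * (sq w + sp w)) * r w) ν := m1.integrable_mul mr
  have i2 : Integrable (fun w => (g w * (sq w - sp w)) * (B.indicator h w * sp w)) ν :=
    m2.integrable_mul m3
  have i3 : Integrable (fun w => (Bᶜ.indicator g w * (sq w - sp w)) * (h w * sp w)) ν :=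
    m5.integrable_mul m4
  have i4 : Integrable (fun w => 1 / 2 * ((g w * (sq w - sp w)) * (B.indicator h w * sp w)
      + (Bᶜ.indicator g w * (sq w - sp w)) * (h w * sp w))) ν := (i2.add i3).const_mul _
  -- Factor the difference of densities as `(sq - sp)(sq + sp)` and insert the remainder `r`: what
  -- is left besides `g (sq + sp) r` is `½ g (sq - sp) h sp`. This is cut at `B`: on `B` the score
  -- is to be small in `L²`, off `B` the function `g` is bounded by `M` and the Hellinger distance
  -- is small.
  have key : (∫ w, g w ∂(R : Measure 𝒲) - ∫ w, g w ∂(P : Measure 𝒲)) / t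
        - ∫ w, g w * h w ∂(P : Measure 𝒲)
      = ∫ w, (g w * (sq w + sp w)) * r w ∂ν
        + 1 / 2 * (∫ w, (g w * (sq w - sp w)) * (B.indicator h w * sp w) ∂ν
          + ∫ w, (Bᶜ.indicator g w * (sq w - sp w)) * (h w * sp w) ∂ν) := by
    rw [← integral_sq_sqrtDensity_mul hacP, ← integral_sq_sqrtDensity_mul hacR,
      ← integral_sq_sqrtDensity_mul hacP, ← integral_sub iR iP, ← integral_div,
      ← integral_sub iD ih, ← integral_add i2 i3, ← integral_const_mul,
      ← integral_add i1 i4]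
    refine integral_congr_ae (ae_of_all _ fun w => ?_)
    simp only [hr, dqmRemainder, ← hν, ← hsp, ← hsq]
    by_cases hw : w ∈ B <;> simp [hw] <;> ring
  have c1 := abs_integral_mul_le_sqrt m1 mr
  have c2 := abs_integral_mul_le_sqrt m2 m3
  have c3 := abs_integral_mul_le_sqrt m5 m4
  rw [b3] at c2
  rw [b4] at c3
  have d1 := Real.sqrt_le_sqrt b1
  have d2 := Real.sqrt_le_sqrt b2
  have d3 : √(∫ w, (Bᶜ.indicator g w * (sq w - sp w)) ^ 2 ∂ν) ≤ M * √(sqHellinger P R) := by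
    refine (Real.sqrt_le_sqrt b5).trans_eq ?_
    rw [Real.sqrt_mul (sq_nonneg M), Real.sqrt_sq hM]
  rw [key]
  set S := √(2 * (∫ w, g w ^ 2 ∂(R : Measure 𝒲) + ∫ w, g w ^ 2 ∂(P : Measure 𝒲)))
  have e1 := c1.trans (mul_le_mul_of_nonneg_right d1 (Real.sqrt_nonneg _))
  have e2 := c2.trans (mul_le_mul_of_nonneg_right d2 (Real.sqrt_nonneg _))
  have e3 := c3.trans (mul_le_mul_of_nonneg_right d3 (Real.sqrt_nonneg _))
  refine (abs_add_le _ _).trans ?_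
  rw [abs_mul, abs_of_pos (by norm_num : (0 : ℝ) < 1 / 2)]
  have := abs_add_le (∫ w, (g w * (sq w - sp w)) * (B.indicator h w * sp w) ∂ν)
    (∫ w, (Bᶜ.indicator g w * (sq w - sp w)) * (h w * sp w) ∂ν)
  have hn := abs_nonneg (∫ w, (g w * (sq w - sp w)) * (B.indicator h w * sp w) ∂ν)
  have hn' := abs_nonneg (∫ w, (Bᶜ.indicator g w * (sq w - sp w)) * (h w * sp w) ∂ν)
  nlinarith

end Pair

/-- Differentiability in quadratic mean in terms of Bochner integrals. -/
lemma DiffInQuadraticMean.tendsto_integral {P : ProbabilityMeasure 𝒲}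
    {Q : ℝ → ProbabilityMeasure 𝒲} {h : 𝒲 → ℝ} (hQ : DiffInQuadraticMean P Q h)
    (hhm : Measurable h) (hh : MemLp h 2 (P : Measure 𝒲)) :
    Tendsto (fun t => ∫ w, dqmRemainder P (Q t) h t w ^ 2 ∂(P + Q t : Measure 𝒲))
      (𝓝[>] 0) (𝓝 0) := by
  have := (ENNReal.tendsto_toReal ENNReal.zero_ne_top).comp hQ
  refine this.congr fun t => ?_
  rw [integral_eq_lintegral_of_nonneg_ae (ae_of_all _ fun w => sq_nonneg _)
    (memLp_dqmRemainder hhm hh t).integrable_sq.aestronglyMeasurable]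
  rfl

lemma DiffInQuadraticMean.tendsto_sqHellinger {P : ProbabilityMeasure 𝒲}
    {Q : ℝ → ProbabilityMeasure 𝒲} {h : 𝒲 → ℝ} (hQ : DiffInQuadraticMean P Q h)
    (hhm : Measurable h) (hh : MemLp h 2 (P : Measure 𝒲)) :
    Tendsto (fun t => sqHellinger P (Q t)) (𝓝[>] 0) (𝓝 0) := by
  have hρ := hQ.tendsto_integral hhm hh
  have ht : Tendsto (fun t : ℝ => t) (𝓝[>] 0) (𝓝 0) := tendsto_nhdsWithin_of_tendsto_nhds tendsto_id
  have := (ht.pow 2).mul ((hρ.const_mul 2).add_const (∫ w, h w ^ 2 ∂(P : Measure 𝒲)))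
  simp only [ne_eq, OfNat.ofNat_ne_zero, not_false_eq_true, zero_pow, zero_mul] at this
  refine squeeze_zero' (Eventually.of_forall fun t => integral_nonneg fun w => sq_nonneg _) ?_ this
  filter_upwards [self_mem_nhdsWithin] with t ht
  exact sqHellinger_le hhm hh (ne_of_gt ht)

/-- Dominated convergence on sets decreasing to the empty set; it supplies the cut-off `B = {M <
|G|}`. -/
lemma tendsto_setIntegral_sq_lt_abs {P : Measure 𝒲} {G h : 𝒲 → ℝ}
    (hG : Measurable G) (hhm : Measurable h) (hh : MemLp h 2 P) :
    Tendsto (fun M : ℕ => ∫ w in {w | (M : ℝ) < |G w|}, h w ^ 2 ∂P) atTop (𝓝 0) := by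
  have hm : ∀ M : ℕ, MeasurableSet {w | (M : ℝ) < |G w|} := fun M =>
    measurableSet_lt measurable_const hG.norm
  simp_rw [← integral_indicator (hm _)]
  rw [← integral_zero 𝒲 ℝ (μ := P)]
  refine tendsto_integral_of_dominated_convergence (fun w => h w ^ 2)
    (fun M => ((hhm.pow_const 2).indicator (hm M)).aestronglyMeasurable) hh.integrable_sq
    (fun M => ae_of_all _ fun w => ?_) (ae_of_all _ fun w => ?_)
  · refine (norm_indicator_le_norm_self _ _).trans_eq (Real.norm_of_nonneg (sq_nonneg _))
  · refine tendsto_const_nhds.congr' ?_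
    filter_upwards [eventually_ge_atTop ⌈|G w|⌉₊] with M hM
    rw [Set.indicator_of_notMem]
    simpa using (Nat.le_ceil _).trans (Nat.cast_le.2 hM)

/-- Expectations are differentiable along a path that is differentiable in quadratic mean, if the
second moments along the path are bounded. -/
theorem DiffInQuadraticMean.tendsto_integral_sub_div {ι : Type*} {L : Filter ι}
    [L.IsCountablyGenerated]
    {P : ProbabilityMeasure 𝒲} {Q : ℝ → ProbabilityMeasure 𝒲} {h : 𝒲 → ℝ}
    (hQ : DiffInQuadraticMean P Q h) (hhm : Measurable h) (hh : MemLp h 2 (P : Measure 𝒲))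
    {t : ι → ℝ} (ht : Tendsto t L (𝓝[>] 0)) {g : ι → 𝒲 → ℝ} {G g₀ : 𝒲 → ℝ}
    (hgm : ∀ i, Measurable (g i)) (hGm : Measurable G) (hG : MemLp G 2 (P : Measure 𝒲))
    (hgG : ∀ i w, |g i w| ≤ |G w|) (hlim : ∀ w, Tendsto (fun i => g i w) L (𝓝 (g₀ w)))
    {K : ℝ} (hK : ∀ᶠ i in L, MemLp (g i) 2 (Q (t i) : Measure 𝒲) ∧
      ∫ w, g i w ^ 2 ∂(Q (t i) : Measure 𝒲) ≤ K) :
    Tendsto (fun i => (∫ w, g i w ∂(Q (t i) : Measure 𝒲) - ∫ w, g i w ∂(P : Measure 𝒲)) / t i) L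
      (𝓝 (∫ w, g₀ w * h w ∂(P : Measure 𝒲))) := by
  have hgP : ∀ i, MemLp (g i) 2 (P : Measure 𝒲) := fun i =>
    hG.of_le (hgm i).aestronglyMeasurable (ae_of_all _ (hgG i))
  have hmain : Tendsto (fun i => ∫ w, g i w * h w ∂(P : Measure 𝒲)) L
      (𝓝 (∫ w, g₀ w * h w ∂(P : Measure 𝒲))) := by
    refine tendsto_integral_filter_of_dominated_convergence (fun w => |G w| * |h w|)
      (Eventually.of_forall fun i => ((hgm i).mul hhm).aestronglyMeasurable)
      (Eventually.of_forall fun i => ae_of_all _ fun w => ?_) ?_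
      (ae_of_all _ fun w => (hlim w).mul_const _)
    · rw [norm_mul]
      exact mul_le_mul_of_nonneg_right (hgG i w) (abs_nonneg _)
    · exact hG.abs.integrable_mul hh.abs
  set D := fun i => (∫ w, g i w ∂(Q (t i) : Measure 𝒲) - ∫ w, g i w ∂(P : Measure 𝒲)) / t i
    - ∫ w, g i w * h w ∂(P : Measure 𝒲) with hD
  suffices hD0 : Tendsto D L (𝓝 0) by
    have := hD0.add hmain
    simpa [hD] using this
  set S := √(2 * (K + ∫ w, G w ^ 2 ∂(P : Measure 𝒲))) with hS
  set ρ := fun t => ∫ w, dqmRemainder P (Q t) h t w ^ 2 ∂(P + Q t : Measure 𝒲)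
  set τ := fun M : ℕ => ∫ w in {w | (M : ℝ) < |G w|}, h w ^ 2 ∂(P : Measure 𝒲)
  have hbound : ∀ M : ℕ, ∀ᶠ i in L, |D i| ≤ S * (√(ρ (t i)) + √(τ M))
      + M * √(sqHellinger P (Q (t i))) * √(∫ w, h w ^ 2 ∂(P : Measure 𝒲)) := fun M => by
    filter_upwards [hK] with i hi
    refine (abs_integral_sub_div_sub_le hhm hh (hgm i) (hgP i) hi.1
      (measurableSet_lt measurable_const hGm.norm : MeasurableSet {w | (M : ℝ) < |G w|})
      (Nat.cast_nonneg M) fun w hw => (hgG i w).trans (not_lt.1 hw)).trans ?_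
    have hgi : ∫ w, g i w ^ 2 ∂(P : Measure 𝒲) ≤ ∫ w, G w ^ 2 ∂(P : Measure 𝒲) :=
      integral_mono (hgP i).integrable_sq hG.integrable_sq fun w => sq_le_sq.2 (hgG i w)
    have hSi := Real.sqrt_le_sqrt (mul_le_mul_of_nonneg_left (add_le_add hi.2 hgi) zero_le_two)
    exact add_le_add (mul_le_mul_of_nonneg_right hSi (by positivity)) le_rfl
  have hρ : Tendsto (fun i => √(ρ (t i))) L (𝓝 0) := by
    simpa using ((hQ.tendsto_integral hhm hh).comp ht).sqrt
  have hH : Tendsto (fun i => √(sqHellinger P (Q (t i)))) L (𝓝 0) := by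
    simpa using ((hQ.tendsto_sqHellinger hhm hh).comp ht).sqrt
  have hτ : Tendsto (fun M => S * √(τ M)) atTop (𝓝 0) := by
    simpa using (tendsto_setIntegral_sq_lt_abs hGm hhm hh).sqrt.const_mul S
  rw [Metric.tendsto_nhds]
  intro ε hε
  -- The cut-off is fixed before the limit in `i` is taken; the Hellinger term, which carries the
  -- factor `M`, then vanishes.
  obtain ⟨M, hM⟩ := ((tendsto_order.1 hτ).2 ε hε).exists
  have hfin := (((hρ.add_const (√(τ M))).const_mul S)).add
    ((hH.const_mul (M : ℝ)).mul_const (√(∫ w, h w ^ 2 ∂(P : Measure 𝒲))))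
  simp only [zero_add, mul_zero, zero_mul, add_zero] at hfin
  filter_upwards [hbound M, (tendsto_order.1 hfin).2 ε hM] with i h1 h2
  rw [Real.dist_eq, sub_zero]
  exact h1.trans_lt h2

end QuadraticMean

/-! ## Contiguity of product measures -/

section Contiguity

variable {𝒲 : Type*} [MeasurableSpace 𝒲]

lemma lintegral_fin_prod_eq_prod {ν : Measure 𝒲} [SigmaFinite ν] :
    ∀ {n : ℕ} {f : Fin n → 𝒲 → ℝ≥0∞}, (∀ i, Measurable (f i)) →
      ∫⁻ x, ∏ i, f i (x i) ∂(Measure.pi fun _ : Fin n => ν) = ∏ i, ∫⁻ w, f i w ∂ν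
  | 0, f, _ => by simp
  | n + 1, f, hf => by
      have hm : Measurable fun x : Fin (n + 1) → 𝒲 => ∏ i, f i (x i) :=
        Finset.measurable_prod _ fun i _ => (hf i).comp (measurable_pi_apply i)
      rw [← ((measurePreserving_piFinSuccAbove (fun _ => ν) 0).symm).lintegral_comp hm]
      simp_rw [MeasurableEquiv.piFinSuccAbove_symm_apply, Fin.insertNthEquiv,
        Fin.prod_univ_succ, Fin.insertNth_zero, Equiv.coe_fn_mk, Fin.cons_succ, Fin.cons_zero]
      rw [← lintegral_fin_prod_eq_prod (f := fun i : Fin n => f i.succ) fun i => hf _]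
      have hm' : Measurable fun x : Fin n → 𝒲 => ∏ i : Fin n, f i.succ (x i) :=
        Finset.measurable_prod _ fun i _ => (hf _).comp (measurable_pi_apply i)
      exact lintegral_prod_mul (hf 0).aemeasurable hm'.aemeasurable

lemma lintegral_fintype_prod_eq_prod {ν : Measure 𝒲} [SigmaFinite ν] {J : Type*} [Fintype J]
    {f : J → 𝒲 → ℝ≥0∞} (hf : ∀ i, Measurable (f i)) :
    ∫⁻ x, ∏ i, f i (x i) ∂(Measure.pi fun _ : J => ν) = ∏ i, ∫⁻ w, f i w ∂ν := by
  let e := (Fintype.equivFin J).symm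
  have hm : Measurable fun x : J → 𝒲 => ∏ i, f i (x i) :=
    Finset.measurable_prod _ fun i _ => (hf i).comp (measurable_pi_apply i)
  rw [← (measurePreserving_piCongrLeft (fun _ : J => ν) e).lintegral_comp hm, ← e.prod_comp]
  simp_rw [← e.prod_comp (fun i => f i _), MeasurableEquiv.coe_piCongrLeft,
    Equiv.piCongrLeft_apply_apply]
  exact lintegral_fin_prod_eq_prod fun i => hf (e i)

lemma lintegral_fintype_prod_eq_pow {ν : Measure 𝒲} [SigmaFinite ν] {J : Type*} [Fintype J]
    {f : 𝒲 → ℝ≥0∞} (hf : Measurable f) :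
    ∫⁻ x, ∏ i, f (x i) ∂(Measure.pi fun _ : J => ν) = (∫⁻ w, f w ∂ν) ^ Fintype.card J := by
  rw [lintegral_fintype_prod_eq_prod fun _ => hf]
  simp

lemma pi_withDensity {ν : Measure 𝒲} [IsFiniteMeasure ν] {J : Type*} [Fintype J]
    {f : 𝒲 → ℝ≥0∞} (hf : Measurable f) [IsFiniteMeasure (ν.withDensity f)] :
    Measure.pi (fun _ : J => ν.withDensity f)
      = (Measure.pi fun _ : J => ν).withDensity (fun x => ∏ i, f (x i)) := by
  refine Measure.pi_eq fun s hs => ?_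
  rw [withDensity_apply _ (MeasurableSet.univ_pi hs)]
  have h1 : ∀ i, ν.withDensity f (s i) = ∫⁻ w, (s i).indicator f w ∂ν := fun i => by
    rw [withDensity_apply f (hs i), lintegral_indicator (hs i)]
  simp_rw [h1]
  rw [← lintegral_fintype_prod_eq_prod fun i => hf.indicator (hs i),
    ← lintegral_indicator (MeasurableSet.univ_pi hs)]
  refine lintegral_congr fun x => ?_
  by_cases hx : x ∈ Set.univ.pi s
  · rw [Set.indicator_of_mem hx]
    exact Finset.prod_congr rfl fun i _ => (Set.indicator_of_mem (hx i trivial) f).symm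
  · rw [Set.indicator_of_notMem hx]
    simp only [Set.mem_univ_pi, not_forall] at hx
    obtain ⟨i, hi⟩ := hx
    exact (Finset.prod_eq_zero (Finset.mem_univ i) (Set.indicator_of_notMem hi f)).symm

/-- The part of the product of the measure with density `f` that is not dominated by the truncated
density `k` has mass at most `|J| ∫ (f - k)`. The rest is controlled by the Cauchy-Schwarz
inequality. -/
lemma pi_apply_le_of_density {ν P R : Measure 𝒲} [IsFiniteMeasure ν] [IsProbabilityMeasure P]
    [IsProbabilityMeasure R] {p q a : 𝒲 → ℝ≥0∞} (hp : Measurable p) (hq : Measurable q)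
    (ha : Measurable a) (hP : P = ν.withDensity (fun w => p w ^ 2)) (hR : R = ν.withDensity q)
    (haq : ∀ w, p w * a w ≤ q w) {J : Type*} [Fintype J] {E : Set (J → 𝒲)} (hE : MeasurableSet E) :
    Measure.pi (fun _ : J => R) E ≤
      ((Measure.pi (fun _ : J => P) E) ^ (1 / 2 : ℝ)
        * ((∫⁻ w, a w ^ 2 ∂ν) ^ Fintype.card J) ^ (1 / 2 : ℝ))
      + (1 - (∫⁻ w, p w * a w ∂ν) ^ Fintype.card J) := by
  set νJ := Measure.pi fun _ : J => ν
  have hpa : Measurable fun x : J → 𝒲 => ∏ i, p (x i) * a (x i) :=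
    Finset.measurable_prod _ fun i _ => (hp.mul ha).comp (measurable_pi_apply i)
  have hle : ∀ x : J → 𝒲, ∏ i, p (x i) * a (x i) ≤ ∏ i, q (x i) := fun x =>
    Finset.prod_le_prod' fun i _ => haq _
  have hqJ : Measurable fun x : J → 𝒲 => ∏ i, q (x i) :=
    Finset.measurable_prod _ fun i _ => hq.comp (measurable_pi_apply i)
  have : IsFiniteMeasure (ν.withDensity q) := hR ▸ inferInstance
  have : IsFiniteMeasure (ν.withDensity fun w => p w ^ 2) := hP ▸ inferInstance
  have hq1 : ∫⁻ x, ∏ i, q (x i) ∂νJ = 1 := by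
    rw [lintegral_fintype_prod_eq_pow hq]
    have : ∫⁻ w, q w ∂ν = 1 := by
      have := measure_univ (μ := R)
      rwa [hR, withDensity_apply _ MeasurableSet.univ, setLIntegral_univ] at this
    simp [this]
  have hfin : ∫⁻ x, ∏ i, p (x i) * a (x i) ∂νJ ≠ ∞ :=
    ((lintegral_mono hle).trans_lt (hq1 ▸ ENNReal.one_lt_top)).ne
  have e1 : Measure.pi (fun _ : J => R) E = ∫⁻ x in E, ∏ i, q (x i) ∂νJ := by
    rw [hR, pi_withDensity hq, withDensity_apply _ hE]
  have e2 : Measure.pi (fun _ : J => P) E = ∫⁻ x in E, (∏ i, p (x i)) ^ 2 ∂νJ := by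
    rw [hP, pi_withDensity (hp.pow_const 2), withDensity_apply _ hE]
    simp_rw [Finset.prod_pow]
    rfl
  -- Split the product density into its dominated part `∏ p a` and the excess. Cauchy-Schwarz treats
  -- the first; the second is bounded by its mass on the whole space, one minus a product of
  -- integrals.
  have e3 : ∫⁻ x in E, ∏ i, q (x i) ∂νJ = ∫⁻ x in E, ∏ i, p (x i) * a (x i) ∂νJ
      + ∫⁻ x in E, (∏ i, q (x i) - ∏ i, p (x i) * a (x i)) ∂νJ := by
    rw [← lintegral_add_left hpa]
    exact lintegral_congr fun x => (add_tsub_cancel_of_le (hle x)).symm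
  have e4 : ∫⁻ x in E, (∏ i, q (x i) - ∏ i, p (x i) * a (x i)) ∂νJ
      ≤ 1 - (∫⁻ w, p w * a w ∂ν) ^ Fintype.card J := by
    refine (setLIntegral_le_lintegral _ _).trans_eq ?_
    rw [lintegral_sub hpa hfin (ae_of_all _ hle), hq1,
      lintegral_fintype_prod_eq_pow (f := fun w => p w * a w) (hp.mul ha)]
  have e5 : ∫⁻ x in E, ∏ i, p (x i) * a (x i) ∂νJ
      ≤ (∫⁻ x in E, (∏ i, p (x i)) ^ 2 ∂νJ) ^ (1 / 2 : ℝ)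
        * ((∫⁻ w, a w ^ 2 ∂ν) ^ Fintype.card J) ^ (1 / 2 : ℝ) := by
    have h := ENNReal.lintegral_mul_le_Lp_mul_Lq (νJ.restrict E) Real.HolderConjugate.two_two
      (f := fun x => ∏ i, p (x i)) (g := fun x => ∏ i, a (x i))
      (Finset.measurable_prod _ fun i _ => hp.comp (measurable_pi_apply i)).aemeasurable
      (Finset.measurable_prod _ fun i _ => ha.comp (measurable_pi_apply i)).aemeasurable
    simp only [Pi.mul_apply, ← Finset.prod_mul_distrib, ENNReal.rpow_two] at h
    refine h.trans (mul_le_mul' le_rfl (ENNReal.rpow_le_rpow ?_ (by norm_num)))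
    refine (setLIntegral_le_lintegral _ _).trans_eq ?_
    simp_rw [← Finset.prod_pow]
    rw [lintegral_fintype_prod_eq_pow (ha.pow_const 2)]
  rw [e1, e2, e3]
  exact add_le_add e5 e4

lemma withDensity_sq_ofReal_sqrtDensity {R ν : Measure 𝒲} [IsFiniteMeasure R] [IsFiniteMeasure ν]
    (h : R ≪ ν) : ν.withDensity (fun w => ENNReal.ofReal (sqrtDensity R ν w) ^ 2) = R := by
  conv_rhs => rw [← Measure.withDensity_rnDeriv_eq R ν h]
  refine withDensity_congr_ae ?_
  filter_upwards [Measure.rnDeriv_lt_top R ν] with w hw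
  rw [← ENNReal.ofReal_pow (sqrtDensity_nonneg _ _ _), sq_sqrtDensity, ENNReal.ofReal_toReal hw.ne]

/-- The set where the density of `R` is more than twice the density of `P`. -/
def largeRatio (P R : ProbabilityMeasure 𝒲) : Set 𝒲 :=
  {w | 2 * sqrtDensity P (P + R : Measure 𝒲) w ^ 2 < sqrtDensity R (P + R : Measure 𝒲) w ^ 2}

lemma measurableSet_largeRatio (P R : ProbabilityMeasure 𝒲) : MeasurableSet (largeRatio P R) :=
  measurableSet_lt (((measurable_sqrtDensity _ _).pow_const 2).const_mul 2)
    ((measurable_sqrtDensity _ _).pow_const 2)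

lemma integral_sq_sqrtDensity {R : ProbabilityMeasure 𝒲} {ν : Measure 𝒲} [IsFiniteMeasure ν]
    (h : (R : Measure 𝒲) ≪ ν) : ∫ w, sqrtDensity R ν w ^ 2 ∂ν = 1 := by
  simpa using integral_sq_sqrtDensity_mul h fun _ => (1 : ℝ)

/-- On this set the root densities satisfy `q ≥ 1.4 p`, whence `(q - p)² ≥ 0.16 p² ≥ p² / 8`. -/
lemma real_largeRatio_le (P R : ProbabilityMeasure 𝒲) :
    (P : Measure 𝒲).real (largeRatio P R) ≤ 8 * sqHellinger P R := by
  set ν := (P + R : Measure 𝒲) with hν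
  have hB := measurableSet_largeRatio P R
  have hac := absolutelyContinuous_add_left P R
  have hd := (memLp_sqrtDensity_sub P R).integrable_sq
  rw [← integral_indicator_one hB, ← integral_sq_sqrtDensity_mul hac, sqHellinger,
    ← integral_const_mul]
  refine integral_mono ((integrable_sq_sqrtDensity_mul_iff hac).2
    ((integrable_const (1 : ℝ)).indicator hB)) (hd.const_mul 8) fun w => ?_
  simp only
  rw [← hν]
  have hp := sqrtDensity_nonneg P ν w
  have hq := sqrtDensity_nonneg R ν w
  set p := sqrtDensity P ν w
  set q := sqrtDensity R ν w
  by_cases hw : w ∈ largeRatio P R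
  · rw [Set.indicator_of_mem hw]
    have hw' : 2 * p ^ 2 < q ^ 2 := hw
    have h1 : 1.4 * p ≤ q := by
      refine abs_le_of_sq_le_sq' ?_ hq |>.2
      nlinarith
    simp only [Pi.one_apply, mul_one]
    nlinarith
  · rw [Set.indicator_of_notMem hw, mul_zero]
    positivity

/-- Quantitative contiguity of product measures. -/
lemma pi_apply_le (P R : ProbabilityMeasure 𝒲) {J : Type*} [Fintype J] {E : Set (J → 𝒲)}
    (hE : MeasurableSet E) :
    Measure.pi (fun _ : J => (R : Measure 𝒲)) E ≤
      (Measure.pi (fun _ : J => (P : Measure 𝒲)) E) ^ (1 / 2 : ℝ)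
        * (ENNReal.ofReal (Real.exp (Fintype.card J * (8 * sqHellinger P R)))) ^ (1 / 2 : ℝ)
      + ENNReal.ofReal (Fintype.card J * (2 * ∫ w in largeRatio P R,
        (sqrtDensity R (P + R : Measure 𝒲) w - sqrtDensity P (P + R : Measure 𝒲) w) ^ 2
          ∂(P + R : Measure 𝒲))) := by
  set ν := (P + R : Measure 𝒲) with hν
  set p := sqrtDensity P ν with hp
  set q := sqrtDensity R ν with hq
  have hp0 : ∀ w, 0 ≤ p w := sqrtDensity_nonneg _ _
  have hq0 : ∀ w, 0 ≤ q w := sqrtDensity_nonneg _ _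
  have mp : Measurable p := measurable_sqrtDensity _ _
  have mq : Measurable q := measurable_sqrtDensity _ _
  have hacP := absolutelyContinuous_add_left P R
  have hacR := absolutelyContinuous_add_right P R
  have hB := measurableSet_largeRatio P R
  -- Here `p` and `q` are root densities. The density of `R` is truncated at twice that of `P` and
  -- written as `p k`; where `p = 0` the truncated density is zero and so is `k`, by the convention
  -- for division by zero.
  set k : 𝒲 → ℝ := fun w => min (q w ^ 2) (2 * p w ^ 2) / p w with hk
  have mk : Measurable k := ((mq.pow_const 2).min ((mp.pow_const 2).const_mul 2)).div mp
  have hk0 : ∀ w, 0 ≤ k w := fun w => by have := hp0 w; positivity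
  have ip := (memLp_sqrtDensity hacP).integrable_sq
  have iq := (memLp_sqrtDensity hacR).integrable_sq
  have id' := (memLp_sqrtDensity_sub P R).integrable_sq
  have hpk : ∀ w, p w * k w = min (q w ^ 2) (2 * p w ^ 2) := fun w => by
    rcases (hp0 w).eq_or_lt with h0 | h0
    · simp [hk, ← h0, sq_nonneg]
    · simp only [hk]; field_simp
  -- The terms `2q² - p²` integrate to exactly one, so `∫ k² ≤ 1 + 8 H²`, with no term of first
  -- order in `q - p`. If no truncation occurs, `k² - (2q² - p²) = (q - p)² (q + p)² / p²`.
  have hk2 : ∀ w, k w ^ 2 ≤ 2 * q w ^ 2 - p w ^ 2 + 8 * (q w - p w) ^ 2 := fun w => by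
    rcases (hp0 w).eq_or_lt with h0 | h0
    · simp only [hk, ← h0, div_zero]; nlinarith [sq_nonneg (q w)]
    · have h1 : k w ^ 2 = (min (q w ^ 2) (2 * p w ^ 2)) ^ 2 / p w ^ 2 := by simp [hk, div_pow]
      rw [h1, div_le_iff₀ (by positivity)]
      have hqw := hq0 w
      generalize p w = x at *
      generalize q w = y at *
      rcases le_total (y ^ 2) (2 * x ^ 2) with h2 | h2
      · rw [min_eq_left h2]
        have h3 : y ≤ 1.5 * x := by
          refine abs_le_of_sq_le_sq' ?_ (by positivity) |>.2
          nlinarith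
        have h4 : (y + x) ^ 2 ≤ 8 * x ^ 2 := by nlinarith
        nlinarith [mul_le_mul_of_nonneg_left h4 (sq_nonneg (y - x))]
      · rw [min_eq_right h2]
        have h3 : 1.4 * x ≤ y := by
          refine abs_le_of_sq_le_sq' ?_ hqw |>.2
          nlinarith
        have h4 : 4 * x ^ 2 ≤ 2 * y ^ 2 - x ^ 2 + 8 * (y - x) ^ 2 := by nlinarith
        nlinarith [mul_le_mul_of_nonneg_right h4 (sq_nonneg x)]
  have key := pi_apply_le_of_density (ν := ν) (P := P) (R := R) (J := J)
    (p := fun w => ENNReal.ofReal (p w)) (q := fun w => ENNReal.ofReal (q w) ^ 2)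
    (a := fun w => ENNReal.ofReal (k w)) mp.ennreal_ofReal (mq.ennreal_ofReal.pow_const 2)
    mk.ennreal_ofReal (withDensity_sq_ofReal_sqrtDensity hacP).symm
    (withDensity_sq_ofReal_sqrtDensity hacR).symm (fun w => by
      rw [← ENNReal.ofReal_mul (hp0 w), ← ENNReal.ofReal_pow (hq0 w), hpk]
      exact ENNReal.ofReal_le_ofReal (min_le_left _ _)) hE
  refine key.trans (add_le_add (mul_le_mul' le_rfl (ENNReal.rpow_le_rpow ?_ (by norm_num))) ?_)
  · have h1 : ∫⁻ w, ENNReal.ofReal (k w) ^ 2 ∂ν ≤ ENNReal.ofReal (1 + 8 * sqHellinger P R) := by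
      have hint : Integrable (fun w => 2 * q w ^ 2 - p w ^ 2 + 8 * (q w - p w) ^ 2) ν :=
        ((iq.const_mul 2).sub ip).add (id'.const_mul 8)
      have e : ∫ w, (2 * q w ^ 2 - p w ^ 2 + 8 * (q w - p w) ^ 2) ∂ν
          = 1 + 8 * sqHellinger P R := by
        have i1 : Integrable (fun w => 2 * q w ^ 2 - p w ^ 2) ν := (iq.const_mul 2).sub ip
        rw [integral_add i1 (id'.const_mul 8), integral_sub (iq.const_mul 2) ip,
          integral_const_mul, integral_const_mul, integral_sq_sqrtDensity hacP,
          integral_sq_sqrtDensity hacR, sqHellinger]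
        ring
      rw [← e, ofReal_integral_eq_lintegral_ofReal hint
        (ae_of_all _ fun w => (sq_nonneg _).trans (hk2 w))]
      refine lintegral_mono fun w => ?_
      simp only
      rw [← ENNReal.ofReal_pow (hk0 w)]
      exact ENNReal.ofReal_le_ofReal (hk2 w)
    have hH0 : 0 ≤ sqHellinger P R := integral_nonneg fun w => sq_nonneg _
    refine (pow_le_pow_left' h1 _).trans ?_
    rw [← ENNReal.ofReal_pow (by positivity), Real.exp_nat_mul]
    refine ENNReal.ofReal_le_ofReal (pow_le_pow_left₀ (by positivity) ?_ _)
    linarith [Real.add_one_le_exp (8 * sqHellinger P R)]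
  · set δ := 2 * ∫ w in largeRatio P R, (q w - p w) ^ 2 ∂ν with hδ
    have hpk0 : ∀ w, 0 ≤ p w * k w := fun w => mul_nonneg (hp0 w) (hk0 w)
    have ipk : Integrable (fun w => p w * k w) ν := by
      refine iq.mono' (mp.mul mk).aestronglyMeasurable (ae_of_all _ fun w => ?_)
      rw [Real.norm_of_nonneg (hpk0 w), hpk]
      exact min_le_left _ _
    have e1 : ∫⁻ w, ENNReal.ofReal (p w) * ENNReal.ofReal (k w) ∂ν
        = ENNReal.ofReal (∫ w, p w * k w ∂ν) := by
      rw [ofReal_integral_eq_lintegral_ofReal ipk (ae_of_all _ hpk0)]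
      exact lintegral_congr fun w => (ENNReal.ofReal_mul (hp0 w)).symm
    -- The truncation removes mass only on `largeRatio`, where `q² - 2p² ≤ 2(q - p)²`, the defect
    -- being `(q - 2p)²`.
    have e2 : 1 - δ ≤ ∫ w, p w * k w ∂ν := by
      rw [hδ, ← integral_sq_sqrtDensity hacR, ← integral_indicator hB, ← integral_const_mul,
        ← integral_sub iq ((id'.indicator hB).const_mul 2)]
      refine integral_mono (iq.sub ((id'.indicator hB).const_mul 2)) ipk fun w => ?_
      simp only
      rw [hpk]
      by_cases hw : w ∈ largeRatio P R
      · have hw' : 2 * p w ^ 2 < q w ^ 2 := hw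
        rw [Set.indicator_of_mem hw, min_eq_right hw'.le]
        nlinarith [sq_nonneg (q w - 2 * p w)]
      · have hw' : q w ^ 2 ≤ 2 * p w ^ 2 := not_lt.1 hw
        rw [Set.indicator_of_notMem hw, min_eq_left hw']
        simp [hq, hν]
    have e3 : 0 ≤ ∫ w, p w * k w ∂ν := integral_nonneg hpk0
    rw [e1, ← ENNReal.ofReal_pow e3, ← ENNReal.ofReal_one, ← ENNReal.ofReal_sub _ (by positivity)]
    refine ENNReal.ofReal_le_ofReal ?_
    -- Bernoulli's inequality makes the lost mass of the product at most the number of factors times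
    -- `δ`.
    have := one_add_mul_le_pow (a := (∫ w, p w * k w ∂ν) - 1) (by linarith) (Fintype.card J)
    rw [add_sub_cancel] at this
    nlinarith [mul_le_mul_of_nonneg_left e2 (Nat.cast_nonneg (α := ℝ) (Fintype.card J))]

/-- Contiguity: along a path that is differentiable in quadratic mean, local alternatives cannot be
distinguished with certainty from `P` in the limit. -/
theorem DiffInQuadraticMean.tendsto_pi_zero {ι : Type*} {L : Filter ι}
    {P : ProbabilityMeasure 𝒲} {Q : ℝ → ProbabilityMeasure 𝒲} {h : 𝒲 → ℝ}
    (hQ : DiffInQuadraticMean P Q h) (hhm : Measurable h) (hh : MemLp h 2 (P : Measure 𝒲))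
    {t : ι → ℝ} (ht : Tendsto t L (𝓝[>] 0)) {J : ι → Type*} [∀ i, Fintype (J i)]
    (hJ : ∀ᶠ i in L, (Fintype.card (J i) : ℝ) * t i ^ 2 ≤ 1) {E : ∀ i, Set (J i → 𝒲)}
    (hE : Tendsto (fun i => Measure.pi (fun _ : J i => (P : Measure 𝒲)) (E i)) L (𝓝 0)) :
    Tendsto (fun i => Measure.pi (fun _ : J i => (Q (t i) : Measure 𝒲)) (E i)) L (𝓝 0) := by
  set ρ := fun s => ∫ w, dqmRemainder P (Q s) h s w ^ 2 ∂(P + Q s : Measure 𝒲) with hρdef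
  set I := ∫ w, h w ^ 2 ∂(P : Measure 𝒲)
  have hρ : Tendsto (fun i => ρ (t i)) L (𝓝 0) := (hQ.tendsto_integral hhm hh).comp ht
  have hH : Tendsto (fun i => 8 * sqHellinger P (Q (t i))) L (𝓝 0) := by
    simpa using ((hQ.tendsto_sqHellinger hhm hh).comp ht).const_mul 8
  have hPB : Tendsto (fun i => (P : Measure 𝒲) (largeRatio P (Q (t i)))) L (𝓝 0) := by
    have h1 : Tendsto (fun i => (P : Measure 𝒲).real (largeRatio P (Q (t i)))) L (𝓝 0) :=
      squeeze_zero (fun _ => measureReal_nonneg) (fun i => real_largeRatio_le P (Q (t i))) hH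
    have h2 := ENNReal.tendsto_ofReal h1
    simpa using h2
  -- The sets of large ratio become null under `P`, so the integral of `h²` over them vanishes. This
  -- is what turns the truncated mass `O(n t²)` into `o(1)`.
  have hIB : Tendsto (fun i => ∫ w in largeRatio P (Q (t i)), h w ^ 2 ∂(P : Measure 𝒲)) L (𝓝 0) :=
    hh.integrable_sq.tendsto_setIntegral_nhds_zero hPB
  have hδ : Tendsto (fun i => ENNReal.ofReal (2 * (2 * ρ (t i)
      + ∫ w in largeRatio P (Q (t i)), h w ^ 2 ∂(P : Measure 𝒲)))) L (𝓝 0) := by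
    have := ENNReal.tendsto_ofReal (((hρ.const_mul 2).add hIB).const_mul 2)
    simpa using this
  set C := ENNReal.ofReal (Real.exp (8 * (2 + I))) ^ (1 / 2 : ℝ)
  have hmain : Tendsto (fun i => (Measure.pi (fun _ : J i => (P : Measure 𝒲)) (E i)) ^ (1 / 2 : ℝ)
      * C) L (𝓝 0) := by
    have h1 := ((ENNReal.continuous_rpow_const (y := (1 / 2 : ℝ))).tendsto 0).comp hE
    have h2 := ENNReal.Tendsto.mul_const (b := C) h1 (Or.inr (by simp [C]))
    simpa using h2
  have hsum := hmain.add hδ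
  rw [add_zero] at hsum
  have htpos : ∀ᶠ i in L, 0 < t i := ht.eventually self_mem_nhdsWithin
  refine tendsto_of_tendsto_of_tendsto_of_le_of_le' tendsto_const_nhds hsum
    (Eventually.of_forall fun _ => bot_le) ?_
  filter_upwards [hJ, htpos, (tendsto_order.1 hρ).2 1 one_pos] with i hi hti hρi
  have hρ0 : 0 ≤ ρ (t i) := integral_nonneg fun _ => sq_nonneg _
  set N := (Fintype.card (J i) : ℝ)
  have hN : 0 ≤ N := Nat.cast_nonneg _
  -- `E i` need not be measurable: it is enlarged to a measurable hull of the same mass under `P`.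
  refine (measure_mono (subset_toMeasurable (Measure.pi fun _ : J i => (P : Measure 𝒲)) _)).trans ?_
  refine (pi_apply_le P (Q (t i)) (measurableSet_toMeasurable _ _)).trans ?_
  rw [measure_toMeasurable]
  refine add_le_add (mul_le_mul' le_rfl (ENNReal.rpow_le_rpow (ENNReal.ofReal_le_ofReal
    (Real.exp_le_exp.2 ?_)) (by norm_num))) (ENNReal.ofReal_le_ofReal ?_)
  · have h1 := sqHellinger_le (R := Q (t i)) hhm hh hti.ne'
    have h2 : N * sqHellinger P (Q (t i)) ≤ N * t i ^ 2 * (2 * ρ (t i) + I) := by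
      rw [mul_assoc]; exact mul_le_mul_of_nonneg_left h1 hN
    have hI : 0 ≤ I := integral_nonneg fun _ => sq_nonneg _
    have h3 := mul_le_mul_of_nonneg_right hi (by positivity : 0 ≤ 2 * ρ (t i) + I)
    linarith
  · have h1 := setIntegral_sq_sqrtDensity_sub_le (R := Q (t i)) hhm hh hti.ne'
      (measurableSet_largeRatio P (Q (t i)))
    set IB := ∫ w in largeRatio P (Q (t i)), h w ^ 2 ∂(P : Measure 𝒲)
    have hIB : 0 ≤ IB := integral_nonneg fun _ => sq_nonneg _
    have h2 := mul_le_mul_of_nonneg_left h1 hN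
    rw [← mul_assoc] at h2
    have h3 := mul_le_mul_of_nonneg_right hi (by positivity : 0 ≤ 2 * ρ (t i) + IB)
    linarith

end Contiguity

/-! ## Characteristic functions along local alternatives -/

section CharFun

lemma norm_pow_sub_pow_le_nat_mul {a b : ℂ} (ha : ‖a‖ ≤ 1) (hb : ‖b‖ ≤ 1) (n : ℕ) :
    ‖a ^ n - b ^ n‖ ≤ n * ‖a - b‖ := by
  induction n with
  | zero => simp
  | succ n ih =>
    have e : a ^ (n + 1) - b ^ (n + 1) = a ^ n * (a - b) + (a ^ n - b ^ n) * b := by ring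
    rw [e]
    refine (norm_add_le _ _).trans ?_
    rw [norm_mul, norm_mul, norm_pow]
    have h1 : ‖a‖ ^ n * ‖a - b‖ ≤ 1 * ‖a - b‖ :=
      mul_le_mul_of_nonneg_right (pow_le_one₀ (norm_nonneg _) ha) (norm_nonneg _)
    have h2 : ‖a ^ n - b ^ n‖ * ‖b‖ ≤ n * ‖a - b‖ * 1 :=
      mul_le_mul ih hb (norm_nonneg _) (by positivity)
    push_cast
    linarith

/-- Powers of characteristic functions with a quadratic expansion converge. -/
lemma tendsto_pow_of_tendsto_nat_mul_sub_one {ι : Type*} {L : Filter ι} {n : ι → ℕ}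
    (hn : Tendsto n L atTop) {w : ι → ℂ} (hw : ∀ i, ‖w i‖ ≤ 1) {s : ℝ} (hs : 0 ≤ s)
    (h : Tendsto (fun i => (n i : ℂ) * (w i - 1)) L (𝓝 (-(s : ℂ)))) :
    Tendsto (fun i => w i ^ n i) L (𝓝 (Complex.exp (-(s : ℂ)))) := by
  have hnR : Tendsto (fun i => (n i : ℝ)) L atTop := tendsto_natCast_atTop_atTop.comp hn
  have hpos : ∀ᶠ i in L, 0 < n i := hn.eventually (eventually_gt_atTop 0)
  have hsn : Tendsto (fun i => s ^ 2 / (n i : ℝ)) L (𝓝 0) := tendsto_const_nhds.div_atTop hnR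
  have hs1 : ∀ᶠ i in L, s / (n i : ℝ) ≤ 1 :=
    (tendsto_order.1 (tendsto_const_nhds.div_atTop hnR)).2 1 one_pos |>.mono fun _ h => h.le
  -- The comparison sequence `exp(-s / n)` has `n`-th power exactly `exp(-s)` and the same
  -- first-order expansion as `w`; since all numbers lie in the unit disc, `n`-th powers differ by
  -- at most `n |w - b|`, and no logarithm is needed.
  set b : ι → ℂ := fun i => Complex.exp (-((s / (n i : ℝ) : ℝ) : ℂ)) with hb
  have hb1 : ∀ i, ‖b i‖ ≤ 1 := fun i => by
    simp only [hb, ← Complex.ofReal_neg, Complex.norm_exp_ofReal]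
    exact Real.exp_le_one_iff.2 (by have : 0 ≤ s / (n i : ℝ) := by positivity
                                    linarith)
  have hbn : Tendsto (fun i => (n i : ℂ) * (b i - 1)) L (𝓝 (-(s : ℂ))) := by
    rw [tendsto_iff_norm_sub_tendsto_zero]
    refine squeeze_zero' (Eventually.of_forall fun _ => norm_nonneg _) ?_ hsn
    filter_upwards [hpos, hs1] with i hi h1
    have hn0 : (0 : ℝ) < n i := by exact_mod_cast hi
    have hn0' : (n i : ℂ) ≠ 0 := by exact_mod_cast hi.ne'
    have h0 : 0 ≤ s / (n i : ℝ) := by positivity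
    have hx : ‖-((s / (n i : ℝ) : ℝ) : ℂ)‖ = s / (n i : ℝ) := by
      rw [norm_neg, Complex.norm_real, Real.norm_of_nonneg h0]
    have h2 := Complex.norm_exp_sub_one_sub_id_le (hx.trans_le h1)
    rw [hx] at h2
    have e : (n i : ℂ) * (b i - 1) - -(s : ℂ)
        = (n i : ℂ) * (b i - 1 - -((s / (n i : ℝ) : ℝ) : ℂ)) := by
      push_cast; field_simp
    rw [e, norm_mul, Complex.norm_natCast]
    refine (mul_le_mul_of_nonneg_left h2 hn0.le).trans_eq ?_
    field_simp
  have hlim : Tendsto (fun i => w i ^ n i - b i ^ n i) L (𝓝 0) := by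
    rw [tendsto_zero_iff_norm_tendsto_zero]
    have h3 := (h.sub hbn).norm
    rw [sub_self, norm_zero] at h3
    refine squeeze_zero (fun _ => norm_nonneg _) (fun i => ?_) h3
    refine (norm_pow_sub_pow_le_nat_mul (hw i) (hb1 i) (n i)).trans_eq ?_
    rw [← mul_sub, norm_mul, Complex.norm_natCast, sub_sub_sub_cancel_right]
  have hbpow : Tendsto (fun i => b i ^ n i) L (𝓝 (Complex.exp (-(s : ℂ)))) := by
    refine tendsto_const_nhds.congr' ?_
    filter_upwards [hpos] with i hi
    have hn0' : (n i : ℂ) ≠ 0 := by exact_mod_cast hi.ne'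
    rw [hb, ← Complex.exp_nat_mul]
    congr 1
    push_cast; field_simp
  simpa using hlim.add hbpow

lemma charFun_map_eq_integral {Ω : Type*} {mΩ : MeasurableSpace Ω} {μ : Measure Ω} {X : Ω → ℝ}
    (hX : AEMeasurable X μ) (u : ℝ) :
    charFun (μ.map X) u = ∫ s, Complex.exp ((u * X s : ℝ) * Complex.I) ∂μ := by
  rw [charFun_apply_real, integral_map hX (by fun_prop)]
  push_cast
  rfl

lemma charFun_gaussianReal_toNNReal {v : ℝ} (hv : 0 ≤ v) (u : ℝ) :
    charFun (gaussianReal 0 v.toNNReal) u = Complex.exp (-((u ^ 2 * v / 2 : ℝ) : ℂ)) := by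
  rw [charFun_gaussianReal, Real.coe_toNNReal _ hv]
  congr 1
  push_cast
  ring

/-- Convergence to a centered Gaussian distribution, through characteristic functions, along a
countably generated filter. -/
lemma tendstoInDistribution_gaussianReal_of_tendsto {ι : Type*} {L : Filter ι}
    [L.IsCountablyGenerated] {Ω : ι → Type*} {mΩ : ∀ i, MeasurableSpace (Ω i)}
    {μ : (i : ι) → Measure (Ω i)} [∀ i, IsProbabilityMeasure (μ i)] {X : (i : ι) → Ω i → ℝ}
    (hX : ∀ i, AEMeasurable (X i) (μ i)) {v : ℝ} (hv : 0 ≤ v)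
    (h : ∀ u : ℝ, Tendsto (fun i => ∫ s, Complex.exp ((u * X i s : ℝ) * Complex.I) ∂(μ i)) L
      (𝓝 (Complex.exp (-((u ^ 2 * v / 2 : ℝ) : ℂ))))) :
    TendstoInDistribution X L (id : ℝ → ℝ) μ (gaussianReal 0 v.toNNReal) := by
  refine ⟨hX, aemeasurable_id, ?_⟩
  -- Along a countably generated filter it suffices to test sequences, to which Lévy's continuity
  -- theorem applies.
  refine tendsto_of_seq_tendsto fun x hx => ?_
  refine ProbabilityMeasure.tendsto_iff_tendsto_charFun.2 fun u => ?_
  simp only [ProbabilityMeasure.coe_mk, Measure.map_id]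
  rw [charFun_gaussianReal_toNNReal hv]
  exact ((h u).comp hx).congr fun k => (charFun_map_eq_integral (hX (x k)) u).symm

lemma TendstoInDistribution.tendsto_integral_exp {ι : Type*} {L : Filter ι} {Ω : ι → Type*}
    {mΩ : ∀ i, MeasurableSpace (Ω i)}
    {μ : (i : ι) → Measure (Ω i)} [∀ i, IsProbabilityMeasure (μ i)] {X : (i : ι) → Ω i → ℝ}
    {v : ℝ} (hv : 0 ≤ v)
    (h : TendstoInDistribution X L (id : ℝ → ℝ) μ (gaussianReal 0 v.toNNReal)) (u : ℝ) :
    Tendsto (fun i => ∫ s, Complex.exp ((u * X i s : ℝ) * Complex.I) ∂(μ i)) L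
      (𝓝 (Complex.exp (-((u ^ 2 * v / 2 : ℝ) : ℂ)))) := by
  have h1 := (ProbabilityMeasure.tendsto_iff_forall_integral_rclike_tendsto ℂ).1 h.tendsto
    (BoundedContinuousFunction.innerProbChar u)
  simp only [ProbabilityMeasure.coe_mk, Measure.map_id, ← charFun_eq_integral_innerProbChar] at h1
  rw [charFun_gaussianReal_toNNReal hv] at h1
  exact h1.congr fun i => charFun_map_eq_integral (h.forall_aemeasurable i) u

/-- Characteristic functions of variables whose difference tends to zero in probability have the
same limit. -/
lemma tendsto_integral_exp_sub {ι : Type*} {L : Filter ι} {Ω : ι → Type*}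
    {mΩ : ∀ i, MeasurableSpace (Ω i)}
    {μ : (i : ι) → Measure (Ω i)} [∀ i, IsProbabilityMeasure (μ i)] {X Y : (i : ι) → Ω i → ℝ}
    (hX : ∀ i, AEMeasurable (X i) (μ i)) (hY : ∀ i, AEMeasurable (Y i) (μ i))
    (h : ∀ ε : ℝ, 0 < ε → Tendsto (fun i => μ i {s | ε < |X i s - Y i s|}) L (𝓝 0)) (u : ℝ) :
    Tendsto (fun i => ∫ s, Complex.exp ((u * X i s : ℝ) * Complex.I) ∂(μ i)
      - ∫ s, Complex.exp ((u * Y i s : ℝ) * Complex.I) ∂(μ i)) L (𝓝 0) := by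
  have hint : ∀ (i : ι) (Z : Ω i → ℝ), AEMeasurable Z (μ i) →
      Integrable (fun s => Complex.exp ((u * Z s : ℝ) * Complex.I)) (μ i) := fun i Z hZ => by
    refine (integrable_const (1 : ℝ)).mono' ?_ (ae_of_all _ fun s => ?_)
    · exact AEMeasurable.aestronglyMeasurable (by fun_prop)
    · rw [Complex.norm_exp_ofReal_mul_I]
  -- Split on the event `ε < |X - Y|`: there the integrands differ by at most `2`, elsewhere by at
  -- most `|u| ε` because `x ↦ exp(i x)` is `1`-Lipschitz.
  have hb : ∀ ε : ℝ, 0 < ε → ∀ i, ‖∫ s, Complex.exp ((u * X i s : ℝ) * Complex.I) ∂(μ i)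
      - ∫ s, Complex.exp ((u * Y i s : ℝ) * Complex.I) ∂(μ i)‖
      ≤ |u| * ε + 2 * (μ i).real {s | ε < |X i s - Y i s|} := fun ε hε i => by
    have hS : NullMeasurableSet {s | ε < |X i s - Y i s|} (μ i) :=
      nullMeasurableSet_lt aemeasurable_const ((hX i).sub (hY i)).norm
    rw [← integral_sub (hint i _ (hX i)) (hint i _ (hY i))]
    refine (norm_integral_le_integral_norm _).trans ?_
    have e : |u| * ε + 2 * (μ i).real {s | ε < |X i s - Y i s|}
        = ∫ s, (|u| * ε + 2 * ({s | ε < |X i s - Y i s|}).indicator (fun _ => (1 : ℝ)) s)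
          ∂(μ i) := by
      rw [integral_add (integrable_const _)
        (((integrable_const (1 : ℝ)).indicator₀ hS).const_mul 2), integral_const_mul (2 : ℝ),
        integral_indicator₀ hS]
      simp
    rw [e]
    refine integral_mono ((hint i _ (hX i)).sub (hint i _ (hY i))).norm ((integrable_const _).add
        (((integrable_const (1 : ℝ)).indicator₀ hS).const_mul 2)) fun s => ?_
    simp only
    by_cases hs : ε < |X i s - Y i s|
    · rw [Set.indicator_of_mem (by exact hs)]
      refine (norm_sub_le _ _).trans ?_
      rw [Complex.norm_exp_ofReal_mul_I, Complex.norm_exp_ofReal_mul_I]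
      have := mul_nonneg (abs_nonneg u) hε.le
      linarith
    · rw [Set.indicator_of_notMem (by exact hs), mul_zero, add_zero]
      have e2 : Complex.exp ((u * X i s : ℝ) * Complex.I)
          - Complex.exp ((u * Y i s : ℝ) * Complex.I)
          = Complex.exp ((u * Y i s : ℝ) * Complex.I)
            * (Complex.exp (Complex.I * (u * (X i s - Y i s) : ℝ)) - 1) := by
        rw [mul_sub, ← Complex.exp_add, mul_one]
        congr 2
        push_cast; ring
      rw [e2, norm_mul, Complex.norm_exp_ofReal_mul_I, one_mul]
      refine Real.norm_exp_I_mul_ofReal_sub_one_le.trans ?_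
      rw [Real.norm_eq_abs, abs_mul]
      exact mul_le_mul_of_nonneg_left (not_lt.1 hs) (abs_nonneg _)
  rw [Metric.tendsto_nhds]
  intro δ hδ
  set ε := δ / (2 * (|u| + 1)) with hεd
  have hε : 0 < ε := by positivity
  have hm : Tendsto (fun i => 2 * (μ i).real {s | ε < |X i s - Y i s|}) L (𝓝 0) := by
    have := ((ENNReal.tendsto_toReal ENNReal.zero_ne_top).comp (h ε hε)).const_mul 2
    rwa [ENNReal.toReal_zero, mul_zero] at this
  filter_upwards [(tendsto_order.1 hm).2 (δ / 2) (by positivity)] with i hi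
  rw [dist_zero_right]
  have h1 : |u| * ε ≤ δ / 2 := by
    rw [hεd, mul_div_assoc', div_le_div_iff₀ (by positivity) (by positivity)]
    nlinarith [abs_nonneg u]
  linarith [hb ε hε i]

/-- Second-order expansion of the characteristic function of a centered variable. -/
lemma tendsto_nat_mul_charFun_sub_one {Ω : Type*} {mΩ : MeasurableSpace Ω} {P : Measure Ω}
    [IsProbabilityMeasure P] {f : Ω → ℝ} (hfm : Measurable f) (hf : MemLp f 2 P)
    (hf0 : ∫ w, f w ∂P = 0) (u : ℝ) {ι : Type*} {L : Filter ι} {a : ι → ℝ}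
    (ha : Tendsto a L atTop) :
    Tendsto (fun i => ((a i ^ 2 : ℝ) : ℂ) *
      (∫ w, Complex.exp ((u / a i * f w : ℝ) * Complex.I) ∂P - 1)) L
      (𝓝 (-((u ^ 2 * (∫ w, f w ^ 2 ∂P) / 2 : ℝ) : ℂ))) := by
  have hPm : IsProbabilityMeasure (P.map f) := Measure.isProbabilityMeasure_map hfm.aemeasurable
  have hid : MemLp id 2 (P.map f) := (memLp_map_measure_iff (by fun_prop) hfm.aemeasurable).2 hf
  -- Two moments make the characteristic function twice continuously differentiable; Taylor's
  -- formula at `0` with little-o remainder is the expansion sought.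
  have hT : (fun t : ℝ => charFun (P.map f) t - taylorWithinEval (charFun (P.map f)) 2 Set.univ 0 t)
      =o[𝓝 0] fun t => (t - 0) ^ 2 := taylor_isLittleO_univ (contDiff_charFun hid)
  have hua : Tendsto (fun i => u / a i) L (𝓝 0) := tendsto_const_nhds.div_atTop ha
  have hpos : ∀ᶠ i in L, 0 < a i := ha.eventually (eventually_gt_atTop 0)
  have h1 : Tendsto (fun i => ((a i ^ 2 : ℝ) : ℂ) * (charFun (P.map f) (u / a i)
      - taylorWithinEval (charFun (P.map f)) 2 Set.univ 0 (u / a i))) L (𝓝 0) := by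
    rw [Metric.tendsto_nhds]
    intro δ hδ
    -- Since `a² (u / a)² = u²`, this constant leaves a final error below `δ`; the `+ 1` covers `u =
    -- 0`.
    have h2 := (hT.comp_tendsto hua).def (c := δ / (2 * (u ^ 2 + 1))) (by positivity)
    filter_upwards [h2, hpos] with i hi hai
    simp only [Function.comp_apply, sub_zero] at hi
    rw [dist_zero_right, norm_mul, Complex.norm_real, Real.norm_of_nonneg (sq_nonneg _)]
    refine (mul_le_mul_of_nonneg_left hi (sq_nonneg _)).trans_lt ?_
    rw [Real.norm_of_nonneg (sq_nonneg _)]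
    have e : a i ^ 2 * (δ / (2 * (u ^ 2 + 1)) * (u / a i) ^ 2)
        = δ * (u ^ 2 / (2 * (u ^ 2 + 1))) := by field_simp
    rw [e]
    have : u ^ 2 / (2 * (u ^ 2 + 1)) < 1 := by
      rw [div_lt_one (by positivity)]; nlinarith [sq_nonneg u]
    nlinarith
  have h3 := h1.add_const (-((u ^ 2 * (∫ w, f w ^ 2 ∂P) / 2 : ℝ) : ℂ))
  rw [zero_add] at h3
  refine h3.congr' ?_
  filter_upwards [hpos] with i hai
  have hai' : (a i : ℂ) ≠ 0 := by exact_mod_cast hai.ne'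
  rw [taylorWithinEval_charFun_two_zero hfm.aemeasurable hid, hf0,
    charFun_map_eq_integral hfm.aemeasurable]
  simp only [Pi.pow_apply]
  generalize ∫ w, Complex.exp ((u / a i * f w : ℝ) * Complex.I) ∂P = Z
  push_cast
  field_simp
  ring

end CharFun

/-! ### Le Cam's third lemma for i.i.d. sums -/

section LocalAlternatives

variable {𝒲 : Type*} [MeasurableSpace 𝒲]

/-- A second-moment bound under `R` for a bounded function, in terms of the Hellinger distance. -/
lemma integral_sq_le_of_bounded (P R : ProbabilityMeasure 𝒲) {g : 𝒲 → ℝ} (hg : Measurable g)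
    {M : ℝ} (hgM : ∀ w, |g w| ≤ M) :
    ∫ w, g w ^ 2 ∂(R : Measure 𝒲)
      ≤ 2 * ∫ w, g w ^ 2 ∂(P : Measure 𝒲) + 2 * M ^ 2 * sqHellinger P R := by
  set ν := (P + R : Measure 𝒲) with hν
  have hacP := absolutelyContinuous_add_left P R
  have hacR := absolutelyContinuous_add_right P R
  have hgb : ∀ R : ProbabilityMeasure 𝒲, Integrable (fun w => g w ^ 2) (R : Measure 𝒲) := fun R =>
    ((MemLp.of_bound hg.aestronglyMeasurable M (ae_of_all _ hgM) :
      MemLp g 2 (R : Measure 𝒲))).integrable_sq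
  have hd := (memLp_sqrtDensity_sub P R).integrable_sq
  have i1 := (integrable_sq_sqrtDensity_mul_iff hacP).2 (hgb P)
  have i2 := (integrable_sq_sqrtDensity_mul_iff hacR).2 (hgb R)
  rw [← integral_sq_sqrtDensity_mul hacP, ← integral_sq_sqrtDensity_mul hacR, sqHellinger,
    ← integral_const_mul, ← integral_const_mul, ← integral_add (i1.const_mul 2)
      (hd.const_mul (2 * M ^ 2))]
  refine integral_mono i2 ((i1.const_mul 2).add (hd.const_mul (2 * M ^ 2))) fun w => ?_
  simp only
  have h1 : g w ^ 2 ≤ M ^ 2 := by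
    have := pow_le_pow_left₀ (abs_nonneg _) (hgM w) 2
    rwa [sq_abs] at this
  set p := sqrtDensity P (P + R : Measure 𝒲) w
  set q := sqrtDensity R (P + R : Measure 𝒲) w
  -- With `p`, `q` the root densities, `q² ≤ 2p² + 2(q - p)²` with defect `(q - 2p)²`; `g²` is
  -- replaced by `M²` only in front of `(q - p)²`.
  nlinarith [mul_le_mul_of_nonneg_right h1 (sq_nonneg (q - p)),
    mul_nonneg (sq_nonneg (g w)) (sq_nonneg (q - 2 * p))]

/-- The imaginary part of `a (exp(i x / a) - 1)` tends to `x`; the companion lemmas treat the real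
part, which tends to zero, and give the bounds `|x|` and `2a` used to differentiate the means of
both parts along a path. -/
lemma tendsto_mul_sin_div {ι : Type*} {L : Filter ι} {a : ι → ℝ} (ha : Tendsto a L atTop) (x : ℝ) :
    Tendsto (fun i => a i * Real.sin (x / a i)) L (𝓝 x) := by
  have h := (Real.continuous_sinc.tendsto 0).comp (tendsto_const_nhds.div_atTop ha : Tendsto
    (fun i => x / a i) L (𝓝 0))
  have h2 := h.const_mul x
  rw [Real.sinc_zero, mul_one] at h2
  refine h2.congr' ?_
  filter_upwards [ha.eventually (eventually_gt_atTop 0)] with i hi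
  rcases eq_or_ne x 0 with rfl | hx
  · simp
  · rw [Function.comp_apply, Real.sinc_of_ne_zero (div_ne_zero hx hi.ne')]
    field_simp

lemma tendsto_mul_cos_div_sub_one {ι : Type*} {L : Filter ι} {a : ι → ℝ} (ha : Tendsto a L atTop)
    (x : ℝ) : Tendsto (fun i => a i * (Real.cos (x / a i) - 1)) L (𝓝 0) := by
  have h1 : Tendsto (fun i => x ^ 2 / 2 / a i) L (𝓝 0) := tendsto_const_nhds.div_atTop ha
  refine squeeze_zero_norm' ?_ h1
  filter_upwards [ha.eventually (eventually_gt_atTop 0)] with i hi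
  have h2 := Real.one_sub_sq_div_two_le_cos (x := x / a i)
  have h3 := Real.cos_le_one (x / a i)
  rw [norm_mul, Real.norm_of_nonneg hi.le, Real.norm_of_nonpos (by linarith)]
  refine (mul_le_mul_of_nonneg_left (by linarith : _ ≤ (x / a i) ^ 2 / 2) hi.le).trans_eq ?_
  field_simp

lemma abs_mul_sin_div_le {a : ℝ} (ha : 0 ≤ a) (x : ℝ) : |a * Real.sin (x / a)| ≤ |x| := by
  rcases ha.eq_or_lt with rfl | h
  · simp
  · rw [abs_mul, abs_of_pos h]
    refine (mul_le_mul_of_nonneg_left Real.abs_sin_le_abs h.le).trans_eq ?_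
    rw [abs_div, abs_of_pos h]; field_simp

lemma abs_mul_cos_div_sub_one_le {a : ℝ} (ha : 0 ≤ a) (x : ℝ) :
    |a * (Real.cos (x / a) - 1)| ≤ |x| := by
  rcases ha.eq_or_lt with rfl | h
  · simp
  · rw [abs_mul, abs_of_pos h]
    have := Real.abs_cos_sub_cos_le (x / a) 0
    rw [Real.cos_zero, sub_zero] at this
    refine (mul_le_mul_of_nonneg_left this h.le).trans_eq ?_
    rw [abs_div, abs_of_pos h]; field_simp

lemma abs_mul_sin_le {a : ℝ} (ha : 0 ≤ a) (x : ℝ) : |a * Real.sin x| ≤ 2 * a := by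
  rw [abs_mul, abs_of_nonneg ha]
  nlinarith [Real.abs_sin_le_one x]

lemma abs_mul_cos_sub_one_le {a : ℝ} (ha : 0 ≤ a) (x : ℝ) : |a * (Real.cos x - 1)| ≤ 2 * a := by
  rw [abs_mul, abs_of_nonneg ha, abs_sub_comm, abs_of_nonneg (by linarith [Real.cos_le_one x])]
  nlinarith [Real.neg_one_le_cos x]

variable {P : ProbabilityMeasure 𝒲} {Q : ℝ → ProbabilityMeasure 𝒲} {h : 𝒲 → ℝ}
  (hQ : DiffInQuadraticMean P Q h) (hhm : Measurable h) (hh : MemLp h 2 (P : Measure 𝒲))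
  {ι : Type*} {L : Filter ι} {t a : ι → ℝ} (ht : Tendsto t L (𝓝[>] 0))

include hQ hhm hh ht in
/-- Second moments of functions bounded by a multiple of `1 / t` stay bounded along a path that is
differentiable in quadratic mean. -/
lemma DiffInQuadraticMean.exists_integral_sq_le (ha : ∀ i, 0 ≤ a i)
    (hat : ∀ᶠ i in L, a i * t i ≤ 1) {g : ι → 𝒲 → ℝ} {G : 𝒲 → ℝ} (hgm : ∀ i, Measurable (g i))
    (hG : MemLp G 2 (P : Measure 𝒲))
    (hgG : ∀ i w, |g i w| ≤ |G w|) (hga : ∀ i w, |g i w| ≤ 2 * a i) :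
    ∃ K : ℝ, ∀ᶠ i in L, MemLp (g i) 2 (Q (t i) : Measure 𝒲) ∧
      ∫ w, g i w ^ 2 ∂(Q (t i) : Measure 𝒲) ≤ K := by
  set I := ∫ w, h w ^ 2 ∂(P : Measure 𝒲)
  refine ⟨2 * ∫ w, G w ^ 2 ∂(P : Measure 𝒲) + 8 * (2 + I), ?_⟩
  have hρ := (hQ.tendsto_integral hhm hh).comp ht
  filter_upwards [hat, ht.eventually self_mem_nhdsWithin, (tendsto_order.1 hρ).2 1 one_pos]
    with i hi hti hρi
  have hti' : 0 < t i := hti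
  simp only [Function.comp_apply] at hρi
  refine ⟨MemLp.of_bound (hgm i).aestronglyMeasurable _ (ae_of_all _ (hga i)), ?_⟩
  refine (integral_sq_le_of_bounded P (Q (t i)) (hgm i) (hga i)).trans ?_
  have h1 : ∫ w, g i w ^ 2 ∂(P : Measure 𝒲) ≤ ∫ w, G w ^ 2 ∂(P : Measure 𝒲) :=
    integral_mono (hG.of_le (hgm i).aestronglyMeasurable (ae_of_all _ (hgG i))).integrable_sq
      hG.integrable_sq fun w => sq_le_sq.2 (hgG i w)
  have h2 := sqHellinger_le (R := Q (t i)) hhm hh hti'.ne'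
  have hI : 0 ≤ I := integral_nonneg fun _ => sq_nonneg _
  have h3 : (a i * t i) ^ 2 ≤ 1 := pow_le_one₀ (mul_nonneg (ha i) hti'.le) hi
  -- The sup bound, of order `a`, is squared and meets a squared Hellinger distance of order `t²`;
  -- the hypothesis `a t ≤ 1` balances them.
  have h4 : 2 * (2 * a i) ^ 2 * sqHellinger P (Q (t i)) ≤ 8 * ((a i * t i) ^ 2 * (2 + I)) := by
    have h5 : sqHellinger P (Q (t i)) ≤ t i ^ 2 * (2 + I) := by
      refine h2.trans (mul_le_mul_of_nonneg_left ?_ (sq_nonneg _))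
      linarith
    have := mul_le_mul_of_nonneg_left h5 (by positivity : 0 ≤ 8 * a i ^ 2)
    nlinarith
  have h5 := mul_le_mul_of_nonneg_right h3 (by linarith : 0 ≤ 2 + I)
  linarith

lemma mul_integral_exp_sub_one {μ : Measure 𝒲} [IsProbabilityMeasure μ] {f : 𝒲 → ℝ}
    (hfm : Measurable f) (u a : ℝ) :
    (a : ℂ) * (∫ w, Complex.exp ((u / a * f w : ℝ) * Complex.I) ∂μ - 1)
      = ((∫ w, a * (Real.cos (u * f w / a) - 1) ∂μ : ℝ) : ℂ)
        + ((∫ w, a * Real.sin (u * f w / a) ∂μ : ℝ) : ℂ) * Complex.I := by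
  have hc : Integrable (fun w => Real.cos (u * f w / a)) μ :=
    (integrable_const (1 : ℝ)).mono' (by fun_prop) (ae_of_all _ fun w => Real.abs_cos_le_one _)
  have hs : Integrable (fun w => Real.sin (u * f w / a)) μ :=
    (integrable_const (1 : ℝ)).mono' (by fun_prop) (ae_of_all _ fun w => Real.abs_sin_le_one _)
  have e : ∫ w, Complex.exp ((u / a * f w : ℝ) * Complex.I) ∂μ
      = ((∫ w, Real.cos (u * f w / a) ∂μ : ℝ) : ℂ)
        + ((∫ w, Real.sin (u * f w / a) ∂μ : ℝ) : ℂ) * Complex.I := by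
    rw [← integral_complex_ofReal, ← integral_complex_ofReal, ← integral_mul_const,
      ← integral_add hc.ofReal (hs.ofReal.mul_const _)]
    refine integral_congr_ae (ae_of_all _ fun w => ?_)
    simp only
    rw [Complex.exp_mul_I, Complex.ofReal_cos, Complex.ofReal_sin, div_mul_eq_mul_div]
  rw [e, integral_const_mul, integral_const_mul, integral_sub hc (integrable_const _)]
  simp only [integral_const, probReal_univ, smul_eq_mul, mul_one]
  push_cast
  ring

variable [L.IsCountablyGenerated]

include hQ hhm hh ht in
-- The functions `a (exp(i u f / a) - 1)` converge pointwise to `i u f`, so the difference quotient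
-- of their means along the path tends to `i u E[f h]`. This first-order change of the
-- characteristic function is the shift under local alternatives.
lemma DiffInQuadraticMean.tendsto_integral_exp_sub_div (ha : ∀ i, 0 ≤ a i)
    (haL : Tendsto a L atTop) (hat : ∀ᶠ i in L, a i * t i ≤ 1) {f : 𝒲 → ℝ} (hfm : Measurable f)
    (hf : MemLp f 2 (P : Measure 𝒲)) (u : ℝ) :
    Tendsto (fun i => ((a i : ℂ) * (∫ w, Complex.exp ((u / a i * f w : ℝ) * Complex.I)
          ∂(Q (t i) : Measure 𝒲) - 1)
        - (a i : ℂ) * (∫ w, Complex.exp ((u / a i * f w : ℝ) * Complex.I) ∂(P : Measure 𝒲) - 1))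
        / (t i : ℂ)) L
      (𝓝 ((u * ∫ w, f w * h w ∂(P : Measure 𝒲) : ℝ) * Complex.I)) := by
  have mc : ∀ i, Measurable fun w => a i * (Real.cos (u * f w / a i) - 1) := fun i => by fun_prop
  have ms : ∀ i, Measurable fun w => a i * Real.sin (u * f w / a i) := fun i => by fun_prop
  have hG : MemLp (fun w => u * f w) 2 (P : Measure 𝒲) := hf.const_mul u
  obtain ⟨K, hK⟩ := hQ.exists_integral_sq_le hhm hh ht ha hat mc hG
    (fun i w => abs_mul_cos_div_sub_one_le (ha i) _) (fun i w => abs_mul_cos_sub_one_le (ha i) _)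
  obtain ⟨K', hK'⟩ := hQ.exists_integral_sq_le hhm hh ht ha hat ms hG
    (fun i w => abs_mul_sin_div_le (ha i) _) (fun i w => abs_mul_sin_le (ha i) _)
  have hc := hQ.tendsto_integral_sub_div hhm hh ht mc (hfm.const_mul u) hG
    (fun i w => abs_mul_cos_div_sub_one_le (ha i) _)
    (fun w => tendsto_mul_cos_div_sub_one haL (u * f w)) hK
  have hs := hQ.tendsto_integral_sub_div hhm hh ht ms (hfm.const_mul u) hG
    (fun i w => abs_mul_sin_div_le (ha i) _) (fun w => tendsto_mul_sin_div haL (u * f w)) hK'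
  have h1 := ((Complex.continuous_ofReal.tendsto _).comp hc).add
    (((Complex.continuous_ofReal.tendsto _).comp hs).mul_const Complex.I)
  simp only [zero_mul, integral_zero, Complex.ofReal_zero, zero_add, mul_assoc,
    integral_const_mul] at h1
  refine (h1.congr fun i => ?_)
  rw [mul_integral_exp_sub_one hfm, mul_integral_exp_sub_one hfm]
  simp only [Function.comp_apply, integral_const_mul]
  push_cast
  ring

include hQ hhm hh ht in
/-- Le Cam's third lemma for the mean of i.i.d. variables, in terms of characteristic functions:
under the local alternatives `Q (t i)`, the scaled sum `n^{-1/2} ∑ f` is asymptotically normal with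
mean `n^{1/2} t E[f h]`. -/
theorem DiffInQuadraticMean.tendsto_integral_exp_iid {n : ι → ℕ} (hn : Tendsto n L atTop)
    (hnt : ∀ᶠ i in L, √(n i : ℝ) * t i ≤ 1) {f : 𝒲 → ℝ} (hfm : Measurable f)
    (hf : MemLp f 2 (P : Measure 𝒲)) (hf0 : ∫ w, f w ∂(P : Measure 𝒲) = 0) (u : ℝ) :
    Tendsto (fun i => ∫ s : Fin (n i) → 𝒲,
        Complex.exp ((u * ((√(n i : ℝ))⁻¹ * ∑ j, f (s j)
          - √(n i : ℝ) * t i * ∫ w, f w * h w ∂(P : Measure 𝒲)) : ℝ) * Complex.I)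
        ∂(iidLaw (Q (t i)) (n i))) L
      (𝓝 (Complex.exp (-((u ^ 2 * (∫ w, f w ^ 2 ∂(P : Measure 𝒲)) / 2 : ℝ) : ℂ)))) := by
  set κ := ∫ w, f w * h w ∂(P : Measure 𝒲) with hκ
  set σ := ∫ w, f w ^ 2 ∂(P : Measure 𝒲)
  set a : ι → ℝ := fun i => √(n i : ℝ) with hadef
  have ha : ∀ i, 0 ≤ a i := fun i => Real.sqrt_nonneg _
  have haL : Tendsto a L atTop :=
    Real.tendsto_sqrt_atTop.comp (tendsto_natCast_atTop_atTop.comp hn)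
  have hapos : ∀ᶠ i in L, 0 < a i := haL.eventually (eventually_gt_atTop 0)
  have htpos : ∀ᶠ i in L, 0 < t i := ht.eventually self_mem_nhdsWithin
  have ht0 : Tendsto t L (𝓝 0) := ht.mono_right nhdsWithin_le_nhds
  have ht0' : Tendsto (fun i => (t i : ℂ)) L (𝓝 0) := by
    have := (Complex.continuous_ofReal.tendsto _).comp ht0
    rw [Complex.ofReal_zero] at this
    exact this
  set φ : ι → ℂ := fun i => ∫ w, Complex.exp ((u / a i * f w : ℝ) * Complex.I)
    ∂(Q (t i) : Measure 𝒲) with hφ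
  set φ₀ : ι → ℂ := fun i => ∫ w, Complex.exp ((u / a i * f w : ℝ) * Complex.I)
    ∂(P : Measure 𝒲) with hφ₀
  -- The deterministic centring is distributed over the observations, one factor `z` each, so that
  -- the expectation is `(z φ)^n`.
  set z : ι → ℂ := fun i => Complex.exp ((-(u * t i * κ / a i) : ℝ) * Complex.I) with hz
  set D : ι → ℂ := fun i => ((a i : ℂ) * (φ i - 1) - (a i : ℂ) * (φ₀ i - 1)) / (t i : ℂ) with hD
  have hDlim : Tendsto D L (𝓝 ((u * κ : ℝ) * Complex.I)) :=
    hQ.tendsto_integral_exp_sub_div hhm hh ht ha haL hnt hfm hf u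
  have hS : Tendsto (fun i => ((a i ^ 2 : ℝ) : ℂ) * (φ₀ i - 1)) L
      (𝓝 (-((u ^ 2 * σ / 2 : ℝ) : ℂ))) := tendsto_nat_mul_charFun_sub_one hfm hf hf0 u haL
  -- the centering factor
  have hzx : Tendsto (fun i => ((a i ^ 2 : ℝ) : ℂ) * (z i - 1)
      + ((a i * t i : ℝ) : ℂ) * ((u * κ : ℝ) * Complex.I)) L (𝓝 0) := by
    have hle : ∀ᶠ i in L, |u * t i * κ / a i| ≤ 1 := by
      have h1 : Tendsto (fun i => |u * t i * κ / a i|) L (𝓝 0) := by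
        have := ((ht0.const_mul u).mul_const κ).div_atTop haL
        simpa using this.abs
      exact ((tendsto_order.1 h1).2 1 one_pos).mono fun _ h => h.le
    have hlim : Tendsto (fun i => (u * κ) ^ 2 * t i ^ 2) L (𝓝 0) := by
      simpa using (ht0.pow 2).const_mul ((u * κ) ^ 2)
    refine squeeze_zero_norm' ?_ hlim
    filter_upwards [hle, hapos] with i hi hai
    have hx : ‖((-(u * t i * κ / a i) : ℝ) : ℂ) * Complex.I‖ = |u * t i * κ / a i| := by
      rw [norm_mul, Complex.norm_I, mul_one, Complex.norm_real, Real.norm_eq_abs, abs_neg]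
    have h2 := Complex.norm_exp_sub_one_sub_id_le (hx.trans_le hi)
    rw [hx, sq_abs] at h2
    have hai' : (a i : ℂ) ≠ 0 := by exact_mod_cast hai.ne'
    have e : ((a i ^ 2 : ℝ) : ℂ) * (z i - 1) + ((a i * t i : ℝ) : ℂ) * ((u * κ : ℝ) * Complex.I)
        = ((a i ^ 2 : ℝ) : ℂ) * (z i - 1 - ((-(u * t i * κ / a i) : ℝ) : ℂ) * Complex.I) := by
      push_cast; field_simp; ring
    rw [e, norm_mul, Complex.norm_real, Real.norm_of_nonneg (sq_nonneg _)]
    refine (mul_le_mul_of_nonneg_left h2 (sq_nonneg _)).trans_eq ?_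
    field_simp
  have hzx' : Tendsto (fun i => (a i : ℂ) * (z i - 1)) L (𝓝 0) := by
    have hlim : Tendsto (fun i => |u * κ| * t i) L (𝓝 0) := by
      simpa using ht0.const_mul |u * κ|
    refine squeeze_zero_norm' ?_ hlim
    filter_upwards [hapos, htpos] with i hai hti
    have h1 := Real.norm_exp_I_mul_ofReal_sub_one_le (x := -(u * t i * κ / a i))
    rw [mul_comm] at h1
    rw [norm_mul, Complex.norm_real, Real.norm_of_nonneg hai.le]
    refine (mul_le_mul_of_nonneg_left h1 hai.le).trans_eq ?_
    rw [Real.norm_eq_abs, abs_neg, abs_div, abs_of_pos hai, abs_mul, abs_mul, abs_mul,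
      abs_of_pos hti]
    field_simp
  have hbdd : ∀ᶠ i in L, ‖((a i * t i : ℝ) : ℂ)‖ ≤ 1 := by
    filter_upwards [hnt, hapos, htpos] with i hi hai hti
    rw [Complex.norm_real, Real.norm_of_nonneg (by positivity)]
    exact hi
  have hy' : Tendsto (fun i => (a i : ℂ) * (φ i - 1)) L (𝓝 0) := by
    have h1 : Tendsto (fun i => (((a i)⁻¹ : ℝ) : ℂ)) L (𝓝 0) := by
      have := (Complex.continuous_ofReal.tendsto _).comp (tendsto_inv_atTop_zero.comp haL)
      rw [Complex.ofReal_zero] at this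
      exact this
    have h2 := (h1.mul hS).add (ht0'.mul hDlim)
    rw [zero_mul, zero_mul, add_zero] at h2
    refine h2.congr' ?_
    filter_upwards [hapos, htpos] with i hai hti
    have hai' : (a i : ℂ) ≠ 0 := by exact_mod_cast hai.ne'
    have hti' : (t i : ℂ) ≠ 0 := by exact_mod_cast hti.ne'
    simp only [hD]
    push_cast
    field_simp
    ring
  -- With `n = a²`, expand `n (z φ - 1) = a² (φ₀ - 1) + a t D + a² (z - 1) + a (z - 1) · a (φ - 1)`.
  -- The first term gives the variance and the last vanishes. The second and third follow `± a t · i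
  -- u κ` and cancel, which is why `a t` need only be bounded and not convergent.
  have hmain : Tendsto (fun i => (n i : ℂ) * (z i * φ i - 1)) L
      (𝓝 (-((u ^ 2 * σ / 2 : ℝ) : ℂ))) := by
    have hb : Tendsto (fun i => ((a i * t i : ℝ) : ℂ) * (D i - (u * κ : ℝ) * Complex.I)) L
        (𝓝 0) := by
      have h1 : Tendsto (fun i => D i - (u * κ : ℝ) * Complex.I) L (𝓝 0) := by
        simpa using hDlim.sub_const ((u * κ : ℝ) * Complex.I)
      rw [tendsto_zero_iff_norm_tendsto_zero] at h1 ⊢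
      refine squeeze_zero' (Eventually.of_forall fun _ => norm_nonneg _) ?_ h1
      filter_upwards [hbdd] with i hi
      rw [norm_mul]
      exact mul_le_of_le_one_left (norm_nonneg _) hi
    have hsum := ((hS.add hb).add hzx).add (hzx'.mul hy')
    rw [add_zero, add_zero, mul_zero, add_zero] at hsum
    refine hsum.congr' ?_
    filter_upwards [hapos, htpos] with i hai hti
    have hai' : (a i : ℂ) ≠ 0 := by exact_mod_cast hai.ne'
    have hti' : (t i : ℂ) ≠ 0 := by exact_mod_cast hti.ne'
    have hni : (n i : ℂ) = (a i : ℂ) ^ 2 := by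
      rw [← Complex.ofReal_pow, hadef]
      simp only [Real.sq_sqrt (Nat.cast_nonneg (n i)), Complex.ofReal_natCast]
    rw [hni]
    simp only [hD]
    push_cast
    field_simp
    ring
  have hnorm : ∀ i, ‖z i * φ i‖ ≤ 1 := fun i => by
    rw [norm_mul, hz]
    simp only [Complex.norm_exp_ofReal_mul_I, one_mul]
    refine (norm_integral_le_of_norm_le_const (C := 1)
      (ae_of_all _ fun w => (Complex.norm_exp_ofReal_mul_I _).le)).trans ?_
    simp
  have hfin := tendsto_pow_of_tendsto_nat_mul_sub_one hn hnorm
    (by positivity : 0 ≤ u ^ 2 * σ / 2) hmain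
  refine hfin.congr' ?_
  filter_upwards [hapos] with i hai
  have e : ∀ s : Fin (n i) → 𝒲,
      Complex.exp ((u * ((a i)⁻¹ * ∑ j, f (s j) - a i * t i * κ) : ℝ) * Complex.I)
      = ∏ j, (z i * Complex.exp ((u / a i * f (s j) : ℝ) * Complex.I)) := fun s => by
    rw [Finset.prod_mul_distrib, Finset.prod_const, Finset.card_univ, Fintype.card_fin,
      ← Complex.exp_sum, hz, ← Complex.exp_nat_mul, ← Complex.exp_add]
    congr 1
    have hni : (n i : ℂ) = (a i : ℂ) ^ 2 := by
      rw [← Complex.ofReal_pow, hadef]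
      simp only [Real.sq_sqrt (Nat.cast_nonneg (n i)), Complex.ofReal_natCast]
    have hai' : (a i : ℂ) ≠ 0 := by exact_mod_cast hai.ne'
    rw [hni, ← Finset.sum_mul, ← Complex.ofReal_sum, ← Finset.mul_sum]
    push_cast
    field_simp
    ring
  refine Eq.trans ?_ (integral_congr_ae (ae_of_all _ fun s => (e s).symm))
  rw [integral_fintype_prod_eq_pow (fun w => z i * Complex.exp ((u / a i * f w : ℝ) * Complex.I)),
    integral_const_mul, Fintype.card_fin]

end LocalAlternatives

/-! ## The model with a known annotation score -/

section Model

variable {d k l : ℕ}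

lemma annotR_eq_indicator (w : ObsData d k l) :
    annotR w = ({w : ObsData d k l | annot w = true}).indicator (fun _ => (1 : ℝ)) w := by
  simp [annotR, Set.indicator]

lemma measurableSet_annot : MeasurableSet {w : ObsData d k l | annot w = true} :=
  measurable_annot (measurableSet_singleton true)

lemma annotR_nonneg (w : ObsData d k l) : 0 ≤ annotR w := by
  unfold annotR; split_ifs <;> norm_num

lemma annotR_le_one (w : ObsData d k l) : annotR w ≤ 1 := by
  unfold annotR; split_ifs <;> norm_num

lemma integrable_annotR (Q : ProbabilityMeasure (ObsData d k l)) :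
    Integrable annotR (Q : Measure (ObsData d k l)) :=
  (integrable_const (1 : ℝ)).mono' measurable_annotR.aestronglyMeasurable
    (ae_of_all _ fun w => by
      rw [Real.norm_of_nonneg (annotR_nonneg w)]; exact annotR_le_one w)

lemma stronglyMeasurable_comp_feat {f : Feat d k l → ℝ} (hf : Measurable f) :
    StronglyMeasurable[MeasurableSpace.comap feat inferInstance]
      (fun w : ObsData d k l => f (feat w)) :=
  (hf.comp (comap_measurable feat)).stronglyMeasurable

lemma measurable_regressionFun (Q : ProbabilityMeasure (ObsData d k l)) :
    Measurable (regressionFun Q) :=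
  ((measurable_snd : Measurable (Prod.snd : Feat d k l × ℝ → ℝ)).stronglyMeasurable.integral_condDistrib
    (X := feat) (Y := outcome)
    (μ := ProbabilityTheory.cond (Q : Measure (ObsData d k l)) {w | annot w = true})).measurable

variable {π : (Fin k → ℝ) → ℝ} {cperp : (Fin d → ℝ) → ℝ} {Q : ProbabilityMeasure (ObsData d k l)}
  {η : ℝ}

lemma InModel.integral_comp_feat_mul_annotR (hQ : InModel π cperp Q) {f : Feat d k l → ℝ}
    (hf : Measurable f) (hint : Integrable (fun w => f (feat w)) (Q : Measure (ObsData d k l))) :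
    ∫ w, f (feat w) * annotR w ∂(Q : Measure (ObsData d k l))
      = ∫ w, f (feat w) * π (covar w) ∂(Q : Measure (ObsData d k l)) := by
  have hm := (measurable_feat (d := d) (k := k) (l := l)).comap_le
  have hfa : Integrable (fun w => f (feat w) * annotR w) (Q : Measure (ObsData d k l)) :=
    hint.mul_bdd (c := 1) measurable_annotR.aestronglyMeasurable (ae_of_all _ fun w => by
      rw [Real.norm_of_nonneg (annotR_nonneg w)]; exact annotR_le_one w)
  rw [← integral_condExp hm]
  refine integral_congr_ae ?_
  filter_upwards [condExp_mul_of_stronglyMeasurable_left (stronglyMeasurable_comp_feat hf) hfa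
    (integrable_annotR Q), hQ.annotation_score] with w h1 h2
  rw [show (fun w => f (feat w) * annotR w) = (fun w => f (feat w)) * annotR from rfl, h1,
    Pi.mul_apply, h2]

/-- Inverse probability weighting: `E_Q[f(X̃) A / π(X)] = E_Q[f(X̃)]`. -/
lemma InModel.integral_comp_feat_mul_annotR_div (hQ : InModel π cperp Q) (hπm : Measurable π)
    (hη : 0 < η) (hπ : ∀ x, η ≤ π x) {f : Feat d k l → ℝ} (hf : Measurable f)
    (hint : Integrable (fun w => f (feat w)) (Q : Measure (ObsData d k l))) :
    ∫ w, f (feat w) * (annotR w / π (covar w)) ∂(Q : Measure (ObsData d k l))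
      = ∫ w, f (feat w) ∂(Q : Measure (ObsData d k l)) := by
  have hg : Measurable fun x : Feat d k l => f x / π x.1 := hf.div (hπm.comp measurable_fst)
  have hgi : Integrable (fun w => f (feat w) / π (feat w).1) (Q : Measure (ObsData d k l)) := by
    refine (hint.norm.div_const η).mono' (hg.comp measurable_feat).aestronglyMeasurable
      (ae_of_all _ fun w => ?_)
    have h0 := hη.trans_le (hπ (feat w).1)
    rw [norm_div, Real.norm_of_nonneg h0.le]
    exact div_le_div_of_nonneg_left (norm_nonneg _) hη (hπ _)
  have h := hQ.integral_comp_feat_mul_annotR hg hgi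
  have e1 : ∀ w : ObsData d k l, f (feat w) / π (feat w).1 * annotR w
      = f (feat w) * (annotR w / π (covar w)) := fun w => by
    simp only [feat]; ring
  have e2 : ∀ w : ObsData d k l, f (feat w) / π (feat w).1 * π (covar w) = f (feat w) := fun w =>
    div_mul_cancel₀ _ (hη.trans_le (hπ (covar w))).ne'
  simpa only [e1, e2] using h

lemma InModel.annotR_mul_outcome (hQ : InModel π cperp Q) :
    (fun w => annotR w * outcome w) =ᵐ[(Q : Measure (ObsData d k l))] outcome := by
  filter_upwards [hQ.outcome_eq_zero] with w hw
  by_cases h : annot w = true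
  · simp [annotR, h]
  · simp [annotR, h, hw (by simpa using h)]

/-- The regression function is a version of `E_Q[M | X̃] / π(X)`. -/
lemma InModel.condExp_outcome (hQ : InModel π cperp Q) (hη : 0 < η) (hπ : ∀ x, η ≤ π x) :
    (Q : Measure (ObsData d k l))[outcome | MeasurableSpace.comap feat inferInstance]
      =ᵐ[(Q : Measure (ObsData d k l))] fun w => π (covar w) * regressionFun Q (feat w) := by
  set S := {w : ObsData d k l | annot w = true} with hS
  have hm := (measurable_feat (d := d) (k := k) (l := l)).comap_le
  have hSm : MeasurableSet S := measurableSet_annot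
  have hA : ∀ F : ObsData d k l → ℝ, (fun w => annotR w * F w) = S.indicator F := fun F => by
    ext w
    by_cases hw : w ∈ S
    · rw [Set.indicator_of_mem hw]; simp [annotR_eq_indicator, ← hS, hw]
    · rw [Set.indicator_of_notMem hw]; simp [annotR_eq_indicator, ← hS, hw]
  -- `Q(A = 1) = E[π(X)] ≥ η > 0`, so conditioning on `A = 1` does give a probability measure.
  have hS0 : (Q : Measure (ObsData d k l)) S ≠ 0 := fun h0 => by
    have h1 := hQ.integral_comp_feat_mul_annotR (f := fun _ => (1 : ℝ)) measurable_const
      (integrable_const _)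
    simp only [one_mul] at h1
    have h2 : ∫ w, annotR w ∂(Q : Measure (ObsData d k l)) = 0 := by
      have : (annotR : ObsData d k l → ℝ) = S.indicator fun _ => 1 := by simpa using hA fun _ => 1
      rw [this, integral_indicator hSm, Measure.restrict_eq_zero.2 h0, integral_zero_measure]
    have h3 : ∫ _w, η ∂(Q : Measure (ObsData d k l)) ≤
        ∫ w, π (covar w) ∂(Q : Measure (ObsData d k l)) :=
      integral_mono_ae (integrable_const _)
        ((integrable_condExp (m := MeasurableSpace.comap feat inferInstance)
          (f := annotR)).congr hQ.annotation_score) (ae_of_all _ fun w => hπ _)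
    rw [← h1, h2] at h3
    simp at h3
    linarith
  set Q' := ProbabilityTheory.cond (Q : Measure (ObsData d k l)) S with hQ'
  have hQ'p : IsProbabilityMeasure Q' := cond_isProbabilityMeasure hS0
  have hc0 : ((Q : Measure (ObsData d k l)) S)⁻¹ ≠ 0 := ENNReal.inv_ne_zero.2 (measure_ne_top _ _)
  have hct : ((Q : Measure (ObsData d k l)) S)⁻¹ ≠ ∞ := ENNReal.inv_ne_top.2 hS0
  have hiff : ∀ F : ObsData d k l → ℝ, Integrable F Q' ↔
      Integrable (fun w => annotR w * F w) (Q : Measure (ObsData d k l)) := fun F => by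
    rw [hA, integrable_indicator_iff hSm, hQ', ProbabilityTheory.cond,
      integrable_smul_measure hc0 hct]
    rfl
  set g : ObsData d k l → ℝ := fun w => regressionFun Q (feat w) with hg
  have hgm : Measurable g := (measurable_regressionFun Q).comp measurable_feat
  have hoi : Integrable outcome Q' :=
    (hiff _).2 (hQ.integrable_outcome.congr hQ.annotR_mul_outcome.symm)
  have hce : Q'[outcome | MeasurableSpace.comap feat inferInstance] =ᵐ[Q'] g :=
    condExp_ae_eq_integral_condDistrib' measurable_feat hoi
  have hgi : Integrable g Q' := integrable_condExp.congr hce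
  have hagi : Integrable (g * annotR) (Q : Measure (ObsData d k l)) :=
    ((hiff g).1 hgi).congr (ae_of_all _ fun w => mul_comm _ _)
  have hpull := condExp_mul_of_stronglyMeasurable_left
    (stronglyMeasurable_comp_feat (measurable_regressionFun Q)) hagi (integrable_annotR Q)
  refine (ae_eq_condExp_of_forall_setIntegral_eq hm hQ.integrable_outcome
    (g := (Q : Measure (ObsData d k l))[g * annotR | MeasurableSpace.comap feat inferInstance])
    (fun s _ _ => integrable_condExp.integrableOn) (fun s hs _ => ?_)
    stronglyMeasurable_condExp.aestronglyMeasurable).symm.trans ?_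
  · rw [setIntegral_condExp hm hagi hs]
    -- Integrals weighted by `A` are, up to the factor `Q(A = 1)`, integrals for the conditional
    -- law; this moves the defining property of the regression function from `Q'` back to `Q`.
    have hset : ∀ F : ObsData d k l → ℝ, ∫ w in s, annotR w * F w ∂(Q : Measure (ObsData d k l))
        = ((Q : Measure (ObsData d k l)) S).toReal * ∫ w in s, F w ∂Q' := fun F => by
      rw [hA, setIntegral_indicator hSm, hQ', ProbabilityTheory.cond, Measure.restrict_smul,
        integral_smul_measure, Measure.restrict_restrict (hm s hs), smul_eq_mul, ENNReal.toReal_inv,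
        mul_inv_cancel_left₀ (ENNReal.toReal_ne_zero.2 ⟨hS0, measure_ne_top _ _⟩)]
    have e1 : ∫ w in s, (g * annotR : ObsData d k l → ℝ) w ∂(Q : Measure (ObsData d k l))
        = ∫ w in s, annotR w * g w ∂(Q : Measure (ObsData d k l)) :=
      integral_congr_ae (ae_of_all _ fun w => mul_comm _ _)
    have e2 : ∫ w in s, outcome w ∂(Q : Measure (ObsData d k l))
        = ∫ w in s, annotR w * outcome w ∂(Q : Measure (ObsData d k l)) :=
      integral_congr_ae (ae_restrict_of_ae hQ.annotR_mul_outcome.symm)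
    rw [e1, e2, hset, hset, ← setIntegral_condExp hm hoi hs]
    congr 1
    exact integral_congr_ae (ae_restrict_of_ae hce.symm)
  · filter_upwards [hpull, hQ.annotation_score] with w h1 h2
    rw [show g * annotR = (fun w => regressionFun Q (feat w)) * annotR from rfl, h1, Pi.mul_apply,
      h2, mul_comm]

/-! ### The numerator as an inverse-probability-weighted mean -/

section Weighted

variable (hQ : InModel π cperp Q) (hπm : Measurable π) (hη : 0 < η) (hπ : ∀ x, η ≤ π x)
  (hcm : Measurable cperp)

include hπm hη hπ hcm in
lemma memLp_weighted_outcome {R : ProbabilityMeasure (ObsData d k l)} (hR : InModel π cperp R) :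
    MemLp (fun w => cperp (regr w) * outcome w / π (covar w)) 2 (R : Measure (ObsData d k l)) := by
  refine hR.memLp_num.of_le_mul (c := η⁻¹) ?_ (ae_of_all _ fun w => ?_)
  · exact (((hcm.comp measurable_regr).mul measurable_outcome).div
      (hπm.comp measurable_covar)).aestronglyMeasurable
  · have h0 := hη.trans_le (hπ (covar w))
    rw [norm_div, Real.norm_of_nonneg h0.le, div_eq_inv_mul]
    exact mul_le_mul_of_nonneg_right (inv_anti₀ hη (hπ _)) (norm_nonneg _)

include hQ hπm hη hπ hcm in
-- `C^⊥ / π(X)` is a function of `X̃` and pulls out of `InModel.condExp_outcome`. Consequently `C^⊥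
-- μ` inherits square-integrability, conditional expectation being a contraction, and `thetaNum`
-- becomes linear in the law.
lemma InModel.cperp_mul_regressionFun_ae_eq :
    (Q : Measure (ObsData d k l))[fun w => cperp (regr w) * outcome w / π (covar w) |
        MeasurableSpace.comap feat inferInstance]
      =ᵐ[(Q : Measure (ObsData d k l))] fun w => cperp (regr w) * regressionFun Q (feat w) := by
  have hk : Measurable fun x : Feat d k l => cperp x.2.2 / π x.1 :=
    (hcm.comp measurable_snd.snd).div (hπm.comp measurable_fst)
  have e : (fun w : ObsData d k l => cperp (regr w) * outcome w / π (covar w))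
      = (fun w => cperp (feat w).2.2 / π (feat w).1) * outcome := by
    ext w; simp only [feat, Pi.mul_apply]; ring
  have hint := (memLp_weighted_outcome hπm hη hπ hcm hQ).integrable one_le_two
  rw [e] at hint ⊢
  filter_upwards [condExp_mul_of_stronglyMeasurable_left (stronglyMeasurable_comp_feat hk) hint
    hQ.integrable_outcome, hQ.condExp_outcome hη hπ] with w h1 h2
  rw [h1, Pi.mul_apply, h2]
  have h0 := (hη.trans_le (hπ (covar w))).ne'
  simp only [feat]
  field_simp

include hQ hπm hη hπ hcm in
lemma InModel.memLp_cperp_mul_regressionFun :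
    MemLp (fun w => cperp (regr w) * regressionFun Q (feat w)) 2
      (Q : Measure (ObsData d k l)) :=
  ((memLp_weighted_outcome hπm hη hπ hcm hQ).condExp one_le_two).ae_eq
    (hQ.cperp_mul_regressionFun_ae_eq hπm hη hπ hcm)

include hQ hπm hη hπ hcm in
/-- In the model, the numerator functional is the mean of `C^⊥ M / π(X)`. -/
lemma InModel.thetaNum_eq :
    thetaNum cperp Q
      = ∫ w, cperp (regr w) * outcome w / π (covar w) ∂(Q : Measure (ObsData d k l)) := by
  rw [thetaNum, ← integral_congr_ae (hQ.cperp_mul_regressionFun_ae_eq hπm hη hπ hcm)]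
  exact integral_condExp (measurable_feat (d := d) (k := k) (l := l)).comap_le

end Weighted

/-! ### The influence function: decomposition, moments, mean zero -/

section Influence

variable {P : ProbabilityMeasure (ObsData d k l)} (hP : InModel π cperp P) (hπm : Measurable π)
  (hη : 0 < η) (hπ : ∀ x, η ≤ π x) (hcm : Measurable cperp)

include hcm hπm in
lemma measurable_phiRatio : Measurable (phiRatio π cperp P) := by
  have h1 : Measurable fun w : ObsData d k l => cperp (regr w) := hcm.comp measurable_regr
  have h2 : Measurable fun w : ObsData d k l => regressionFun P (feat w) :=
    (measurable_regressionFun P).comp measurable_feat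
  have h3 : Measurable fun w : ObsData d k l => annotR w / π (covar w) :=
    measurable_annotR.div (hπm.comp measurable_covar)
  have h4 : Measurable (outcome : ObsData d k l → ℝ) := measurable_outcome
  exact ((((h1.mul (h2.add (h3.mul (h4.sub h2)))).sub_const _).sub
    (((h1.pow_const 2).sub_const _).const_mul _)).const_mul _)

include hη hπ in
lemma abs_annotR_div_le (w : ObsData d k l) : |annotR w / π (covar w)| ≤ η⁻¹ := by
  have h0 := hη.trans_le (hπ (covar w))
  rw [abs_div, abs_of_pos h0, abs_of_nonneg (annotR_nonneg w), div_eq_mul_inv]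
  have := inv_anti₀ hη (hπ (covar w))
  have h1 := annotR_le_one w
  have h2 := annotR_nonneg w
  have h3 := inv_pos.2 h0
  nlinarith

include hη hπ in
lemma abs_one_sub_annotR_div_le (w : ObsData d k l) :
    |1 - annotR w / π (covar w)| ≤ 1 + η⁻¹ :=
  (abs_sub _ _).trans (by rw [abs_one]; linarith [abs_annotR_div_le hη hπ w])

include hP hη hπ in
-- Because `A M = M` almost surely, `φ_num` separates into the weighted outcome, which carries the
-- derivative of the numerator, and an augmentation, which the scores do not see.
lemma phiNum_ae_eq : phiNum π cperp P =ᵐ[(P : Measure (ObsData d k l))] fun w =>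
    cperp (regr w) * outcome w / π (covar w)
      + cperp (regr w) * regressionFun P (feat w) * (1 - annotR w / π (covar w))
      - thetaNum cperp P := by
  filter_upwards [hP.annotR_mul_outcome] with w hw
  have h0 := (hη.trans_le (hπ (covar w))).ne'
  rw [phiNum, ← hw]
  have h1 : annotR w * annotR w = annotR w := by unfold annotR; split_ifs <;> norm_num
  field_simp
  linear_combination (cperp (regr w) * outcome w) * h1

include hP hπm hη hπ hcm in
lemma memLp_augmentation : MemLp (fun w => cperp (regr w) * regressionFun P (feat w)
    * (1 - annotR w / π (covar w))) 2 (P : Measure (ObsData d k l)) := by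
  have h := hP.memLp_cperp_mul_regressionFun hπm hη hπ hcm
  have hm : Measurable fun w : ObsData d k l => 1 - annotR w / π (covar w) :=
    (measurable_annotR.div (hπm.comp measurable_covar)).const_sub 1
  refine h.of_le_mul (c := 1 + η⁻¹) (h.aestronglyMeasurable.mul hm.aestronglyMeasurable)
    (ae_of_all _ fun w => ?_)
  rw [norm_mul, mul_comm]
  exact mul_le_mul_of_nonneg_right (abs_one_sub_annotR_div_le hη hπ w) (norm_nonneg _)

include hP hπm hη hπ hcm in
lemma memLp_phiNum : MemLp (phiNum π cperp P) 2 (P : Measure (ObsData d k l)) :=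
  (((memLp_weighted_outcome hπm hη hπ hcm hP).add
    (memLp_augmentation hP hπm hη hπ hcm)).sub (memLp_const _)).ae_eq (phiNum_ae_eq hP hη hπ).symm

include hP in
lemma memLp_phiDen : MemLp (phiDen cperp P) 2 (P : Measure (ObsData d k l)) :=
  hP.memLp_den.sub (memLp_const _)

include hP hπm hη hπ hcm in
lemma memLp_phiRatio : MemLp (phiRatio π cperp P) 2 (P : Measure (ObsData d k l)) :=
  ((memLp_phiNum hP hπm hη hπ hcm).sub
    ((memLp_phiDen hP).const_mul (thetaRatio cperp P))).const_mul (thetaDen cperp P)⁻¹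

include hP hπm hη hπ hcm in
lemma integral_phiNum : ∫ w, phiNum π cperp P w ∂(P : Measure (ObsData d k l)) = 0 := by
  have hk : Measurable fun x : Feat d k l => cperp x.2.2 * regressionFun P x :=
    (hcm.comp measurable_snd.snd).mul (measurable_regressionFun P)
  have hki := (hP.memLp_cperp_mul_regressionFun hπm hη hπ hcm).integrable one_le_two
  have h1 := hP.integral_comp_feat_mul_annotR_div hπm hη hπ hk hki
  have hki' : Integrable (fun w => cperp (regr w) * regressionFun P (feat w)
      * (annotR w / π (covar w))) (P : Measure (ObsData d k l)) :=
    hki.mul_bdd (c := η⁻¹) (measurable_annotR.div (hπm.comp measurable_covar)).aestronglyMeasurable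
      (ae_of_all _ fun w => abs_annotR_div_le hη hπ w)
  have hw := (memLp_weighted_outcome hπm hη hπ hcm hP).integrable one_le_two
  have ha := (memLp_augmentation hP hπm hη hπ hcm).integrable one_le_two
  have h2 : ∫ w, cperp (regr w) * regressionFun P (feat w) * (1 - annotR w / π (covar w))
      ∂(P : Measure (ObsData d k l)) = 0 := by
    simp_rw [mul_sub, mul_one]
    rw [integral_sub hki hki']
    exact sub_eq_zero.2 h1.symm
  rw [integral_congr_ae (phiNum_ae_eq hP hη hπ)]
  have hwa : Integrable (fun w => cperp (regr w) * outcome w / π (covar w)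
      + cperp (regr w) * regressionFun P (feat w) * (1 - annotR w / π (covar w)))
      (P : Measure (ObsData d k l)) := hw.add ha
  rw [integral_sub hwa (integrable_const _), integral_add hw ha, h2,
    ← hP.thetaNum_eq hπm hη hπ hcm]
  simp

include hP in
lemma integral_phiDen : ∫ w, phiDen cperp P w ∂(P : Measure (ObsData d k l)) = 0 := by
  unfold phiDen
  rw [integral_sub (hP.memLp_den.integrable one_le_two) (integrable_const _)]
  simp [thetaDen]

include hP hπm hη hπ hcm in
lemma integral_phiRatio : ∫ w, phiRatio π cperp P w ∂(P : Measure (ObsData d k l)) = 0 := by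
  unfold phiRatio
  rw [integral_const_mul, integral_sub ((memLp_phiNum hP hπm hη hπ hcm).integrable one_le_two)
    (((memLp_phiDen hP).integrable one_le_two).const_mul _), integral_const_mul,
    integral_phiNum hP hπm hη hπ hcm, integral_phiDen hP]
  simp

end Influence

end Model

/-! ## Pathwise differentiability -/

section Pathwise

variable {d k l : ℕ} {π : (Fin k → ℝ) → ℝ} {cperp : (Fin d → ℝ) → ℝ}
  {P : ProbabilityMeasure (ObsData d k l)} {Q : ℝ → ProbabilityMeasure (ObsData d k l)}
  {h : ObsData d k l → ℝ} {η : ℝ}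

/-- The mean of a fixed function with bounded second moments is differentiable along a regular
submodel. -/
lemma IsRegularSubmodel.tendsto_integral_sub_div (S : IsRegularSubmodel π cperp P Q h)
    {f : ObsData d k l → ℝ} (hfm : Measurable f) (hf : MemLp f 2 (P : Measure (ObsData d k l)))
    {K : ℝ} (hK : ∀ᶠ t in 𝓝[>] 0, MemLp f 2 (Q t : Measure (ObsData d k l)) ∧
      ∫ w, f w ^ 2 ∂(Q t : Measure (ObsData d k l)) ≤ K) :
    Tendsto (fun t : ℝ => (∫ w, f w ∂(Q t : Measure (ObsData d k l))
        - ∫ w, f w ∂(P : Measure (ObsData d k l))) / t) (𝓝[>] 0)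
      (𝓝 (∫ w, f w * h w ∂(P : Measure (ObsData d k l)))) :=
  S.diff.tendsto_integral_sub_div S.measurable_score S.memLp_score tendsto_id
    (fun _ => hfm) hfm hf (fun _ _ => le_rfl) (fun _ => tendsto_const_nhds) hK

lemma IsRegularSubmodel.tendsto_integral_sub_div_of_bounded (S : IsRegularSubmodel π cperp P Q h)
    {f : ObsData d k l → ℝ} (hfm : Measurable f) {M : ℝ} (hfM : ∀ w, |f w| ≤ M) :
    Tendsto (fun t : ℝ => (∫ w, f w ∂(Q t : Measure (ObsData d k l))
        - ∫ w, f w ∂(P : Measure (ObsData d k l))) / t) (𝓝[>] 0)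
      (𝓝 (∫ w, f w * h w ∂(P : Measure (ObsData d k l)))) := by
  have hb : ∀ R : ProbabilityMeasure (ObsData d k l), MemLp f 2 (R : Measure (ObsData d k l)) :=
    fun R => MemLp.of_bound hfm.aestronglyMeasurable M (ae_of_all _ hfM)
  refine S.tendsto_integral_sub_div (K := M ^ 2) hfm (hb P) (Eventually.of_forall fun t =>
    ⟨hb _, ?_⟩)
  refine (integral_mono (hb (Q t)).integrable_sq (integrable_const (M ^ 2)) fun w => ?_).trans_eq
    (by simp)
  have := pow_le_pow_left₀ (abs_nonneg _) (hfM w) 2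
  rwa [sq_abs] at this

/-- Scores have mean zero. -/
lemma IsRegularSubmodel.integral_score (S : IsRegularSubmodel π cperp P Q h) :
    ∫ w, h w ∂(P : Measure (ObsData d k l)) = 0 := by
  have h1 := S.tendsto_integral_sub_div_of_bounded (f := fun _ => 1) measurable_const (M := 1)
    (fun _ => by simp)
  simp only [integral_const, probReal_univ, smul_eq_mul, mul_one, sub_self, zero_div,
    one_mul] at h1
  exact tendsto_nhds_unique h1 tendsto_const_nhds

variable (hπm : Measurable π) (hη : 0 < η) (hπ : ∀ x, η ≤ π x) (hcm : Measurable cperp)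

include hπm hη hπ in
/-- Scores are orthogonal to the functions `f(X̃) (1 - A / π(X))`, because the annotation score does
not vary along the submodel. -/
lemma IsRegularSubmodel.integral_augmentation_mul_score (S : IsRegularSubmodel π cperp P Q h)
    {f : Feat d k l → ℝ} (hfm : Measurable f)
    (hf : MemLp (fun w => f (feat w)) 2 (P : Measure (ObsData d k l))) :
    ∫ w, f (feat w) * (1 - annotR w / π (covar w)) * h w ∂(P : Measure (ObsData d k l)) = 0 := by
  have hm : Measurable fun w : ObsData d k l => 1 - annotR w / π (covar w) :=
    (measurable_annotR.div (hπm.comp measurable_covar)).const_sub 1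
  -- The moments of `f(X̃)` along the path are not controlled, whereas bounded functions are always
  -- differentiable along it. So `f` is truncated, and the truncation is removed by dominated
  -- convergence under `P`.
  set B : ℕ → Set (Feat d k l) := fun N => {x | |f x| ≤ N} with hB
  have hBm : ∀ N, MeasurableSet (B N) := fun N => measurableSet_le hfm.norm measurable_const
  have hbd : ∀ (N : ℕ) x, |(B N).indicator f x| ≤ N := fun N x => by
    by_cases hx : x ∈ B N
    · rw [Set.indicator_of_mem hx]; exact hx
    · rw [Set.indicator_of_notMem hx]; simp
  have hfB : ∀ N, Measurable fun w : ObsData d k l => (B N).indicator f (feat w) := fun N =>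
    (hfm.indicator (hBm N)).comp measurable_feat
  have hzero : ∀ N, ∫ w, (B N).indicator f (feat w) * (1 - annotR w / π (covar w)) * h w
      ∂(P : Measure (ObsData d k l)) = 0 := fun N => by
    -- The mean vanishes under every law of the model, hence identically along the path, and so does
    -- its derivative `E[f (1 - A / π) h]`.
    have hmean : ∀ R : ProbabilityMeasure (ObsData d k l), InModel π cperp R →
        ∫ w, (B N).indicator f (feat w) * (1 - annotR w / π (covar w))
          ∂(R : Measure (ObsData d k l)) = 0 := fun R hR => by
      have hi : Integrable (fun w => (B N).indicator f (feat w)) (R : Measure (ObsData d k l)) :=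
        (integrable_const (N : ℝ)).mono' (hfB N).aestronglyMeasurable
          (ae_of_all _ fun w => hbd N _)
      have hi' : Integrable (fun w => (B N).indicator f (feat w) * (annotR w / π (covar w)))
          (R : Measure (ObsData d k l)) :=
        hi.mul_bdd (c := η⁻¹) (measurable_annotR.div (hπm.comp measurable_covar)).aestronglyMeasurable
          (ae_of_all _ fun w => abs_annotR_div_le hη hπ w)
      simp_rw [mul_sub, mul_one]
      rw [integral_sub hi hi', hR.integral_comp_feat_mul_annotR_div hπm hη hπ
        (hfm.indicator (hBm N)) hi, sub_self]
    have hmm : Measurable fun w : ObsData d k l =>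
        (B N).indicator f (feat w) * (1 - annotR w / π (covar w)) := (hfB N).mul hm
    have h1 := S.tendsto_integral_sub_div_of_bounded hmm (M := N * (1 + η⁻¹))
      (fun w => by
        rw [abs_mul]
        exact mul_le_mul (hbd N _) (abs_one_sub_annotR_div_le hη hπ w) (abs_nonneg _)
          (Nat.cast_nonneg _))
    have hP : InModel π cperp P := S.at_zero ▸ S.mem_model 0
    simp only [fun t => hmean (Q t) (S.mem_model t), hmean P hP, sub_zero, zero_div] at h1
    exact tendsto_nhds_unique h1 tendsto_const_nhds
  have hlim : Tendsto (fun N => ∫ w, (B N).indicator f (feat w) * (1 - annotR w / π (covar w))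
      * h w ∂(P : Measure (ObsData d k l))) atTop
      (𝓝 (∫ w, f (feat w) * (1 - annotR w / π (covar w)) * h w
        ∂(P : Measure (ObsData d k l)))) := by
    refine tendsto_integral_of_dominated_convergence
      (fun w => |f (feat w)| * |h w| * (1 + η⁻¹))
      (fun N => (((hfB N).mul hm).mul S.measurable_score).aestronglyMeasurable)
      ((hf.abs.integrable_mul S.memLp_score.abs).mul_const _)
      (fun N => ae_of_all _ fun w => ?_) (ae_of_all _ fun w => ?_)
    · have h1 := norm_indicator_le_norm_self (s := B N) f (feat w)
      rw [norm_mul, norm_mul, Real.norm_eq_abs, Real.norm_eq_abs, Real.norm_eq_abs]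
      simp only [Real.norm_eq_abs] at h1
      have h2 := mul_le_mul h1 (abs_one_sub_annotR_div_le hη hπ w) (abs_nonneg _) (abs_nonneg _)
      exact (mul_le_mul_of_nonneg_right h2 (abs_nonneg (h w))).trans_eq (by ring)
    · refine tendsto_const_nhds.congr' ?_
      filter_upwards [eventually_ge_atTop ⌈|f (feat w)|⌉₊] with N hN
      rw [Set.indicator_of_mem]
      exact (Nat.le_ceil _).trans (Nat.cast_le.2 hN)
  simp only [hzero] at hlim
  exact tendsto_nhds_unique hlim tendsto_const_nhds

include hπm hη hπ hcm in
-- The numerator is the mean of the fixed function `C^⊥ M / π(X)`, which is therefore a gradient.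
-- Passing to `phiNum` adds the augmentation and a constant, both orthogonal to the score.
lemma IsRegularSubmodel.tendsto_thetaNum (S : IsRegularSubmodel π cperp P Q h) :
    Tendsto (fun t : ℝ => (thetaNum cperp (Q t) - thetaNum cperp P) / t) (𝓝[>] 0)
      (𝓝 (∫ w, phiNum π cperp P w * h w ∂(P : Measure (ObsData d k l)))) := by
  have hP : InModel π cperp P := S.at_zero ▸ S.mem_model 0
  obtain ⟨K, hK⟩ := S.moments_bounded
  have hm : Measurable fun w : ObsData d k l => cperp (regr w) * outcome w / π (covar w) :=
    ((hcm.comp measurable_regr).mul measurable_outcome).div (hπm.comp measurable_covar)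
  have h1 := S.tendsto_integral_sub_div (K := (η ^ 2)⁻¹ * K) hm
    (memLp_weighted_outcome hπm hη hπ hcm hP) (hK.mono fun t ht => by
      have hL := memLp_weighted_outcome hπm hη hπ hcm (S.mem_model t)
      refine ⟨hL, ?_⟩
      have hle := integral_mono hL.integrable_sq
        (((S.mem_model t).memLp_num.integrable_sq).const_mul (η ^ 2)⁻¹) fun w => by
          have h0 := hη.trans_le (hπ (covar w))
          simp only
          rw [div_pow, div_eq_inv_mul]
          exact mul_le_mul_of_nonneg_right (inv_anti₀ (by positivity)
            (pow_le_pow_left₀ hη.le (hπ _) 2)) (sq_nonneg _)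
      rw [integral_const_mul] at hle
      exact hle.trans (mul_le_mul_of_nonneg_left ht.1 (by positivity)))
  simp only [← fun t => (S.mem_model t).thetaNum_eq hπm hη hπ hcm,
    ← hP.thetaNum_eq hπm hη hπ hcm] at h1
  convert h1 using 2
  have ew : Integrable (fun w => cperp (regr w) * outcome w / π (covar w) * h w)
      (P : Measure (ObsData d k l)) :=
    (memLp_weighted_outcome hπm hη hπ hcm hP).integrable_mul S.memLp_score
  have ea : Integrable (fun w => cperp (regr w) * regressionFun P (feat w)
      * (1 - annotR w / π (covar w)) * h w) (P : Measure (ObsData d k l)) :=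
    (memLp_augmentation hP hπm hη hπ hcm).integrable_mul S.memLp_score
  have eh := (S.memLp_score.integrable one_le_two).const_mul (thetaNum cperp P)
  have hk : Measurable fun x : Feat d k l => cperp x.2.2 * regressionFun P x :=
    (hcm.comp measurable_snd.snd).mul (measurable_regressionFun P)
  have hz := S.integral_augmentation_mul_score hπm hη hπ hk
    (hP.memLp_cperp_mul_regressionFun hπm hη hπ hcm)
  have e : ∫ w, phiNum π cperp P w * h w ∂(P : Measure (ObsData d k l))
      = ∫ w, (cperp (regr w) * outcome w / π (covar w) * h w
        + cperp (regr w) * regressionFun P (feat w) * (1 - annotR w / π (covar w)) * h w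
        - thetaNum cperp P * h w) ∂(P : Measure (ObsData d k l)) := by
    refine integral_congr_ae ?_
    filter_upwards [phiNum_ae_eq hP hη hπ] with w hw
    rw [hw]; ring
  have ewa : Integrable (fun w => cperp (regr w) * outcome w / π (covar w) * h w
      + cperp (regr w) * regressionFun P (feat w) * (1 - annotR w / π (covar w)) * h w)
      (P : Measure (ObsData d k l)) := ew.add ea
  rw [e, integral_sub ewa eh, integral_add ew ea, integral_const_mul, S.integral_score]
  have hz' : ∫ w, cperp (regr w) * regressionFun P (feat w) * (1 - annotR w / π (covar w)) * h w
      ∂(P : Measure (ObsData d k l)) = 0 := hz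
  rw [hz']
  ring

include hcm in
lemma IsRegularSubmodel.tendsto_thetaDen (S : IsRegularSubmodel π cperp P Q h) :
    Tendsto (fun t : ℝ => (thetaDen cperp (Q t) - thetaDen cperp P) / t) (𝓝[>] 0)
      (𝓝 (∫ w, phiDen cperp P w * h w ∂(P : Measure (ObsData d k l)))) := by
  have hP : InModel π cperp P := S.at_zero ▸ S.mem_model 0
  obtain ⟨K, hK⟩ := S.moments_bounded
  have h1 := S.tendsto_integral_sub_div (K := K) ((hcm.comp measurable_regr).pow_const 2)
    hP.memLp_den (hK.mono fun t ht => ⟨(S.mem_model t).memLp_den, ht.2⟩)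
  have ec : Integrable (fun w => cperp (regr w) ^ 2 * h w) (P : Measure (ObsData d k l)) :=
    hP.memLp_den.integrable_mul S.memLp_score
  have e : ∫ w, phiDen cperp P w * h w ∂(P : Measure (ObsData d k l))
      = ∫ w, cperp (regr w) ^ 2 * h w ∂(P : Measure (ObsData d k l)) := by
    simp only [phiDen, sub_mul]
    rw [integral_sub ec ((S.memLp_score.integrable one_le_two).const_mul _), integral_const_mul,
      S.integral_score, mul_zero, sub_zero]
  rw [e]
  exact h1

include hπm hη hπ hcm in
/-- `phiRatio` is the gradient of the ratio functional along every regular submodel. -/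
theorem IsRegularSubmodel.tendsto_thetaRatio (S : IsRegularSubmodel π cperp P Q h) :
    Tendsto (fun t : ℝ => (thetaRatio cperp (Q t) - thetaRatio cperp P) / t) (𝓝[>] 0)
      (𝓝 (∫ w, phiRatio π cperp P w * h w ∂(P : Measure (ObsData d k l)))) := by
  have hP : InModel π cperp P := S.at_zero ▸ S.mem_model 0
  have hN := S.tendsto_thetaNum hπm hη hπ hcm
  have hD := S.tendsto_thetaDen hcm
  set N := thetaNum cperp P
  set D := thetaDen cperp P
  have hDpos : 0 < D := hP.den_pos
  have ht0 : Tendsto (fun t : ℝ => t) (𝓝[>] 0) (𝓝 0) :=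
    tendsto_nhdsWithin_of_tendsto_nhds tendsto_id
  have hDt : Tendsto (fun t => thetaDen cperp (Q t)) (𝓝[>] 0) (𝓝 D) := by
    have h1 := (ht0.mul hD).add_const D
    rw [zero_mul, zero_add] at h1
    refine h1.congr' ?_
    filter_upwards [self_mem_nhdsWithin] with t ht
    have : t ≠ 0 := ne_of_gt ht
    field_simp
    ring
  -- Quotient rule: `(N_t / D_t - N / D) / t` is `((N_t - N) / t · D - N · (D_t - D) / t) / (D_t
  -- D)`.
  have hlim := ((hN.mul_const D).sub (hD.const_mul N)).div (hDt.mul_const D)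
    (mul_pos hDpos hDpos).ne'
  have e : ∫ w, phiRatio π cperp P w * h w ∂(P : Measure (ObsData d k l))
      = ((∫ w, phiNum π cperp P w * h w ∂(P : Measure (ObsData d k l))) * D
        - N * ∫ w, phiDen cperp P w * h w ∂(P : Measure (ObsData d k l))) / (D * D) := by
    have e1 : Integrable (fun w => phiNum π cperp P w * h w) (P : Measure (ObsData d k l)) :=
      (memLp_phiNum hP hπm hη hπ hcm).integrable_mul S.memLp_score
    have e2 : Integrable (fun w => phiDen cperp P w * h w) (P : Measure (ObsData d k l)) :=
      (memLp_phiDen hP).integrable_mul S.memLp_score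
    have e3 : ∀ w, phiRatio π cperp P w * h w
        = D⁻¹ * (phiNum π cperp P w * h w - D⁻¹ * N * (phiDen cperp P w * h w)) := fun w => by
      simp only [phiRatio, thetaRatio]; ring
    simp_rw [e3]
    rw [integral_const_mul, integral_sub e1 (e2.const_mul _), integral_const_mul]
    field_simp
  rw [e]
  refine hlim.congr' ?_
  filter_upwards [self_mem_nhdsWithin] with t ht
  have ht' : t ≠ 0 := ne_of_gt ht
  have hDt0 : thetaDen cperp (Q t) ≠ 0 := (S.mem_model t).den_pos.ne'
  rw [Pi.div_apply]
  change _ = ((thetaDen cperp (Q t))⁻¹ * thetaNum cperp (Q t) - D⁻¹ * N) / t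
  field_simp
  ring

end Pathwise

/-! ## Linear tilts -/

section Tilt

variable {𝒲 : Type*} [MeasurableSpace 𝒲] {P : ProbabilityMeasure 𝒲} {g : 𝒲 → ℝ} {s : ℝ}

/-- The measure with density `1 + s g` with respect to `P`. -/
def linTilt (P : ProbabilityMeasure 𝒲) (g : 𝒲 → ℝ) (s : ℝ) : Measure 𝒲 :=
  (P : Measure 𝒲).withDensity fun w => ENNReal.ofReal (1 + s * g w)

lemma linTilt_zero : linTilt P g 0 = P := by
  simp [linTilt]

lemma linTilt_absolutelyContinuous : linTilt P g s ≪ (P : Measure 𝒲) :=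
  withDensity_absolutelyContinuous _ _

variable (hgm : Measurable g) (hs : ∀ w, |s * g w| ≤ 1 / 2)

include hgm hs in
lemma integral_linTilt (f : 𝒲 → ℝ) :
    ∫ w, f w ∂(linTilt P g s) = ∫ w, (1 + s * g w) * f w ∂(P : Measure 𝒲) := by
  rw [linTilt, integral_withDensity_eq_integral_toReal_smul
    ((hgm.const_mul s).const_add 1).ennreal_ofReal (ae_of_all _ fun _ => ENNReal.ofReal_lt_top)]
  refine integral_congr_ae (ae_of_all _ fun w => ?_)
  simp only
  rw [ENNReal.toReal_ofReal (by linarith [(abs_le.1 (hs w)).1]), smul_eq_mul]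

include hs in
-- Domination by `2 P` passes all moment conditions from `P` to the tilt, uniformly in the tilt
-- parameter.
lemma linTilt_le : linTilt P g s ≤ (2 : ℝ≥0∞) • (P : Measure 𝒲) := by
  rw [← withDensity_const]
  refine withDensity_mono (ae_of_all _ fun w => ?_)
  rw [show (2 : ℝ≥0∞) = ENNReal.ofReal 2 by simp]
  exact ENNReal.ofReal_le_ofReal (by linarith [(abs_le.1 (hs w)).2])

include hs in
lemma isProbabilityMeasure_linTilt (hg : Integrable g (P : Measure 𝒲))
    (hg0 : ∫ w, g w ∂(P : Measure 𝒲) = 0) : IsProbabilityMeasure (linTilt P g s) := by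
  have hi : Integrable (fun w => 1 + s * g w) (P : Measure 𝒲) :=
    (integrable_const 1).add (hg.const_mul s)
  constructor
  rw [linTilt, withDensity_apply _ MeasurableSet.univ, Measure.restrict_univ,
    ← ofReal_integral_eq_lintegral_ofReal hi
      (ae_of_all _ fun w => by
        change 0 ≤ 1 + s * g w
        linarith [(abs_le.1 (hs w)).1]), integral_add (integrable_const 1) (hg.const_mul s),
    integral_const_mul, hg0]
  simp

/-- The difference is exactly `-(√(1 + x) - 1)² / 2`, and `|√(1 + x) - 1| ≤ |x|` because `√(1 + x) +
1 ≥ 1`. -/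
lemma abs_sqrt_one_add_sub_le {x : ℝ} (hx : |x| ≤ 1 / 2) : |√(1 + x) - 1 - x / 2| ≤ x ^ 2 / 2 := by
  have h0 : 0 ≤ 1 + x := by linarith [(abs_le.1 hx).1]
  have h1 := Real.sq_sqrt h0
  have h2 := Real.sqrt_nonneg (1 + x)
  have e : √(1 + x) - 1 - x / 2 = -((√(1 + x) - 1) ^ 2 / 2) := by linear_combination (1 / 2) * h1
  have h3 : (√(1 + x) - 1) * (√(1 + x) + 1) = x := by linear_combination h1
  have h4 : (√(1 + x) - 1) ^ 2 ≤ x ^ 2 := by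
    calc (√(1 + x) - 1) ^ 2 ≤ (√(1 + x) - 1) ^ 2 * (√(1 + x) + 1) ^ 2 :=
          le_mul_of_one_le_right (sq_nonneg _) (by nlinarith)
      _ = x ^ 2 := by rw [← mul_pow, h3]
  rw [e, abs_neg, abs_of_nonneg (by positivity)]
  linarith

include hgm in
/-- The path of linear tilts in a bounded direction `g` is differentiable in quadratic mean, with
score `g`. -/
lemma diffInQuadraticMean_linTilt {Q : ℝ → ProbabilityMeasure 𝒲} {M : ℝ} (hM : ∀ w, |g w| ≤ M)
    (hQ : ∀ᶠ t in 𝓝[>] (0 : ℝ), (Q t : Measure 𝒲) = linTilt P g t) :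
    DiffInQuadraticMean P Q g := by
  have hM0 : 0 ≤ M := by
    obtain ⟨w⟩ := P.nonempty
    exact (abs_nonneg _).trans (hM w)
  have hsmall : ∀ᶠ t in 𝓝[>] (0 : ℝ), t * M < 1 / 2 := by
    have : Tendsto (fun t : ℝ => t * M) (𝓝[>] 0) (𝓝 (0 * M)) :=
      (tendsto_nhdsWithin_of_tendsto_nhds tendsto_id).mul_const M
    rw [zero_mul] at this
    exact this.eventually (gt_mem_nhds (by norm_num))
  have hlim : Tendsto (fun t : ℝ => ENNReal.ofReal ((t * (M ^ 2 / 2)) ^ 2)) (𝓝[>] 0) (𝓝 0) := by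
    have : Tendsto (fun t : ℝ => (t * (M ^ 2 / 2)) ^ 2) (𝓝[>] 0) (𝓝 ((0 * (M ^ 2 / 2)) ^ 2)) :=
      ((tendsto_nhdsWithin_of_tendsto_nhds tendsto_id).mul_const _).pow 2
    simpa using ENNReal.tendsto_ofReal this
  refine tendsto_of_tendsto_of_tendsto_of_le_of_le' tendsto_const_nhds hlim
    (Eventually.of_forall fun _ => bot_le) ?_
  filter_upwards [hQ, hsmall, self_mem_nhdsWithin] with t hQt ht ht0
  have ht0 : 0 < t := ht0
  have hb : ∀ w, |t * g w| ≤ 1 / 2 := fun w => by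
    rw [abs_mul, abs_of_pos ht0]
    exact (mul_le_mul_of_nonneg_left (hM w) ht0.le).trans ht.le
  simp only
  set ν : Measure 𝒲 := (P : Measure 𝒲) + (Q t : Measure 𝒲) with hν
  have hQP : (Q t : Measure 𝒲) ≪ (P : Measure 𝒲) := hQt ▸ linTilt_absolutelyContinuous
  have hνP : ν ≪ (P : Measure 𝒲) := fun s hs => by
    rw [hν, Measure.add_apply, hs, hQP hs, add_zero]
  have hdm : Measurable fun w => ENNReal.ofReal (1 + t * g w) :=
    ((hgm.const_mul t).const_add 1).ennreal_ofReal
  have hd : (Q t : Measure 𝒲).rnDeriv (P : Measure 𝒲) =ᵐ[ν]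
      fun w => ENNReal.ofReal (1 + t * g w) :=
    hνP.ae_le (by rw [hQt]; exact Measure.rnDeriv_withDensity _ hdm)
  -- Chain rule `dQ_t/dν = (1 + t g) dP/dν`: the root of `dP/dν` factors out of the integrand,
  -- leaving the second-order error of `√(1 + t g)`, bounded uniformly in `w`.
  have hmul := Measure.rnDeriv_mul_rnDeriv (κ := ν) hQP
  have hPle := Measure.lintegral_rnDeriv_le (μ := (P : Measure 𝒲)) (ν := ν)
  rw [measure_univ] at hPle
  calc ∫⁻ w, ENNReal.ofReal (((√(((Q t : Measure 𝒲).rnDeriv ν w).toReal)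
          - √(((P : Measure 𝒲).rnDeriv ν w).toReal)) / t
          - g w / 2 * √(((P : Measure 𝒲).rnDeriv ν w).toReal)) ^ 2) ∂ν
      ≤ ∫⁻ w, ENNReal.ofReal ((t * (M ^ 2 / 2)) ^ 2) * (P : Measure 𝒲).rnDeriv ν w ∂ν := by
        refine lintegral_mono_ae ?_
        filter_upwards [hd, hmul, Measure.rnDeriv_lt_top (P : Measure 𝒲) ν] with w h1 h2 h3
        have h0 : 0 ≤ 1 + t * g w := by linarith [(abs_le.1 (hb w)).1]
        rw [← h2, Pi.mul_apply, h1, ENNReal.toReal_mul, ENNReal.toReal_ofReal h0,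
          Real.sqrt_mul h0]
        set p := ((P : Measure 𝒲).rnDeriv ν w).toReal with hp
        have hpp : (P : Measure 𝒲).rnDeriv ν w = ENNReal.ofReal p := (ENNReal.ofReal_toReal h3.ne).symm
        rw [hpp, ← ENNReal.ofReal_mul (sq_nonneg _)]
        refine ENNReal.ofReal_le_ofReal ?_
        have hp0 : 0 ≤ p := ENNReal.toReal_nonneg
        have e : (√(1 + t * g w) * √p - √p) / t - g w / 2 * √p
            = (√(1 + t * g w) - 1 - t * g w / 2) / t * √p := by
          field_simp
        rw [e, mul_pow, Real.sq_sqrt hp0]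
        refine mul_le_mul_of_nonneg_right ?_ hp0
        refine sq_le_sq' ?_ ?_ |>.trans_eq rfl
        all_goals
          have h4 : |(√(1 + t * g w) - 1 - t * g w / 2) / t| ≤ t * (M ^ 2 / 2) := by
            rw [abs_div, abs_of_pos ht0, div_le_iff₀ ht0]
            refine (abs_sqrt_one_add_sub_le (hb w)).trans ?_
            have h5 : g w ^ 2 ≤ M ^ 2 := sq_le_sq' (by linarith [(abs_le.1 (hM w)).1])
              ((abs_le.1 (hM w)).2)
            nlinarith [mul_le_mul_of_nonneg_left h5 (sq_nonneg t)]
        · exact (abs_le.1 h4).1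
        · exact (abs_le.1 h4).2
    _ = ENNReal.ofReal ((t * (M ^ 2 / 2)) ^ 2) * ∫⁻ w, (P : Measure 𝒲).rnDeriv ν w ∂ν :=
        lintegral_const_mul _ (Measure.measurable_rnDeriv _ _)
    _ ≤ ENNReal.ofReal ((t * (M ^ 2 / 2)) ^ 2) := mul_le_of_le_one_right' hPle

end Tilt

/-! ## The tangent space -/

section Tangent

variable {d k l : ℕ} {π : (Fin k → ℝ) → ℝ} {cperp : (Fin d → ℝ) → ℝ}
  {P : ProbabilityMeasure (ObsData d k l)} {g : ObsData d k l → ℝ}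

lemma measurable_annotation_error (hπm : Measurable π) :
    Measurable fun w : ObsData d k l => annotR w - π (covar w) :=
  measurable_annotR.sub (hπm.comp measurable_covar)

/-- Bounded directions `g` along which a linear tilt keeps the annotation score. -/
structure IsTiltDirection (π : (Fin k → ℝ) → ℝ) (P : ProbabilityMeasure (ObsData d k l))
    (g : ObsData d k l → ℝ) : Prop where
  measurable : Measurable g
  bounded : ∃ M, ∀ w, |g w| ≤ M
  integral_eq_zero : ∫ w, g w ∂(P : Measure (ObsData d k l)) = 0
  orthogonal : ∀ S : Set (Feat d k l), MeasurableSet S →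
    ∫ w in feat ⁻¹' S, g w * (annotR w - π (covar w)) ∂(P : Measure (ObsData d k l)) = 0

lemma IsTiltDirection.integrable (hg : IsTiltDirection π P g) :
    Integrable g (P : Measure (ObsData d k l)) :=
  let ⟨M, hM⟩ := hg.bounded
  (integrable_const M).mono' hg.measurable.aestronglyMeasurable (ae_of_all _ hM)

/-- Tilting adds `s ∫_S g (A - π)` to `∫_S (A - π)` for each event `S` of the features; both are
zero, so `π` remains the annotation score. Null sets pass by absolute continuity, moments by
`linTilt_le`, and the denominator stays positive because the density is at least `1/2`. -/
lemma InModel.of_linTilt (hP : InModel π cperp P) (hπm : Measurable π)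
    (hπ0 : ∀ x, 0 ≤ π x) (hπ1 : ∀ x, π x ≤ 1)
    (hg : IsTiltDirection π P g) {s : ℝ} (hs : ∀ w, |s * g w| ≤ 1 / 2)
    {Q : ProbabilityMeasure (ObsData d k l)} (hQ : (Q : Measure (ObsData d k l)) = linTilt P g s) :
    InModel π cperp Q := by
  have hac : (Q : Measure (ObsData d k l)) ≪ P := hQ ▸ linTilt_absolutelyContinuous
  have hle : (Q : Measure (ObsData d k l)) ≤ (2 : ℝ≥0∞) • (P : Measure (ObsData d k l)) :=
    hQ ▸ linTilt_le hs
  have hm := (measurable_feat (d := d) (k := k) (l := l)).comap_le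
  have hb : ∀ w : ObsData d k l, ‖annotR w - π (covar w)‖ ≤ 1 := fun w => by
    rw [Real.norm_eq_abs, abs_le]
    constructor <;>
      linarith [annotR_nonneg w, annotR_le_one w, hπ0 (covar w), hπ1 (covar w)]
  have hdi : ∀ R : ProbabilityMeasure (ObsData d k l),
      Integrable (fun w => annotR w - π (covar w)) (R : Measure (ObsData d k l)) := fun R =>
    (integrable_const (1 : ℝ)).mono' (measurable_annotation_error hπm).aestronglyMeasurable
      (ae_of_all _ hb)
  have hπi : ∀ R : ProbabilityMeasure (ObsData d k l),
      Integrable (fun w : ObsData d k l => π (covar w)) (R : Measure (ObsData d k l)) := fun R =>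
    ((integrable_annotR R).sub (hdi R)).congr (ae_of_all _ fun w => by simp)
  have hset : ∀ S : Set (Feat d k l), MeasurableSet S →
      ∫ w in feat ⁻¹' S, (annotR w - π (covar w)) ∂(Q : Measure (ObsData d k l)) = 0 := by
    intro S hS
    have hSm := measurable_feat (d := d) (k := k) (l := l) hS
    have h1 : ∫ w in feat ⁻¹' S, (annotR w - π (covar w)) ∂(P : Measure (ObsData d k l)) = 0 := by
      rw [integral_sub (integrable_annotR P).integrableOn (hπi P).integrableOn, sub_eq_zero,
        ← setIntegral_condExp hm (integrable_annotR P) ⟨S, hS, rfl⟩]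
      exact integral_congr_ae (ae_restrict_of_ae hP.annotation_score)
    rw [← integral_indicator hSm, hQ, integral_linTilt hg.measurable hs]
    have e : ∀ w, (1 + s * g w) * (feat ⁻¹' S).indicator (fun w => annotR w - π (covar w)) w
        = (feat ⁻¹' S).indicator (fun w => (annotR w - π (covar w))
          + s * (g w * (annotR w - π (covar w)))) w := fun w => by
      by_cases hw : w ∈ feat ⁻¹' S
      · rw [Set.indicator_of_mem hw, Set.indicator_of_mem hw]; ring
      · rw [Set.indicator_of_notMem hw, Set.indicator_of_notMem hw, mul_zero]
    simp_rw [e]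
    have hgi : Integrable (fun w => g w * (annotR w - π (covar w)))
        (P : Measure (ObsData d k l)) :=
      hg.integrable.mul_bdd (c := 1) (measurable_annotation_error hπm).aestronglyMeasurable
        (ae_of_all _ hb)
    rw [integral_indicator hSm, integral_add (hdi P).integrableOn
      (hgi.const_mul s).integrableOn, integral_const_mul, hg.orthogonal S hS, h1]
    simp
  refine ⟨hac.ae_le hP.outcome_eq_zero, ?_,
    hP.integrable_outcome.of_measure_le_smul (by simp) hle,
    hP.memLp_num.of_measure_le_smul (by simp) hle,
    hP.memLp_den.of_measure_le_smul (by simp) hle, ?_⟩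
  · refine (ae_eq_condExp_of_forall_setIntegral_eq hm (integrable_annotR Q)
      (fun _ _ _ => (hπi Q).integrableOn) ?_ ?_).symm
    · rintro _ ⟨S, hS, rfl⟩ -
      have h := hset S hS
      rw [integral_sub (integrable_annotR Q).integrableOn (hπi Q).integrableOn] at h
      linarith
    · exact (stronglyMeasurable_comp_feat (hπm.comp measurable_fst)).aestronglyMeasurable
  · have hi := hP.memLp_den.integrable one_le_two
    rw [thetaDen, hQ, integral_linTilt hg.measurable hs]
    have h1 : 0 < ∫ w, 1 / 2 * cperp (regr w) ^ 2 ∂(P : Measure (ObsData d k l)) := by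
      rw [integral_const_mul]; exact mul_pos (by norm_num) hP.den_pos
    refine h1.trans_le (integral_mono (hi.const_mul _) ?_ fun w => ?_)
    · refine (hi.mul_bdd (c := 3 / 2) (g := fun w => 1 + s * g w)
        ((hg.measurable.const_mul s).const_add 1).aestronglyMeasurable
        (ae_of_all _ fun w => ?_)).congr (ae_of_all _ fun w => mul_comm _ _)
      rw [Real.norm_eq_abs, abs_le]
      constructor <;> linarith [(abs_le.1 (hs w)).1, (abs_le.1 (hs w)).2]
    · exact mul_le_mul_of_nonneg_right (by linarith [(abs_le.1 (hs w)).1]) (sq_nonneg _)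

/-- Every tilt direction is the score of a regular submodel. -/
theorem IsTiltDirection.exists_isRegularSubmodel (hg : IsTiltDirection π P g)
    (hP : InModel π cperp P) (hπm : Measurable π) (hπ0 : ∀ x, 0 ≤ π x)
    (hπ1 : ∀ x, π x ≤ 1) : ∃ Q, IsRegularSubmodel π cperp P Q g := by
  obtain ⟨M, hM⟩ := hg.bounded
  -- A submodel must lie in the model for every real `t`, but `1 + t g` is a density bounded away
  -- from zero only for small `t`. For the others the path is parked at `P`; the score depends only
  -- on `t ↓ 0`.
  set τ : ℝ → ℝ := fun t => if |t| * M ≤ 1 / 2 then t else 0 with hτ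
  have hs : ∀ t w, |τ t * g w| ≤ 1 / 2 := fun t w => by
    simp only [hτ]
    split_ifs with h
    · rw [abs_mul]
      exact (mul_le_mul_of_nonneg_left (hM w) (abs_nonneg t)).trans h
    · simp
  set Q : ℝ → ProbabilityMeasure (ObsData d k l) := fun t =>
    ⟨linTilt P g (τ t), isProbabilityMeasure_linTilt (hs t) hg.integrable
      hg.integral_eq_zero⟩ with hQ
  have hQc : ∀ t, (Q t : Measure (ObsData d k l)) = linTilt P g (τ t) := fun t => rfl
  have hev : ∀ᶠ t in 𝓝[>] (0 : ℝ), τ t = t := by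
    have : Tendsto (fun t : ℝ => |t| * M) (𝓝[>] 0) (𝓝 (|0| * M)) :=
      ((tendsto_nhdsWithin_of_tendsto_nhds tendsto_id).abs).mul_const M
    rw [abs_zero, zero_mul] at this
    filter_upwards [this.eventually (gt_mem_nhds (by norm_num : (0 : ℝ) < 1 / 2))] with t ht
    simp only [hτ]
    rw [if_pos ht.le]
  have hmodel : ∀ t, InModel π cperp (Q t) := fun t =>
    hP.of_linTilt hπm hπ0 hπ1 hg (hs t) (hQc t)
  have hmom : ∀ t {f : ObsData d k l → ℝ}, MemLp f 2 (P : Measure (ObsData d k l)) →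
      ∫ w, f w ^ 2 ∂(Q t : Measure (ObsData d k l))
        ≤ 2 * ∫ w, f w ^ 2 ∂(P : Measure (ObsData d k l)) := fun t f hf => by
    have hi : Integrable (fun w => f w ^ 2) ((2 : ℝ≥0∞) • (P : Measure (ObsData d k l))) :=
      hf.integrable_sq.smul_measure (by simp)
    have h := integral_mono_measure ((hQc t).trans_le (linTilt_le (hs t)))
      (ae_of_all _ fun w => sq_nonneg (f w)) hi
    rwa [integral_smul_measure, ENNReal.toReal_ofNat, smul_eq_mul] at h
  refine ⟨Q, ?_, hmodel, hg.measurable,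
    MemLp.of_bound hg.measurable.aestronglyMeasurable M (ae_of_all _ hM),
    diffInQuadraticMean_linTilt hg.measurable hM (hev.mono fun t ht => by rw [hQc, ht]), ?_⟩
  · refine Subtype.ext ?_
    change linTilt P g (τ 0) = _
    rw [show τ 0 = 0 by simp [hτ], linTilt_zero]
    rfl
  · exact ⟨max _ _, Eventually.of_forall fun t => ⟨(hmom t hP.memLp_num).trans (le_max_left _ _),
      (hmom t hP.memLp_den).trans (le_max_right _ _)⟩⟩

end Tangent

/-! ## The efficient influence function lies in the tangent space -/

section TangentSpace

variable {d k l : ℕ} {π : (Fin k → ℝ) → ℝ} {cperp : (Fin d → ℝ) → ℝ}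
  {P : ProbabilityMeasure (ObsData d k l)} {η : ℝ}

lemma InModel.setIntegral_comp_feat_mul_annotR (hP : InModel π cperp P) {f : Feat d k l → ℝ}
    (hf : Measurable f) (hint : Integrable (fun w => f (feat w)) (P : Measure (ObsData d k l)))
    {S : Set (Feat d k l)} (hS : MeasurableSet S) :
    ∫ w in feat ⁻¹' S, f (feat w) * annotR w ∂(P : Measure (ObsData d k l))
      = ∫ w in feat ⁻¹' S, f (feat w) * π (covar w) ∂(P : Measure (ObsData d k l)) := by
  have hSm := measurable_feat (d := d) (k := k) (l := l) hS
  have e : ∀ a : ObsData d k l → ℝ, (fun w => S.indicator f (feat w) * a w)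
      = (feat ⁻¹' S).indicator fun w => f (feat w) * a w := fun a => by
    ext w
    by_cases hw : feat w ∈ S
    · rw [Set.indicator_of_mem hw, Set.indicator_of_mem (s := feat ⁻¹' S) hw]
    · rw [Set.indicator_of_notMem hw, Set.indicator_of_notMem (s := feat ⁻¹' S) hw, zero_mul]
  have h := hP.integral_comp_feat_mul_annotR (hf.indicator hS) (hint.indicator hSm)
  rwa [e, e, integral_indicator hSm, integral_indicator hSm] at h

/-- Centred bounded functions of the features are tilt directions. -/
lemma InModel.isTiltDirection_comp_feat (hP : InModel π cperp P) (hπm : Measurable π)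
    {f : Feat d k l → ℝ} (hf : Measurable f) {M : ℝ} (hM : ∀ x, |f x| ≤ M) :
    IsTiltDirection π P fun w => f (feat w)
      - ∫ w, f (feat w) ∂(P : Measure (ObsData d k l)) := by
  have hi : Integrable (fun w => f (feat w)) (P : Measure (ObsData d k l)) :=
    (integrable_const M).mono' (hf.comp measurable_feat).aestronglyMeasurable
      (ae_of_all _ fun w => hM _)
  set c := ∫ w, f (feat w) ∂(P : Measure (ObsData d k l))
  have hci : Integrable (fun w => f (feat w) - c) (P : Measure (ObsData d k l)) :=
    hi.sub (integrable_const c)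
  refine ⟨(hf.comp measurable_feat).sub_const _, ⟨M + |c|, fun w => (abs_sub _ _).trans
    (add_le_add_left (hM _) _)⟩, ?_, fun S hS => ?_⟩
  · rw [integral_sub hi (integrable_const _)]
    simp [c]
  · have h := hP.setIntegral_comp_feat_mul_annotR (hf.sub_const c) hci hS
    have hπi : Integrable (fun w => (f (feat w) - c) * π (covar w))
        (P : Measure (ObsData d k l)) := by
      refine hci.mul_bdd (c := 1) (hπm.comp measurable_covar).aestronglyMeasurable ?_
      filter_upwards [ae_bdd_abs_condExp_of_ae_bdd_abs
        (m := MeasurableSpace.comap (feat : ObsData d k l → _) inferInstance)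
        (μ := (P : Measure (ObsData d k l))) (f := annotR) (R := 1) (ae_of_all _ fun w => by
          rw [abs_of_nonneg (annotR_nonneg w)]; exact annotR_le_one w),
        hP.annotation_score] with w h1 h2
      rwa [h2] at h1
    have hai : Integrable (fun w => (f (feat w) - c) * annotR w)
        (P : Measure (ObsData d k l)) :=
      hci.mul_bdd (c := 1) measurable_annotR.aestronglyMeasurable (ae_of_all _ fun w => by
        rw [Real.norm_of_nonneg (annotR_nonneg w)]; exact annotR_le_one w)
    simp_rw [mul_sub]
    rw [integral_sub hai.integrableOn hπi.integrableOn, h, sub_self]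

/-- Truncation at level `M`. -/
def hardTrunc (M x : ℝ) : ℝ := if M ≤ |x| then 0 else x

lemma measurable_hardTrunc (M : ℝ) : Measurable (hardTrunc M) :=
  Measurable.ite (measurableSet_le measurable_const measurable_norm) measurable_const measurable_id

lemma abs_hardTrunc_le {M : ℝ} (hM : 0 ≤ M) (x : ℝ) : |hardTrunc M x| ≤ M := by
  unfold hardTrunc
  split_ifs with h
  · simpa
  · exact (not_le.1 h).le

lemma exists_eLpNorm_sub_hardTrunc_le {f : ObsData d k l → ℝ} (hfm : Measurable f)
    (hf : MemLp f 2 (P : Measure (ObsData d k l))) {ε : ℝ} (hε : 0 < ε) :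
    ∃ M : ℝ, 0 ≤ M ∧ eLpNorm (fun w => f w - hardTrunc M (f w)) 2 (P : Measure (ObsData d k l))
      ≤ ENNReal.ofReal ε := by
  obtain ⟨M, hM0, hM⟩ := hf.eLpNorm_indicator_norm_ge_pos_le hfm.stronglyMeasurable hε
  refine ⟨M, hM0.le, hM.trans_eq' (congrArg (fun g => eLpNorm g 2 _) ?_)⟩
  ext w
  by_cases hw : M ≤ |f w|
  · rw [Set.indicator_of_mem (by simpa using hw), hardTrunc, if_pos hw, sub_zero]
  · rw [Set.indicator_of_notMem (by simpa using hw), hardTrunc, if_neg hw, sub_self]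

/-- Square-integrable centred functions of the features are limits of tilt directions. -/
lemma InModel.exists_isTiltDirection_comp_feat (hP : InModel π cperp P) (hπm : Measurable π)
    {F : Feat d k l → ℝ} (hF : Measurable F)
    (hFL : MemLp (fun w => F (feat w)) 2 (P : Measure (ObsData d k l)))
    (hF0 : ∫ w, F (feat w) ∂(P : Measure (ObsData d k l)) = 0) {ε : ℝ} (hε : 0 < ε) :
    ∃ g, IsTiltDirection π P g ∧
      eLpNorm ((fun w => F (feat w)) - g) 2 (P : Measure (ObsData d k l)) ≤ ENNReal.ofReal ε := by
  obtain ⟨M, hM0, hM⟩ := exists_eLpNorm_sub_hardTrunc_le (hF.comp measurable_feat) hFL (half_pos hε)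
  have hT : Measurable fun x => hardTrunc M (F x) := (measurable_hardTrunc M).comp hF
  have hTi : Integrable (fun w => hardTrunc M (F (feat w))) (P : Measure (ObsData d k l)) :=
    (integrable_const M).mono' (hT.comp measurable_feat).aestronglyMeasurable
      (ae_of_all _ fun w => abs_hardTrunc_le hM0 _)
  refine ⟨_, hP.isTiltDirection_comp_feat hπm hT fun x => abs_hardTrunc_le hM0 (F x), ?_⟩
  set r : ObsData d k l → ℝ := fun w => F (feat w) - hardTrunc M (F (feat w)) with hr
  have hr1 : eLpNorm r 2 (P : Measure (ObsData d k l)) ≤ ENNReal.ofReal (ε / 2) := hM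
  have hrm : AEStronglyMeasurable r (P : Measure (ObsData d k l)) :=
    ((hF.sub hT).comp measurable_feat).aestronglyMeasurable
  have hri : ∫ w, r w ∂(P : Measure (ObsData d k l))
      = - ∫ w, hardTrunc M (F (feat w)) ∂(P : Measure (ObsData d k l)) := by
    rw [hr, integral_sub (hFL.integrable one_le_two) hTi, hF0, zero_sub]
  -- As `F` has mean zero, recentring the truncation subtracts from the truncation error `r` its own
  -- mean. Viewed as a conditional expectation on the trivial σ-algebra, that mean is no larger in
  -- norm than `r`.
  have e : (fun w => F (feat w)) - (fun w => hardTrunc M (F (feat w))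
      - ∫ w, hardTrunc M (F (feat w)) ∂(P : Measure (ObsData d k l)))
      = r - (P : Measure (ObsData d k l))[r | ⊥] := by
    ext w
    rw [condExp_bot, hri]
    simp only [hr, Pi.sub_apply]
    ring
  rw [e]
  refine (eLpNorm_sub_le hrm integrable_condExp.aestronglyMeasurable one_le_two).trans ?_
  refine (add_le_add hr1 ((eLpNorm_condExp_le_eLpNorm r one_le_two).trans hr1)).trans_eq ?_
  rw [← ENNReal.ofReal_add (by positivity) (by positivity), add_halves]

/-! ### Perturbations of the outcome law, and membership in the tangent space -/

section Score

variable (hP : InModel π cperp P) (hπm : Measurable π) (hη : 0 < η) (hπ : ∀ x, η ≤ π x)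

include hP in
lemma InModel.condExp_comp_feat_mul_annotR {f : Feat d k l → ℝ} (hf : Measurable f)
    (hint : Integrable (fun w => f (feat w)) (P : Measure (ObsData d k l))) :
    (P : Measure (ObsData d k l))[fun w => f (feat w) * annotR w |
        MeasurableSpace.comap feat inferInstance]
      =ᵐ[(P : Measure (ObsData d k l))] fun w => f (feat w) * π (covar w) := by
  have hfa : Integrable (fun w => f (feat w) * annotR w) (P : Measure (ObsData d k l)) :=
    hint.mul_bdd (c := 1) measurable_annotR.aestronglyMeasurable (ae_of_all _ fun w => by
      rw [Real.norm_of_nonneg (annotR_nonneg w)]; exact annotR_le_one w)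
  filter_upwards [condExp_mul_of_stronglyMeasurable_left (stronglyMeasurable_comp_feat hf) hfa
    (integrable_annotR P), hP.annotation_score] with w h1 h2
  rw [show (fun w => f (feat w) * annotR w) = (fun w => f (feat w)) * annotR from rfl, h1,
    Pi.mul_apply, h2]

include hP hπm in
/-- Bounded functions that vanish on units that are not annotated, and are centred given the
features, are tilt directions. -/
lemma InModel.isTiltDirection_annot {g : ObsData d k l → ℝ} (hgm : Measurable g) {M : ℝ}
    (hgM : ∀ w, |g w| ≤ M) (hgA : ∀ w, annotR w * g w = g w)
    (hg0 : (P : Measure (ObsData d k l))[g | MeasurableSpace.comap feat inferInstance]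
      =ᵐ[(P : Measure (ObsData d k l))] 0) : IsTiltDirection π P g := by
  have hm := (measurable_feat (d := d) (k := k) (l := l)).comap_le
  have hgi : Integrable g (P : Measure (ObsData d k l)) :=
    (integrable_const M).mono' hgm.aestronglyMeasurable (ae_of_all _ hgM)
  have hπ1 : ∀ᵐ w ∂(P : Measure (ObsData d k l)), ‖π (covar w)‖ ≤ 1 := by
    filter_upwards [ae_bdd_abs_condExp_of_ae_bdd_abs
      (m := MeasurableSpace.comap (feat : ObsData d k l → _) inferInstance)
      (μ := (P : Measure (ObsData d k l))) (f := annotR) (R := 1) (ae_of_all _ fun w => by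
        rw [abs_of_nonneg (annotR_nonneg w)]; exact annotR_le_one w),
      hP.annotation_score] with w h1 h2
    rwa [h2] at h1
  have hπg : Integrable (fun w => g w * π (covar w)) (P : Measure (ObsData d k l)) :=
    hgi.mul_bdd (c := 1) (hπm.comp measurable_covar).aestronglyMeasurable hπ1
  refine ⟨hgm, ⟨M, hgM⟩, ?_, fun S hS => ?_⟩
  · rw [← integral_condExp hm, integral_congr_ae hg0]
    simp
  · have hS' : MeasurableSet[MeasurableSpace.comap feat inferInstance] (feat ⁻¹' S) := ⟨S, hS, rfl⟩
    have h1 : ∫ w in feat ⁻¹' S, g w ∂(P : Measure (ObsData d k l)) = 0 := by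
      rw [← setIntegral_condExp hm hgi hS', integral_congr_ae (ae_restrict_of_ae hg0)]
      simp
    have hpull := condExp_mul_of_stronglyMeasurable_right
      (stronglyMeasurable_comp_feat (hπm.comp measurable_fst)) (f := g) hπg hgi
    have h2 : ∫ w in feat ⁻¹' S, g w * π (covar w) ∂(P : Measure (ObsData d k l)) = 0 := by
      rw [← setIntegral_condExp hm hπg hS']
      refine (integral_congr_ae (ae_restrict_of_ae ?_)).trans (integral_zero' _ _)
      filter_upwards [hpull, hg0] with w h3 h4
      refine h3.trans ?_
      rw [Pi.mul_apply, h4, Pi.zero_apply, zero_mul]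
    -- Since `A g = g`, the product is `(1 - π) g`, which is centred given the features along with
    -- `g`.
    have e : ∀ w, g w * (annotR w - π (covar w)) = g w - g w * π (covar w) := fun w => by
      linear_combination hgA w
    simp_rw [e]
    rw [integral_sub hgi.integrableOn hπg.integrableOn, h1, h2, sub_zero]

include hP hπm hη hπ in
/-- Square-integrable functions that vanish on units that are not annotated, and are centred given
the features, are limits of tilt directions. -/
lemma InModel.exists_isTiltDirection_annot {f : ObsData d k l → ℝ} (hfm : Measurable f)
    (hf : MemLp f 2 (P : Measure (ObsData d k l))) (hfA : ∀ w, annotR w * f w = f w)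
    (hf0 : (P : Measure (ObsData d k l))[f | MeasurableSpace.comap feat inferInstance]
      =ᵐ[(P : Measure (ObsData d k l))] 0) {ε : ℝ} (hε : 0 < ε) :
    ∃ g, IsTiltDirection π P g ∧
      eLpNorm (f - g) 2 (P : Measure (ObsData d k l)) ≤ ENNReal.ofReal ε := by
  have hm := (measurable_feat (d := d) (k := k) (l := l)).comap_le
  -- The truncation error counts once, and its recentring at most `η⁻¹` times.
  have hδ : 0 < ε / (1 + η⁻¹) := by positivity
  obtain ⟨M, hM0, hM⟩ := exists_eLpNorm_sub_hardTrunc_le hfm hf hδ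
  set q : ObsData d k l → ℝ := fun w => hardTrunc M (f w) with hq
  set r : ObsData d k l → ℝ := fun w => f w - q w with hr
  have hqm : Measurable q := (measurable_hardTrunc M).comp hfm
  have hqb : ∀ w, |q w| ≤ M := fun w => abs_hardTrunc_le hM0 _
  have hqi : Integrable q (P : Measure (ObsData d k l)) :=
    (integrable_const M).mono' hqm.aestronglyMeasurable (ae_of_all _ hqb)
  have hqA : ∀ w, annotR w * q w = q w := fun w => by
    have h := hfA w
    unfold annotR at h ⊢
    split_ifs at h ⊢ with hA
    · rw [one_mul]
    · rw [zero_mul] at h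
      simp [hq, ← h, hardTrunc]
  -- a bounded version of `E[q | X̃]`
  obtain ⟨e₀, he₀m, he₀⟩ := Measurable.exists_eq_measurable_comp (f := feat)
    (stronglyMeasurable_condExp (μ := (P : Measure (ObsData d k l))) (f := q)
      (m := MeasurableSpace.comap feat inferInstance)).measurable
  set e : Feat d k l → ℝ := fun x => max (-M) (min M (e₀ x)) with he
  have hem : Measurable e := measurable_const.max (measurable_const.min he₀m)
  have heb : ∀ x, |e x| ≤ M := fun x => by
    rw [abs_le]
    exact ⟨le_max_left _ _, max_le (by linarith) (min_le_left _ _)⟩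
  have hei : Integrable (fun w => e (feat w)) (P : Measure (ObsData d k l)) :=
    (integrable_const M).mono' (hem.comp measurable_feat).aestronglyMeasurable
      (ae_of_all _ fun w => heb _)
  have hqe : (P : Measure (ObsData d k l))[q | MeasurableSpace.comap feat inferInstance]
      =ᵐ[(P : Measure (ObsData d k l))] fun w => e (feat w) := by
    filter_upwards [ae_bdd_abs_condExp_of_ae_bdd_abs
      (m := MeasurableSpace.comap (feat : ObsData d k l → _) inferInstance)
      (μ := (P : Measure (ObsData d k l))) (ae_of_all _ hqb)] with w hw
    rw [he₀] at hw ⊢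
    simp only [Function.comp_apply, he] at hw ⊢
    rw [min_eq_right (abs_le.1 hw).2, max_eq_right (abs_le.1 hw).1]
  -- The recentring must itself vanish when `A = 0`. So `E[q | X̃] A / π(X)` is subtracted instead
  -- of `E[q | X̃]`; both have the same conditional mean.
  set κ : Feat d k l → ℝ := fun x => e x / π x.1 with hκ
  have hκm : Measurable κ := hem.div (hπm.comp measurable_fst)
  have hκb : ∀ x, |κ x| ≤ η⁻¹ * |e x| := fun x => by
    have h0 := hη.trans_le (hπ x.1)
    simp only [hκ]
    rw [abs_div, abs_of_pos h0, div_eq_inv_mul]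
    exact mul_le_mul_of_nonneg_right (inv_anti₀ hη (hπ _)) (abs_nonneg _)
  have hκM : ∀ x, |κ x| ≤ η⁻¹ * M := fun x =>
    (hκb x).trans (mul_le_mul_of_nonneg_left (heb x) (by positivity))
  have hκi : Integrable (fun w => κ (feat w)) (P : Measure (ObsData d k l)) :=
    (integrable_const (η⁻¹ * M)).mono' (hκm.comp measurable_feat).aestronglyMeasurable
      (ae_of_all _ fun w => hκM _)
  have hκAb : ∀ w : ObsData d k l, |κ (feat w) * annotR w| ≤ |κ (feat w)| := fun w => by
    rw [abs_mul, abs_of_nonneg (annotR_nonneg w)]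
    exact mul_le_of_le_one_right (abs_nonneg _) (annotR_le_one w)
  have hκAm : Measurable fun w : ObsData d k l => κ (feat w) * annotR w :=
    (hκm.comp measurable_feat).mul measurable_annotR
  have hκAi : Integrable (fun w => κ (feat w) * annotR w) (P : Measure (ObsData d k l)) :=
    hκi.mono hκAm.aestronglyMeasurable (ae_of_all _ hκAb)
  refine ⟨fun w => q w - κ (feat w) * annotR w, hP.isTiltDirection_annot hπm
    (M := M + η⁻¹ * M) (hqm.sub hκAm) (fun w => (abs_sub _ _).trans
      (add_le_add (hqb w) ((hκAb w).trans (hκM _)))) (fun w => ?_) ?_, ?_⟩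
  · have h1 : annotR w * annotR w = annotR w := by unfold annotR; split_ifs <;> norm_num
    linear_combination hqA w - κ (feat w) * h1
  · filter_upwards [condExp_sub hqi hκAi (MeasurableSpace.comap feat inferInstance), hqe,
      hP.condExp_comp_feat_mul_annotR hκm hκi] with w h1 h2 h3
    refine h1.trans ?_
    have h0 : π (covar w) ≠ 0 := (hη.trans_le (hπ (covar w))).ne'
    rw [Pi.sub_apply, h2, h3]
    simp only [hκ, feat, Pi.zero_apply]
    field_simp
    ring
  · have hrm : AEStronglyMeasurable r (P : Measure (ObsData d k l)) :=
      (hfm.sub hqm).aestronglyMeasurable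
    -- `f` is centred given the features, so `E[q | X̃] = -E[r | X̃]`: the correction is controlled
    -- by the truncation error.
    have hbound : ∀ᵐ w ∂(P : Measure (ObsData d k l)), ‖κ (feat w) * annotR w‖
        ≤ η⁻¹ * ‖((P : Measure (ObsData d k l))[r | MeasurableSpace.comap feat inferInstance]) w‖ := by
      filter_upwards [condExp_sub (hf.integrable one_le_two) hqi
        (MeasurableSpace.comap feat inferInstance), hqe, hf0] with w h1 h2 h3
      have h4 : ((P : Measure (ObsData d k l))[r | MeasurableSpace.comap feat inferInstance]) w
          = - e (feat w) := by
        refine h1.trans ?_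
        rw [Pi.sub_apply, h2, h3, Pi.zero_apply, zero_sub]
      rw [h4, norm_neg]
      exact (hκAb w).trans (hκb _)
    have h5 := eLpNorm_le_mul_eLpNorm_of_ae_le_mul hbound 2
    have e2 : (f - fun w => q w - κ (feat w) * annotR w)
        = r + fun w => κ (feat w) * annotR w := by
      ext w
      simp only [hr, Pi.sub_apply, Pi.add_apply]
      ring
    rw [e2]
    refine (eLpNorm_add_le hrm hκAm.aestronglyMeasurable one_le_two).trans ?_
    refine (add_le_add hM (h5.trans (mul_le_mul_right
      ((eLpNorm_condExp_le_eLpNorm r one_le_two).trans hM) _))).trans_eq ?_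
    rw [← ENNReal.ofReal_mul (by positivity), ← ENNReal.ofReal_add hδ.le (by positivity)]
    congr 1
    field_simp

variable (hcm : Measurable cperp) (hπ1 : ∀ x, π x ≤ 1)

include hP hπm hη hπ hcm hπ1 in
/-- `phiRatio` lies in the closed linear span of the scores of regular submodels. -/
theorem InModel.phiRatio_mem_tangent {ε : ℝ≥0∞} (hε : 0 < ε) :
    ∃ g ∈ Submodule.span ℝ {h : ObsData d k l → ℝ | ∃ Q, IsRegularSubmodel π cperp P Q h},
      eLpNorm (phiRatio π cperp P - g) 2 (P : Measure (ObsData d k l)) < ε := by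
  obtain ⟨δ, hδ0, hδ⟩ := ENNReal.lt_iff_exists_nnreal_btwn.1 hε
  have hδ' : (0 : ℝ) < δ / 2 := by
    have : (0 : ℝ) < δ := by exact_mod_cast hδ0
    linarith
  have hm := (measurable_feat (d := d) (k := k) (l := l)).comap_le
  set D := thetaDen cperp P
  have hcf : Measurable fun x : Feat d k l => cperp x.2.2 := hcm.comp measurable_snd.snd
  -- The influence function splits as `F(X̃) + f`: `F` perturbs the law of the features and `f` that
  -- of the outcome given `A = 1` and the features. No component perturbs the annotation mechanism,
  -- which is known.
  set F : Feat d k l → ℝ := fun x => D⁻¹ * (cperp x.2.2 * regressionFun P x - thetaNum cperp P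
    - thetaRatio cperp P * (cperp x.2.2 ^ 2 - D)) with hF
  set f : ObsData d k l → ℝ := fun w => D⁻¹ * (cperp (regr w) * (annotR w / π (covar w)
    * (outcome w - regressionFun P (feat w)))) with hf
  have hFm : Measurable F := (((hcf.mul (measurable_regressionFun P)).sub_const _).sub
    (((hcf.pow_const 2).sub_const _).const_mul _)).const_mul _
  have hsum : ∀ w, phiRatio π cperp P w = F (feat w) + f w := fun w => by
    simp only [phiRatio, phiNum, phiDen, hF, hf, feat]
    ring
  have hfm : Measurable f := ((hcm.comp measurable_regr).mul
    ((measurable_annotR.div (hπm.comp measurable_covar)).mul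
      (measurable_outcome.sub ((measurable_regressionFun P).comp measurable_feat)))).const_mul _
  have hFL : MemLp (fun w => F (feat w)) 2 (P : Measure (ObsData d k l)) :=
    (((hP.memLp_cperp_mul_regressionFun hπm hη hπ hcm).sub (memLp_const _)).sub
      ((memLp_phiDen hP).const_mul (thetaRatio cperp P))).const_mul D⁻¹
  have hfL : MemLp f 2 (P : Measure (ObsData d k l)) :=
    ((memLp_phiRatio hP hπm hη hπ hcm).sub hFL).ae_eq (ae_of_all _ fun w => by
      rw [Pi.sub_apply, hsum, add_sub_cancel_left])
  have hfA : ∀ w, annotR w * f w = f w := fun w => by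
    have h1 : annotR w * annotR w = annotR w := by unfold annotR; split_ifs <;> norm_num
    simp only [hf]
    linear_combination (D⁻¹ * cperp (regr w) / π (covar w)
      * (outcome w - regressionFun P (feat w))) * h1
  have hf0 : (P : Measure (ObsData d k l))[f | MeasurableSpace.comap feat inferInstance]
      =ᵐ[(P : Measure (ObsData d k l))] 0 := by
    set κ : Feat d k l → ℝ := fun x => cperp x.2.2 * regressionFun P x / π x.1 with hκ
    have hκm : Measurable κ :=
      (hcf.mul (measurable_regressionFun P)).div (hπm.comp measurable_fst)
    have hκi : Integrable (fun w => κ (feat w)) (P : Measure (ObsData d k l)) := by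
      refine (((hP.memLp_cperp_mul_regressionFun hπm hη hπ hcm).integrable one_le_two).norm.div_const
        η).mono' (hκm.comp measurable_feat).aestronglyMeasurable (ae_of_all _ fun w => ?_)
      have h0 := hη.trans_le (hπ (feat w).1)
      simp only [hκ]
      rw [norm_div, Real.norm_of_nonneg h0.le]
      exact div_le_div_of_nonneg_left (norm_nonneg _) hη (hπ _)
    have hκAi : Integrable (fun w => κ (feat w) * annotR w) (P : Measure (ObsData d k l)) :=
      hκi.mul_bdd (c := 1) measurable_annotR.aestronglyMeasurable (ae_of_all _ fun w => by
        rw [Real.norm_of_nonneg (annotR_nonneg w)]; exact annotR_le_one w)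
    have hwi := (memLp_weighted_outcome hπm hη hπ hcm hP).integrable one_le_two
    -- Both `C^⊥ M / π` and `κ A` have conditional expectation `C^⊥ μ` given the features, so `f` is
    -- conditionally centred.
    have hfe : f =ᵐ[(P : Measure (ObsData d k l))] D⁻¹ •
        ((fun w => cperp (regr w) * outcome w / π (covar w))
          - fun w => κ (feat w) * annotR w) := by
      filter_upwards [hP.annotR_mul_outcome] with w hw
      simp only [hf, hκ, Pi.smul_apply, Pi.sub_apply, smul_eq_mul, feat]
      linear_combination D⁻¹ * cperp (regr w) / π (covar w) * hw
    filter_upwards [condExp_congr_ae (m := MeasurableSpace.comap feat inferInstance) hfe,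
      condExp_smul D⁻¹ ((fun w => cperp (regr w) * outcome w / π (covar w))
          - fun w => κ (feat w) * annotR w) (MeasurableSpace.comap feat inferInstance),
      condExp_sub hwi hκAi (MeasurableSpace.comap feat inferInstance),
      hP.cperp_mul_regressionFun_ae_eq hπm hη hπ hcm,
      hP.condExp_comp_feat_mul_annotR hκm hκi] with w h1 h2 h3 h4 h5
    have h0 : π (covar w) ≠ 0 := (hη.trans_le (hπ (covar w))).ne'
    rw [h1, h2, Pi.smul_apply, h3, Pi.sub_apply, h4, h5]
    simp only [hκ, feat, Pi.zero_apply, smul_eq_mul]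
    field_simp
    ring
  have hF0 : ∫ w, F (feat w) ∂(P : Measure (ObsData d k l)) = 0 := by
    have h1 : ∫ w, f w ∂(P : Measure (ObsData d k l)) = 0 := by
      rw [← integral_condExp hm, integral_congr_ae hf0]
      simp
    have h2 := integral_phiRatio hP hπm hη hπ hcm
    simp_rw [hsum] at h2
    rwa [integral_add (hFL.integrable one_le_two) (hfL.integrable one_le_two), h1, add_zero] at h2
  obtain ⟨g₁, hg₁, hd₁⟩ := hP.exists_isTiltDirection_comp_feat hπm hFm hFL hF0 hδ'
  obtain ⟨g₂, hg₂, hd₂⟩ := hP.exists_isTiltDirection_annot hπm hη hπ hfm hfL hfA hf0 hδ'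
  have hmem : ∀ {g}, IsTiltDirection π P g → g ∈ Submodule.span ℝ
      {h : ObsData d k l → ℝ | ∃ Q, IsRegularSubmodel π cperp P Q h} := fun hg =>
    Submodule.subset_span (hg.exists_isRegularSubmodel hP hπm (fun x => hη.le.trans (hπ x)) hπ1)
  refine ⟨g₁ + g₂, Submodule.add_mem _ (hmem hg₁) (hmem hg₂), lt_of_le_of_lt ?_ hδ⟩
  have e : phiRatio π cperp P - (g₁ + g₂) = ((fun w => F (feat w)) - g₁) + (f - g₂) := by
    ext w
    simp only [Pi.sub_apply, Pi.add_apply, hsum]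
    ring
  rw [e]
  refine (eLpNorm_add_le ((hFm.comp measurable_feat).sub hg₁.measurable).aestronglyMeasurable
    (hfm.sub hg₂.measurable).aestronglyMeasurable one_le_two).trans ?_
  refine (add_le_add hd₁ hd₂).trans_eq ?_
  rw [← ENNReal.ofReal_add hδ'.le hδ'.le, add_halves, ENNReal.ofReal_coe_nnreal]

end Score

end TangentSpace

/-! ## Identification from the law of a complete unit -/

section Identification

variable {d k l : ℕ} {Pfull : ProbabilityMeasure (FullData d k l)} {π : (Fin k → ℝ) → ℝ} {η : ℝ}

/-- Conditional independence says that the conditional law of `A` given `(f, g)` is the one given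
`f`; evaluate it at `{true}`. -/
lemma condExp_annotR_prodMk_of_condIndepFun {β γ : Type*} [MeasurableSpace β]
    [StandardBorelSpace β] [Nonempty β] [MeasurableSpace γ] {g : FullData d k l → β}
    {f : FullData d k l → γ} (hg : Measurable g) (hf : Measurable f)
    (h : CondIndepFun (MeasurableSpace.comap f inferInstance) hf.comap_le g annot
      (Pfull : Measure (FullData d k l))) :
    (Pfull : Measure (FullData d k l))[annotR |
        MeasurableSpace.comap (fun z => (f z, g z)) inferInstance]
      =ᵐ[(Pfull : Measure (FullData d k l))]
    (Pfull : Measure (FullData d k l))[annotR | MeasurableSpace.comap f inferInstance] := by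
  have hd := (condIndepFun_iff_condDistrib_prod_ae_eq_prodMkRight measurable_annot hg hf).1 h
  have hA : (annotR : FullData d k l → ℝ) = (annot ⁻¹' {true}).indicator fun _ => 1 := by
    ext z; exact annotR_eq_indicator z
  rw [hA]
  filter_upwards [condDistrib_ae_eq_condExp (μ := (Pfull : Measure (FullData d k l)))
      (hf.prodMk hg) measurable_annot (measurableSet_singleton true),
    condDistrib_ae_eq_condExp (μ := (Pfull : Measure (FullData d k l))) hf measurable_annot
      (measurableSet_singleton true),
    ae_of_ae_map (hf.prodMk hg).aemeasurable hd] with z h1 h2 h3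
  rw [← h1, ← h2]
  simp only [Measure.real, h3, Kernel.prodMkRight_apply]

/-- Under the missing-at-random assumption, the annotation score given the covariates, the features
and the outcome depends on the covariates only. -/
lemma MissingAtRandom.condExp_annotR (hMAR : MissingAtRandom Pfull)
    (hπ : IsAnnotationScore Pfull π η) :
    (Pfull : Measure (FullData d k l))[annotR | MeasurableSpace.comap
        (fun z : FullData d k l => ((covar z, unstr z, outcome z), regr z)) inferInstance]
      =ᵐ[(Pfull : Measure (FullData d k l))] fun z => π (covar z) :=
  -- First `C` is dropped from the conditioning, then `(U, M*)`, leaving `X` alone.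
  ((condExp_annotR_prodMk_of_condIndepFun measurable_regr
    (measurable_covar.prodMk (measurable_unstr.prodMk measurable_outcome)) hMAR.regr_indep).trans
  (condExp_annotR_prodMk_of_condIndepFun (measurable_unstr.prodMk measurable_outcome)
    measurable_covar hMAR.outcome_indep)).trans hπ.eq_condProb

lemma MissingAtRandom.integral_mul_annotR (hMAR : MissingAtRandom Pfull)
    (hπ : IsAnnotationScore Pfull π η) {F : FullData d k l → ℝ}
    (hFm : StronglyMeasurable[MeasurableSpace.comap
      (fun z : FullData d k l => ((covar z, unstr z, outcome z), regr z)) inferInstance] F)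
    (hF : Integrable F (Pfull : Measure (FullData d k l))) :
    ∫ z, F z * annotR z ∂(Pfull : Measure (FullData d k l))
      = ∫ z, F z * π (covar z) ∂(Pfull : Measure (FullData d k l)) := by
  have hm := ((measurable_covar.prodMk (measurable_unstr.prodMk measurable_outcome)).prodMk
    (measurable_regr (d := d) (k := k) (l := l))).comap_le
  have hFa : Integrable (F * annotR) (Pfull : Measure (FullData d k l)) :=
    hF.mul_bdd (c := 1) measurable_annotR.aestronglyMeasurable (ae_of_all _ fun w => by
      rw [Real.norm_of_nonneg (annotR_nonneg w)]; exact annotR_le_one w)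
  change ∫ z, (F * annotR : FullData d k l → ℝ) z ∂(Pfull : Measure (FullData d k l)) = _
  rw [← integral_condExp hm]
  refine integral_congr_ae ?_
  filter_upwards [condExp_mul_of_stronglyMeasurable_left hFm hFa (integrable_annotR Pfull),
    hMAR.condExp_annotR hπ] with z h1 h2
  rw [h1, Pi.mul_apply, h2]

lemma integral_obsLaw {f : ObsData d k l → ℝ} (hf : Measurable f) :
    ∫ w, f w ∂(obsLaw Pfull : Measure (ObsData d k l))
      = ∫ z, f (observe z) ∂(Pfull : Measure (FullData d k l)) :=
  integral_map measurable_observe.aemeasurable hf.aestronglyMeasurable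

lemma memLp_obsLaw {f : ObsData d k l → ℝ} (hf : Measurable f) {p : ℝ≥0∞} :
    MemLp f p (obsLaw Pfull : Measure (ObsData d k l))
      ↔ MemLp (fun z => f (observe z)) p (Pfull : Measure (FullData d k l)) :=
  memLp_map_measure_iff hf.aestronglyMeasurable measurable_observe.aemeasurable

/-- The law of the observed unit belongs to the model. -/
theorem MissingAtRandom.inModel_obsLaw (hMAR : MissingAtRandom Pfull)
    (hπ : IsAnnotationScore Pfull π η) {cperp : (Fin d → ℝ) → ℝ} (hcm : Measurable cperp)
    (hM : Integrable outcome (Pfull : Measure (FullData d k l)))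
    (hbdd : ∃ B : ℝ, ∀ᵐ z ∂(Pfull : Measure (FullData d k l)), |cperp (regr z)| ≤ B)
    (hden : 0 < ∫ z, cperp (regr z) ^ 2 ∂(Pfull : Measure (FullData d k l)))
    (hmom : MemLp (fun z => cperp (regr z) * outcome z) 2
      (Pfull : Measure (FullData d k l))) : InModel π cperp (obsLaw Pfull) := by
  have hA1 : ∀ z : FullData d k l, ‖annotR z‖ ≤ 1 := fun z => by
    rw [Real.norm_of_nonneg (annotR_nonneg z)]; exact annotR_le_one z
  have hcr : Measurable fun w : ObsData d k l => cperp (regr w) := hcm.comp measurable_regr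
  have hco : Measurable fun w : ObsData d k l => cperp (regr w) * outcome w :=
    hcr.mul measurable_outcome
  have hm := (measurable_feat (d := d) (k := k) (l := l)).comap_le
  have hπm : Measurable fun w : ObsData d k l => π (covar w) := hπ.measurable.comp measurable_covar
  have hπi : Integrable (fun w => π (covar w)) (obsLaw Pfull : Measure (ObsData d k l)) :=
    (integrable_const (1 : ℝ)).mono' hπm.aestronglyMeasurable (ae_of_all _ fun w => by
      rw [Real.norm_of_nonneg (hπ.pos.le.trans (hπ.mem_Icc _).1)]
      exact (hπ.mem_Icc _).2)
  refine ⟨?_, ?_, ?_, ?_, ?_, ?_⟩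
  · have hS : MeasurableSet {w : ObsData d k l | annot w = false → outcome w = 0} := by
      have : {w : ObsData d k l | annot w = false → outcome w = 0}
          = (annot ⁻¹' {false})ᶜ ∪ outcome ⁻¹' {0} := by
        ext w
        simp [imp_iff_not_or]
      rw [this]
      exact (measurable_annot (measurableSet_singleton _)).compl.union
        (measurable_outcome (measurableSet_singleton _))
    refine (ae_map_iff measurable_observe.aemeasurable hS).2 (ae_of_all _ fun z hz => ?_)
    have hz' : annot z = false := hz
    simp [observe, outcome, annotR, hz']
  · refine (ae_eq_condExp_of_forall_setIntegral_eq hm (integrable_annotR _)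
      (fun _ _ _ => hπi.integrableOn) ?_
      (stronglyMeasurable_comp_feat (hπ.measurable.comp measurable_fst)).aestronglyMeasurable).symm
    rintro _ ⟨S, hS, rfl⟩ -
    have hSm := measurable_feat (d := d) (k := k) (l := l) hS
    rw [← integral_indicator hSm, ← integral_indicator hSm,
      integral_obsLaw (hπm.indicator hSm), integral_obsLaw (measurable_annotR.indicator hSm)]
    -- `A` and `X̃` are unchanged by `observe`, so the identity can be checked on the complete unit,
    -- where events of `X̃` are also events of the larger vector `(X, U, M*, C)`.
    have h := hMAR.integral_mul_annotR hπ (F := (feat ⁻¹' S).indicator fun _ => 1)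
      (stronglyMeasurable_const.indicator ?_) ((integrable_const 1).indicator hSm)
    · have e : ∀ a : FullData d k l → ℝ, ∀ z, (feat ⁻¹' S).indicator a z
          = (feat ⁻¹' S).indicator (fun _ => (1 : ℝ)) z * a z := fun a z => by
        by_cases hz : z ∈ feat ⁻¹' S
        · rw [Set.indicator_of_mem hz, Set.indicator_of_mem hz, one_mul]
        · rw [Set.indicator_of_notMem hz, Set.indicator_of_notMem hz, zero_mul]
      simp_rw [← e annotR, ← e fun w => π (covar w)] at h
      have e' : ∀ a : ObsData d k l → ℝ, (∀ z, a (observe z) = a z) → ∀ z : FullData d k l,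
          (feat ⁻¹' S).indicator a (observe z) = (feat ⁻¹' S).indicator a z := fun a ha z => by
        by_cases hz : feat z ∈ S
        · rw [Set.indicator_of_mem (s := feat ⁻¹' S) (a := z) hz,
            Set.indicator_of_mem (s := feat ⁻¹' S) (a := observe z) hz, ha]
        · rw [Set.indicator_of_notMem (s := feat ⁻¹' S) (a := z) hz,
            Set.indicator_of_notMem (s := feat ⁻¹' S) (a := observe z) hz]
      simp_rw [e' annotR fun _ => rfl, e' (fun w => π (covar w)) fun _ => rfl]
      exact h.symm
    · have hp : Measurable fun p : ((Fin k → ℝ) × (Fin l → ℝ) × ℝ) × (Fin d → ℝ) =>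
          (p.1.1, p.1.2.1, p.2) := by fun_prop
      exact ⟨_, hp hS, rfl⟩
  · rw [← memLp_one_iff_integrable, memLp_obsLaw measurable_outcome, memLp_one_iff_integrable]
    exact (hM.mul_bdd (c := 1) measurable_annotR.aestronglyMeasurable (ae_of_all _ hA1)).congr
      (ae_of_all _ fun z => mul_comm _ _)
  · rw [memLp_obsLaw hco]
    refine hmom.mono (hco.comp measurable_observe).aestronglyMeasurable
      (ae_of_all _ fun z => ?_)
    change ‖cperp (regr z) * (annotR z * outcome z)‖ ≤ _
    rw [mul_left_comm, norm_mul]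
    exact mul_le_of_le_one_left (norm_nonneg _) (hA1 z)
  · rw [memLp_obsLaw (hcr.pow_const 2)]
    obtain ⟨B, hB⟩ := hbdd
    refine MemLp.of_bound (C := B ^ 2)
      ((hcr.pow_const 2).comp measurable_observe).aestronglyMeasurable (hB.mono fun z hz => ?_)
    change ‖cperp (regr z) ^ 2‖ ≤ _
    rw [norm_pow]
    exact pow_le_pow_left₀ (norm_nonneg _) hz 2
  · rw [thetaDen, integral_obsLaw (hcr.pow_const 2)]
    exact hden

/-- The target functional at the law of the observed unit, in terms of the complete unit. -/
theorem MissingAtRandom.thetaRatio_obsLaw (hMAR : MissingAtRandom Pfull)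
    (hπ : IsAnnotationScore Pfull π η) {cperp : (Fin d → ℝ) → ℝ} (hcm : Measurable cperp)
    (hP : InModel π cperp (obsLaw Pfull))
    (hmom : MemLp (fun z => cperp (regr z) * outcome z) 2
      (Pfull : Measure (FullData d k l))) :
    thetaRatio cperp (obsLaw Pfull)
      = (∫ z, cperp (regr z) ^ 2 ∂(Pfull : Measure (FullData d k l)))⁻¹
        * ∫ z, cperp (regr z) * outcome z ∂(Pfull : Measure (FullData d k l)) := by
  have hcr : Measurable fun w : ObsData d k l => cperp (regr w) := hcm.comp measurable_regr
  have hπm : Measurable fun w : ObsData d k l => π (covar w) := hπ.measurable.comp measurable_covar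
  have hπ0 : ∀ x, 0 < π x := fun x => hπ.pos.trans_le (hπ.mem_Icc x).1
  have hcw : Measurable fun w : ObsData d k l => cperp (regr w) * outcome w / π (covar w) :=
    (hcr.mul measurable_outcome).div hπm
  rw [thetaRatio, thetaDen, integral_obsLaw (hcr.pow_const 2),
    hP.thetaNum_eq hπ.measurable hπ.pos (fun x => (hπ.mem_Icc x).1) hcm,
    integral_obsLaw hcw]
  congr 1
  have hp : Measurable fun p : ((Fin k → ℝ) × (Fin l → ℝ) × ℝ) × (Fin d → ℝ) =>
      cperp p.2 * p.1.2.2 / π p.1.1 :=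
    ((hcm.comp measurable_snd).mul measurable_fst.snd.snd).div
      (hπ.measurable.comp measurable_fst.fst)
  have hFi : Integrable (fun z => cperp (regr z) * outcome z / π (covar z))
      (Pfull : Measure (FullData d k l)) := by
    refine ((hmom.integrable one_le_two).norm.div_const η).mono'
      hcw.aestronglyMeasurable (ae_of_all _ fun z => ?_)
    rw [norm_div, Real.norm_of_nonneg (hπ0 _).le]
    exact div_le_div_of_nonneg_left (norm_nonneg _) hπ.pos (hπ.mem_Icc _).1
  -- With the weight `1 / π(X)` inside `F`, the factor `π(X)` produced by averaging `A` cancels,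
  -- leaving `E[C^⊥ M*]`.
  have h := hMAR.integral_mul_annotR hπ
    (F := fun z => cperp (regr z) * outcome z / π (covar z))
    (hp.comp (comap_measurable _)).stronglyMeasurable hFi
  simp only [div_mul_cancel₀ _ (hπ0 _).ne'] at h
  rw [← h]
  refine integral_congr_ae (ae_of_all _ fun z => ?_)
  change cperp (regr z) * (annotR z * outcome z) / π (covar z) = _
  simp only
  ring

lemma measurable_resid (j : Fin d) (b₀ : ℝ) (b : Fin d → ℝ) : Measurable (resid j b₀ b) := by
  unfold resid
  fun_prop

/-- The normal equations identify the coefficient of the linear model. -/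
theorem LinearModel.coefficient_eq {θ : Fin d → ℝ} (hlin : LinearModel Pfull θ) {j : Fin d}
    {b₀ : ℝ} {b : Fin d → ℝ} (hproj : IsLinearProjection Pfull j b₀ b)
    (hbdd : ∃ B : ℝ, ∀ᵐ z ∂(Pfull : Measure (FullData d k l)), |resid j b₀ b (regr z)| ≤ B)
    (hden : 0 < ∫ z, resid j b₀ b (regr z) ^ 2 ∂(Pfull : Measure (FullData d k l))) :
    θ j = (∫ z, resid j b₀ b (regr z) ^ 2 ∂(Pfull : Measure (FullData d k l)))⁻¹
        * ∫ z, resid j b₀ b (regr z) * outcome z ∂(Pfull : Measure (FullData d k l)) := by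
  set c := resid j b₀ b with hc
  have hcm : Measurable c := measurable_resid j b₀ b
  have hcr : Measurable fun z : FullData d k l => c (regr z) := hcm.comp measurable_regr
  obtain ⟨B, hB⟩ := hbdd
  have hmul : ∀ {f : FullData d k l → ℝ}, Integrable f (Pfull : Measure (FullData d k l)) →
      Integrable (fun z => c (regr z) * f z) (Pfull : Measure (FullData d k l)) := fun hf =>
    hf.bdd_mul (c := B) hcr.aestronglyMeasurable hB
  have hri : ∀ r, Integrable (fun z => regr z r) (Pfull : Measure (FullData d k l)) := fun r =>
    (hlin.memLp r).integrable one_le_two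
  have hsumi : Integrable (fun z => ∑ r, regr z r * θ r) (Pfull : Measure (FullData d k l)) :=
    integrable_finsetSum _ fun r _ => (hri r).mul_const _
  have hεi : Integrable (fun z => outcome z - ∑ r, regr z r * θ r)
    (Pfull : Measure (FullData d k l)) := hlin.integrable.sub hsumi
  have hm := (measurable_regr (d := d) (k := k) (l := l)).comap_le
  -- `C^⊥` is a bounded function of `C`, hence orthogonal to an error with `E[ε | C] = 0`.
  have hε : ∫ z, c (regr z) * (outcome z - ∑ r, regr z r * θ r)
      ∂(Pfull : Measure (FullData d k l)) = 0 := by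
    rw [← integral_condExp hm]
    refine (integral_congr_ae ?_).trans (integral_zero' _ _)
    have hcs : StronglyMeasurable[MeasurableSpace.comap regr inferInstance]
        fun z : FullData d k l => c (regr z) := (hcm.comp (comap_measurable _)).stronglyMeasurable
    filter_upwards [condExp_mul_of_stronglyMeasurable_left hcs (hmul hεi) hεi,
      hlin.condExp_error] with z h1 h2
    refine h1.trans ?_
    rw [Pi.mul_apply, h2, Pi.zero_apply, mul_zero]
  -- `C_j - C^⊥` lies in the span of `1` and the other regressors, to which `C^⊥` is orthogonal.
  have hj : ∫ z, c (regr z) * regr z j ∂(Pfull : Measure (FullData d k l))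
      = ∫ z, c (regr z) ^ 2 ∂(Pfull : Measure (FullData d k l)) := by
    have hci : Integrable (fun z => c (regr z)) (Pfull : Measure (FullData d k l)) := by
      simpa using hmul (integrable_const (1 : ℝ))
    have e : ∀ z : FullData d k l, c (regr z) * regr z j = c (regr z) ^ 2
        + (c (regr z) * b₀ + ∑ r ∈ Finset.univ.erase j, b r * (c (regr z) * regr z r)) := by
      intro z
      have h1 : regr z j = c (regr z) + (b₀ + ∑ r ∈ Finset.univ.erase j, b r * regr z r) := by
        simp only [hc, resid]; ring
      have h2 : ∑ r ∈ Finset.univ.erase j, b r * (c (regr z) * regr z r)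
          = c (regr z) * ∑ r ∈ Finset.univ.erase j, b r * regr z r := by
        rw [Finset.mul_sum]
        exact Finset.sum_congr rfl fun r _ => by ring
      rw [h2, h1]
      ring
    have hi2 : Integrable (fun z => c (regr z) ^ 2) (Pfull : Measure (FullData d k l)) :=
      (hmul hci).congr (ae_of_all _ fun z => (sq _).symm)
    have hi3 : Integrable (fun z => ∑ r ∈ Finset.univ.erase j, b r * (c (regr z) * regr z r))
        (Pfull : Measure (FullData d k l)) :=
      integrable_finsetSum _ fun r _ => (hmul (hri r)).const_mul _
    have hi4 : Integrable (fun z => c (regr z) * b₀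
        + ∑ r ∈ Finset.univ.erase j, b r * (c (regr z) * regr z r))
        (Pfull : Measure (FullData d k l)) := (hci.mul_const _).add hi3
    simp_rw [e]
    rw [integral_add hi2 hi4, integral_add (hci.mul_const _) hi3, integral_mul_const,
      hproj.orthogonal_const, integral_finsetSum _ fun r _ => (hmul (hri r)).const_mul _,
      Finset.sum_eq_zero fun r hr => ?_]
    · ring
    · rw [integral_const_mul, hproj.orthogonal r (Finset.ne_of_mem_erase hr), mul_zero]
  have hsum : ∫ z, c (regr z) * ∑ r, regr z r * θ r ∂(Pfull : Measure (FullData d k l))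
      = θ j * ∫ z, c (regr z) ^ 2 ∂(Pfull : Measure (FullData d k l)) := by
    simp_rw [Finset.mul_sum]
    rw [integral_finsetSum _ fun r _ => hmul ((hri r).mul_const _)]
    simp_rw [← mul_assoc, integral_mul_const]
    rw [Finset.sum_eq_single j (fun r _ hr => by rw [hproj.orthogonal r hr, zero_mul])
      (fun h => absurd (Finset.mem_univ j) h), hj, mul_comm]
  have htot : ∫ z, c (regr z) * outcome z ∂(Pfull : Measure (FullData d k l))
      = θ j * ∫ z, c (regr z) ^ 2 ∂(Pfull : Measure (FullData d k l)) := by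
    simp_rw [mul_sub] at hε
    rw [integral_sub (hmul hlin.integrable) (hmul hsumi), hsum] at hε
    linarith
  rw [htot]
  field_simp

end Identification

/-! ## Asymptotic linearity of the residualized regression -/

section ScaledSum

variable {𝒲 : Type*} [MeasurableSpace 𝒲] {P : ProbabilityMeasure 𝒲}

/-- The normalized sum `n^{-1/2} ∑ f(W_i)`. -/
def scaledSum (f : 𝒲 → ℝ) {n : ℕ} (s : Fin n → 𝒲) : ℝ := (√(n : ℝ))⁻¹ * ∑ i, f (s i)

lemma Measurable.scaledSum {f : 𝒲 → ℝ} (hf : Measurable f) (n : ℕ) :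
    Measurable fun s : Fin n → 𝒲 => scaledSum f s := by
  unfold _root_.scaledSum
  exact (Finset.measurable_sum _ fun i _ => hf.comp (measurable_pi_apply i)).const_mul _

/-- Chebyshev's inequality for normalized sums of centred summands. -/
lemma iidLaw_lt_abs_scaledSum_le {f : 𝒲 → ℝ} (hf : MemLp f 2 (P : Measure 𝒲))
    (hf0 : ∫ w, f w ∂(P : Measure 𝒲) = 0) {K : ℝ} (hK : 0 < K) (n : ℕ) :
    iidLaw P n {s | K < |scaledSum f s|}
      ≤ ENNReal.ofReal ((∫ w, f w ^ 2 ∂(P : Measure 𝒲)) / K ^ 2) := by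
  have hi : ∀ i : Fin n, MemLp (fun s : Fin n → 𝒲 => f (s i)) 2 (iidLaw P n) := fun i =>
    hf.comp_measurePreserving (measurePreserving_eval (fun _ : Fin n => (P : Measure 𝒲)) i)
  have hsum : MemLp (∑ i, fun s : Fin n → 𝒲 => f (s i)) 2 (iidLaw P n) :=
    memLp_finsetSum' _ fun i _ => hi i
  have e : (fun s : Fin n → 𝒲 => scaledSum f s)
      = fun s => (√(n : ℝ))⁻¹ * (∑ i, fun s : Fin n → 𝒲 => f (s i)) s := by
    ext s; simp [scaledSum]
  have hL : MemLp (fun s : Fin n → 𝒲 => scaledSum f s) 2 (iidLaw P n) := e ▸ hsum.const_mul _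
  have hmean : ∫ s, scaledSum f s ∂(iidLaw P n) = 0 := by
    simp only [scaledSum]
    rw [integral_const_mul, integral_finsetSum _ fun i _ => (hi i).integrable one_le_two]
    simp_rw [integral_comp_eval (μ := fun _ : Fin n => (P : Measure 𝒲)) hf.aestronglyMeasurable, hf0]
    simp
  have hvar : Var[fun s : Fin n → 𝒲 => scaledSum f s; iidLaw P n]
      ≤ ∫ w, f w ^ 2 ∂(P : Measure 𝒲) := by
    have hv := variance_sum_pi (μ := fun _ : Fin n => (P : Measure 𝒲)) (X := fun _ => f)
      fun _ => hf
    rw [e, variance_const_mul, hv, variance_of_integral_eq_zero hf.aemeasurable hf0,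
      Finset.sum_const, Finset.card_univ, Fintype.card_fin, nsmul_eq_mul, inv_pow,
      Real.sq_sqrt (Nat.cast_nonneg n), ← mul_assoc]
    -- An inequality, not an equality: for `n = 0` the factor `n⁻¹ n` is `0`.
    exact mul_le_of_le_one_left (integral_nonneg fun w => sq_nonneg _) (inv_mul_le_one)
  have h := meas_ge_le_variance_div_sq hL hK
  rw [hmean] at h
  refine (measure_mono fun s hs => ?_).trans (h.trans (ENNReal.ofReal_le_ofReal
    (div_le_div_of_nonneg_right hvar (sq_nonneg K))))
  simpa using le_of_lt hs

end ScaledSum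

/-! ### Linearization of the ratio and control of the imputation error -/

section Linearity

variable {d k l : ℕ} {π : (Fin k → ℝ) → ℝ} {cperp : (Fin d → ℝ) → ℝ}
  {P : ProbabilityMeasure (ObsData d k l)} {η : ℝ}

/-- The change in a summand of the numerator caused by the estimation error of the imputation
function `f`. -/
def imputationError (π : (Fin k → ℝ) → ℝ) (cperp : (Fin d → ℝ) → ℝ)
    (P : ProbabilityMeasure (ObsData d k l)) (f : Feat d k l → ℝ) (w : ObsData d k l) : ℝ :=
  cperp (regr w) * (f (feat w) - regressionFun P (feat w)) * (1 - annotR w / π (covar w))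

/-- Deterministic bound for the error of the linearization of the ratio. -/
lemma abs_linearization_le (hD : 0 < thetaDen cperp P)
    {muHat : (m : ℕ) → (Fin m → ObsData d k l) → Feat d k l → ℝ} {n m : ℕ} (hn : 0 < n)
    {s : (Fin n → ObsData d k l) × (Fin m → ObsData d k l)} {K a : ℝ}
    (hKn : K ≤ √(n : ℝ) * (thetaDen cperp P / 2)) (hKa : K ^ 2 ≤ √(n : ℝ) * a)
    (h1 : |scaledSum (phiRatio π cperp P) s.1| ≤ K) (h2 : |scaledSum (phiDen cperp P) s.1| ≤ K)
    (h3 : |scaledSum (imputationError π cperp P (muHat m s.2)) s.1| ≤ a) :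
    |√(n : ℝ) * (thetaHat π cperp muHat n m s - thetaRatio cperp P)
      - scaledSum (phiRatio π cperp P) s.1| ≤ 4 * a / thetaDen cperp P := by
  set q := √(n : ℝ) with hq
  have hq0 : 0 < q := Real.sqrt_pos.2 (Nat.cast_pos.2 hn)
  have hqq : q ^ 2 = n := Real.sq_sqrt (Nat.cast_nonneg n)
  set D := thetaDen cperp P
  set ψ := thetaRatio cperp P with hψ
  set Z := scaledSum (phiRatio π cperp P) s.1 with hZ
  set Y := scaledSum (phiDen cperp P) s.1 with hY
  set r := scaledSum (imputationError π cperp P (muHat m s.2)) s.1 with hr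
  have hunscale : ∀ f : ObsData d k l → ℝ, ∑ i, f (s.1 i) = q * scaledSum f s.1 := fun f => by
    rw [scaledSum, ← hq, mul_inv_cancel_left₀ hq0.ne']
  have hden : ∑ i, cperp (regr (s.1 i)) ^ 2 = q * (q * D + Y) := by
    have h := hunscale (phiDen cperp P)
    simp only [phiDen, Finset.sum_sub_distrib, Finset.sum_const, Finset.card_univ,
      Fintype.card_fin, nsmul_eq_mul] at h
    rw [← hqq] at h
    linear_combination h
  have hnum : ∑ i, cperp (regr (s.1 i)) * pseudoOutcome π (muHat m s.2) (s.1 i)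
      = ψ * (q * (q * D + Y)) + q * (D * Z + r) := by
    -- An exact identity per summand: the first term sums to `ψ` times the denominator, the second
    -- is the linear part, and the third isolates all dependence on the estimated imputation
    -- function.
    have hsplit : ∀ w, cperp (regr w) * pseudoOutcome π (muHat m s.2) w
        = ψ * cperp (regr w) ^ 2 + D * phiRatio π cperp P w
          + imputationError π cperp P (muHat m s.2) w := fun w => by
      have hNψ : thetaNum cperp P = D * ψ := by
        rw [hψ, thetaRatio, mul_inv_cancel_left₀ hD.ne']
      have h4 : D * phiRatio π cperp P w = phiNum π cperp P w - ψ * phiDen cperp P w := by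
        rw [phiRatio, mul_inv_cancel_left₀ hD.ne']
      rw [h4, phiNum, phiDen, hNψ, imputationError, pseudoOutcome]
      ring
    simp_rw [hsplit]
    rw [Finset.sum_add_distrib, Finset.sum_add_distrib, ← Finset.mul_sum, ← Finset.mul_sum, hden,
      hunscale, hunscale]
    ring
  have hpos : q * (D / 2) ≤ q * D + Y := by linarith [(abs_le.1 h2).1]
  have hpos0 : 0 < q * (D / 2) := by positivity
  have hS0 : 0 < q * D + Y := hpos0.trans_le hpos
  -- The exact linearization error. With `Y` and `Z` bounded and the denominator of order `√n`, the
  -- cross term `Y Z` disappears and only the imputation error `r` can persist.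
  have e : q * (thetaHat π cperp muHat n m s - ψ) - Z = (q * r - Y * Z) / (q * D + Y) := by
    rw [thetaHat, hnum, hden]
    field_simp
    ring
  have hYZ : |Y * Z| ≤ K ^ 2 := by
    rw [abs_mul, sq]
    exact mul_le_mul h2 h1 (abs_nonneg _) ((abs_nonneg _).trans h2)
  have hnumle : |q * r - Y * Z| ≤ 2 * (q * a) := by
    refine (abs_sub _ _).trans ?_
    rw [abs_mul, abs_of_pos hq0]
    linarith [mul_le_mul_of_nonneg_left h3 hq0.le]
  rw [e, abs_div, abs_of_pos hS0]
  -- Numerator at most `q a + K² ≤ 2 q a`, denominator at least `q D / 2`.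
  calc |q * r - Y * Z| / (q * D + Y) ≤ 2 * (q * a) / (q * (D / 2)) :=
        div_le_div₀ ((abs_nonneg _).trans hnumle) hnumle hpos0 hpos
    _ = 4 * a / D := by field_simp; ring

variable (hP : InModel π cperp P) (hπm : Measurable π) (hη : 0 < η) (hπ : ∀ x, η ≤ π x)
  (hcm : Measurable cperp)

include hcm hπm in
lemma measurable_imputationError_prod {m : ℕ} {muHat : (Fin m → ObsData d k l) → Feat d k l → ℝ}
    (hmeas : Measurable (Function.uncurry muHat)) :
    Measurable fun p : ObsData d k l × (Fin m → ObsData d k l) =>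
      imputationError π cperp P (muHat p.2) p.1 := by
  have h1 : Measurable fun p : ObsData d k l × (Fin m → ObsData d k l) => muHat p.2 (feat p.1) :=
    hmeas.comp (measurable_snd.prodMk (measurable_feat.comp measurable_fst))
  exact (((hcm.comp measurable_regr).comp measurable_fst).mul
    (h1.sub (((measurable_regressionFun P).comp measurable_feat).comp measurable_fst))).mul
    (((measurable_annotR.div (hπm.comp measurable_covar)).const_sub 1).comp measurable_fst)

include hP hπm hη hπ hcm in
/-- The normalized sum of the imputation errors is bounded in probability by the mean squared error
of the imputation function. -/
lemma InModel.iidLaw_lt_abs_scaledSum_imputationError_le {B : ℝ} (hB0 : 0 < B)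
    (hB : ∀ᵐ w ∂(P : Measure (ObsData d k l)), |cperp (regr w)| ≤ B) {f : Feat d k l → ℝ}
    (hf : Measurable f) {a : ℝ} (ha : 0 < a) (n : ℕ) :
    iidLaw P n {s | a < |scaledSum (imputationError π cperp P f) s|}
      ≤ ENNReal.ofReal ((B * (1 + η⁻¹)) ^ 2 / a ^ 2)
        * ∫⁻ x, ENNReal.ofReal ((f x - regressionFun P x) ^ 2)
          ∂((P : Measure (ObsData d k l)).map feat) := by
  set G : Feat d k l → ℝ := fun x => f x - regressionFun P x with hG
  have hGm : Measurable G := hf.sub (measurable_regressionFun P)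
  have hC : 0 < B * (1 + η⁻¹) := by positivity
  rw [lintegral_map (hGm.pow_const 2).ennreal_ofReal measurable_feat]
  -- For an imputation function of infinite mean squared error the bound is `∞`; otherwise the
  -- summands are square-integrable.
  by_cases htop : ∫⁻ w, ENNReal.ofReal (G (feat w) ^ 2) ∂(P : Measure (ObsData d k l)) = ∞
  · rw [htop, ENNReal.mul_top (ENNReal.ofReal_pos.2 (by positivity)).ne']
    exact le_top
  have hGi : Integrable (fun w => G (feat w) ^ 2) (P : Measure (ObsData d k l)) := by
    refine ⟨((hGm.comp measurable_feat).pow_const 2).aestronglyMeasurable, ?_⟩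
    rw [hasFiniteIntegral_iff_ofReal (ae_of_all _ fun w => sq_nonneg _)]
    exact lt_top_iff_ne_top.2 htop
  have hGL : MemLp (fun w => G (feat w)) 2 (P : Measure (ObsData d k l)) :=
    (memLp_two_iff_integrable_sq (hGm.comp measurable_feat).aestronglyMeasurable).2 hGi
  have hfeq : imputationError π cperp P f
      = fun w => cperp (regr w) * G (feat w) * (1 - annotR w / π (covar w)) := rfl
  have hbound : ∀ᵐ w ∂(P : Measure (ObsData d k l)),
      ‖imputationError π cperp P f w‖ ≤ B * (1 + η⁻¹) * ‖G (feat w)‖ := by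
    filter_upwards [hB] with w hw
    rw [hfeq, norm_mul, norm_mul]
    have h1 := mul_le_mul (mul_le_mul_of_nonneg_right hw (norm_nonneg (G (feat w))))
      (abs_one_sub_annotR_div_le hη hπ w) (abs_nonneg _) (by positivity)
    exact h1.trans_eq (by ring)
  have hκm : Measurable fun x : Feat d k l => cperp x.2.2 * G x :=
    (hcm.comp measurable_snd.snd).mul hGm
  have hEm : Measurable (imputationError π cperp P f) :=
    ((hκm.comp measurable_feat).mul
      ((measurable_annotR.div (hπm.comp measurable_covar)).const_sub 1))
  have hEL : MemLp (imputationError π cperp P f) 2 (P : Measure (ObsData d k l)) :=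
    hGL.of_le_mul hEm.aestronglyMeasurable hbound
  have hκi : Integrable (fun w => cperp (regr w) * G (feat w)) (P : Measure (ObsData d k l)) :=
    (hGL.integrable one_le_two).bdd_mul (c := B) (hcm.comp measurable_regr).aestronglyMeasurable hB
  have hκi' : Integrable (fun w => cperp (regr w) * G (feat w) * (annotR w / π (covar w)))
      (P : Measure (ObsData d k l)) :=
    hκi.mul_bdd (c := η⁻¹) (measurable_annotR.div (hπm.comp measurable_covar)).aestronglyMeasurable
      (ae_of_all _ fun w => abs_annotR_div_le hη hπ w)
  -- The factor `1 - A / π(X)` has conditional mean zero given the features, so a wrong imputation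
  -- function causes no bias, only variance.
  have hE0 : ∫ w, imputationError π cperp P f w ∂(P : Measure (ObsData d k l)) = 0 := by
    have h1 := hP.integral_comp_feat_mul_annotR_div hπm hη hπ hκm hκi
    rw [hfeq]
    simp_rw [mul_sub, mul_one]
    rw [integral_sub hκi hκi']
    exact sub_eq_zero.2 h1.symm
  refine (iidLaw_lt_abs_scaledSum_le hEL hE0 ha n).trans ?_
  rw [← ofReal_integral_eq_lintegral_ofReal hGi (ae_of_all _ fun w => sq_nonneg _),
    ← ENNReal.ofReal_mul (by positivity)]
  refine ENNReal.ofReal_le_ofReal ?_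
  rw [div_mul_eq_mul_div, ← integral_const_mul]
  refine div_le_div_of_nonneg_right (integral_mono_ae hEL.integrable_sq (hGi.const_mul _) ?_)
    (sq_nonneg a)
  filter_upwards [hbound] with w hw
  have := pow_le_pow_left₀ (norm_nonneg _) hw 2
  rwa [mul_pow, Real.norm_eq_abs, Real.norm_eq_abs, sq_abs, sq_abs] at this

include hP hπm hη hπ hcm in
/-- The residualized regression on the pseudo-outcome is asymptotically linear, with influence
function `phiRatio`. -/
theorem InModel.tendsto_linearization {B : ℝ}
    (hB : ∀ᵐ w ∂(P : Measure (ObsData d k l)), |cperp (regr w)| ≤ B)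
    {muHat : (m : ℕ) → (Fin m → ObsData d k l) → Feat d k l → ℝ}
    (hmeas : ∀ m, Measurable (Function.uncurry (muHat m))) (hMSE : MSEConsistent P muHat)
    {ε : ℝ} (hε : 0 < ε) :
    Tendsto (fun N : ℕ × ℕ => splitLaw P N.1 N.2
      {s | ε < |√(N.1 : ℝ) * (thetaHat π cperp muHat N.1 N.2 s - thetaRatio cperp P)
        - scaledSum (phiRatio π cperp P) s.1|}) (atTop ×ˢ atTop) (𝓝 0) := by
  have hD := hP.den_pos
  set D := thetaDen cperp P
  -- Chosen so that the bound `4 a / D` of `abs_linearization_le` equals `ε`.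
  set a := ε * D / 4 with ha
  have ha0 : 0 < a := by positivity
  have hB' : ∀ᵐ w ∂(P : Measure (ObsData d k l)), |cperp (regr w)| ≤ max B 1 :=
    hB.mono fun w hw => hw.trans (le_max_left _ _)
  have hB0 : 0 < max B 1 := zero_lt_one.trans_le (le_max_right _ _)
  set C := ENNReal.ofReal ((max B 1 * (1 + η⁻¹)) ^ 2 / a ^ 2) with hC
  set MSE : ℕ → ℝ≥0∞ := fun m => ∫⁻ s', ∫⁻ x, ENNReal.ofReal ((muHat m s' x
    - regressionFun P x) ^ 2) ∂((P : Measure (ObsData d k l)).map feat) ∂(iidLaw P m) with hMSEdef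
  set V := (∫ w, phiRatio π cperp P w ^ 2 ∂(P : Measure (ObsData d k l)))
    + ∫ w, phiDen cperp P w ^ 2 ∂(P : Measure (ObsData d k l)) with hV
  -- bound for the remainder
  have hrem : ∀ n m, splitLaw P n m {s | a < |scaledSum (imputationError π cperp P
      (muHat m s.2)) s.1|} ≤ C * MSE m := fun n m => by
    have hEm := measurable_imputationError_prod (P := P) hπm hcm (hmeas m)
    have hsm : Measurable fun s : (Fin n → ObsData d k l) × (Fin m → ObsData d k l) =>
        scaledSum (imputationError π cperp P (muHat m s.2)) s.1 := by
      refine (Finset.measurable_sum _ fun i _ => ?_).const_mul _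
      have hpm : Measurable fun s : (Fin n → ObsData d k l) × (Fin m → ObsData d k l) =>
          (s.1 i, s.2) := ((measurable_pi_apply i).comp measurable_fst).prodMk measurable_snd
      exact hEm.comp hpm
    have hset : MeasurableSet {s : (Fin n → ObsData d k l) × (Fin m → ObsData d k l) |
        a < |scaledSum (imputationError π cperp P (muHat m s.2)) s.1|} :=
      measurableSet_lt measurable_const hsm.norm
    -- Condition on the training sample: by independence the imputation function becomes a fixed
    -- function.
    rw [Measure.prod_apply_symm hset]
    have hle : ∀ s' : Fin m → ObsData d k l, iidLaw P n ((fun s => (s, s')) ⁻¹'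
        {s | a < |scaledSum (imputationError π cperp P (muHat m s.2)) s.1|})
        ≤ C * ∫⁻ x, ENNReal.ofReal ((muHat m s' x - regressionFun P x) ^ 2)
          ∂((P : Measure (ObsData d k l)).map feat) := fun s' =>
      hP.iidLaw_lt_abs_scaledSum_imputationError_le hπm hη hπ hcm hB0 hB'
        ((hmeas m).comp measurable_prodMk_left) ha0 n
    refine (lintegral_mono hle).trans_eq ?_
    rw [lintegral_const_mul' _ _ ENNReal.ofReal_ne_top]
  have hCM : Tendsto (fun N : ℕ × ℕ => C * MSE N.2) (atTop ×ˢ atTop) (𝓝 0) := by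
    have h1 : Tendsto MSE atTop (𝓝 0) := hMSE
    have h2 := ENNReal.Tendsto.const_mul (a := C)
      (h1.comp (tendsto_snd (f := (atTop : Filter ℕ)) (g := atTop)))
      (Or.inr ENNReal.ofReal_ne_top)
    rwa [mul_zero] at h2
  have hVK : Tendsto (fun K : ℝ => ENNReal.ofReal (V / K ^ 2)) atTop (𝓝 0) := by
    have h1 : Tendsto (fun K : ℝ => V / K ^ 2) atTop (𝓝 0) :=
      tendsto_const_nhds.div_atTop (tendsto_pow_atTop two_ne_zero)
    simpa using ENNReal.tendsto_ofReal h1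
  rw [ENNReal.tendsto_nhds_zero]
  intro δ hδ
  have hδ2 : 0 < δ / 2 := ENNReal.half_pos hδ.ne'
  -- Tightness: `K` bounds both normalized sums with high probability uniformly in `n`; afterwards
  -- `n` is taken large compared with `K`.
  obtain ⟨K, hKδ, hK0⟩ := ((hVK.eventually (ge_mem_nhds hδ2)).and (eventually_gt_atTop 0)).exists
  have hsqrt : Tendsto (fun n : ℕ => √(n : ℝ)) atTop atTop :=
    Real.tendsto_sqrt_atTop.comp tendsto_natCast_atTop_atTop
  have hn1 : ∀ᶠ n : ℕ in atTop, K ≤ √(n : ℝ) * (D / 2) :=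
    (hsqrt.atTop_mul_const (half_pos hD)).eventually_ge_atTop K
  have hn2 : ∀ᶠ n : ℕ in atTop, K ^ 2 ≤ √(n : ℝ) * a :=
    (hsqrt.atTop_mul_const ha0).eventually_ge_atTop (K ^ 2)
  filter_upwards [tendsto_fst.eventually (hn1.and (hn2.and (eventually_gt_atTop 0))),
    hCM.eventually (ge_mem_nhds hδ2)] with N hN hN2
  obtain ⟨hN1, hN3, hN4⟩ := hN
  have hsub : {s : (Fin N.1 → ObsData d k l) × (Fin N.2 → ObsData d k l) |
      ε < |√(N.1 : ℝ) * (thetaHat π cperp muHat N.1 N.2 s - thetaRatio cperp P)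
        - scaledSum (phiRatio π cperp P) s.1|}
      ⊆ ({s | K < |scaledSum (phiRatio π cperp P) s|} ×ˢ Set.univ
          ∪ {s | K < |scaledSum (phiDen cperp P) s|} ×ˢ Set.univ)
        ∪ {s | a < |scaledSum (imputationError π cperp P (muHat N.2 s.2)) s.1|} := by
    intro s hs
    by_contra hcon
    simp only [Set.mem_union, Set.mem_prod, Set.mem_ofPred_eq, Set.mem_univ, and_true, not_or,
      not_lt] at hcon
    have h := abs_linearization_le hD hN4 hN1 hN3 hcon.1.1 hcon.1.2 hcon.2
    rw [ha, show 4 * (ε * D / 4) / D = ε by field_simp] at h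
    exact absurd hs (not_lt.2 h)
  refine (measure_mono hsub).trans ((measure_union_le _ _).trans ?_)
  refine (add_le_add (measure_union_le _ _) (hrem _ _)).trans ?_
  rw [Measure.prod_prod, Measure.prod_prod, measure_univ, mul_one, mul_one]
  refine (add_le_add (add_le_add
    (iidLaw_lt_abs_scaledSum_le (memLp_phiRatio hP hπm hη hπ hcm)
      (integral_phiRatio hP hπm hη hπ hcm) hK0 _)
    (iidLaw_lt_abs_scaledSum_le (memLp_phiDen hP) (integral_phiDen hP) hK0 _)) hN2).trans ?_
  rw [← ENNReal.ofReal_add (div_nonneg (integral_nonneg fun w => sq_nonneg _) (sq_nonneg K))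
    (div_nonneg (integral_nonneg fun w => sq_nonneg _) (sq_nonneg K)), ← add_div]
  exact (add_le_add_left hKδ _).trans_eq (ENNReal.add_halves δ)

end Linearity

/-! ## The variance bound for regular asymptotically linear estimators -/

section Bound

lemma tendsto_measure_lt_abs_sub {ι : Type*} {L : Filter ι} {Ω : ι → Type*}
    {mΩ : ∀ i, MeasurableSpace (Ω i)} {μ : ∀ i, Measure (Ω i)} {X : ∀ i, Ω i → ℝ} {c : ι → ℝ}
    (hX : ∀ ε : ℝ, 0 < ε → Tendsto (fun i => μ i {s | ε < |X i s|}) L (𝓝 0))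
    (hc : Tendsto c L (𝓝 0)) {ε : ℝ} (hε : 0 < ε) :
    Tendsto (fun i => μ i {s | ε < |X i s - c i|}) L (𝓝 0) := by
  refine tendsto_of_tendsto_of_tendsto_of_le_of_le' tendsto_const_nhds (hX (ε / 2) (half_pos hε))
    (Eventually.of_forall fun _ => bot_le) ?_
  have h0 : Tendsto (fun i => |c i|) L (𝓝 0) := by simpa using hc.abs
  filter_upwards [h0.eventually (gt_mem_nhds (half_pos hε))] with i hi
  refine measure_mono fun s (hs : ε < |X i s - c i|) => ?_
  have := abs_sub (X i s) (c i)
  change ε / 2 < |X i s|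
  linarith

/-- Boundedness of `a t` is enough: the increment follows `a t κ` even if `a t` does not converge,
as happens for two sample sizes with no limiting ratio. -/
lemma tendsto_mul_sub_of_tendsto_div {ι : Type*} {L : Filter ι} {a : ι → ℝ} {t : ι → ℝ} {F : ℝ → ℝ}
    {F₀ κ : ℝ} (hF : Tendsto (fun t => (F t - F₀) / t) (𝓝[>] 0) (𝓝 κ))
    (ht : Tendsto t L (𝓝[>] 0)) (ha : ∀ᶠ i in L, 0 ≤ a i ∧ a i * t i ≤ 1) :
    Tendsto (fun i => a i * (F (t i) - F₀) - a i * t i * κ) L (𝓝 0) := by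
  have h1 : Tendsto (fun i => |(F (t i) - F₀) / t i - κ|) L (𝓝 0) := by
    simpa using ((hF.comp ht).sub_const κ).abs
  refine squeeze_zero_norm' ?_ h1
  filter_upwards [ha, ht.eventually self_mem_nhdsWithin] with i hi hti
  have hti : 0 < t i := hti
  have e : a i * (F (t i) - F₀) - a i * t i * κ = a i * t i * ((F (t i) - F₀) / t i - κ) := by
    field_simp
  rw [e, norm_mul, Real.norm_of_nonneg (mul_nonneg hi.1 hti.le)]
  exact mul_le_of_le_one_left (norm_nonneg _) hi.2

lemma tendsto_one_div_sqrt {ι : Type*} {L : Filter ι} {n : ι → ℕ} (hn : Tendsto n L atTop) :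
    Tendsto (fun i => 1 / √(n i : ℝ)) L (𝓝[>] 0) := by
  have h : Tendsto (fun i => √(n i : ℝ)) L atTop :=
    Real.tendsto_sqrt_atTop.comp (tendsto_natCast_atTop_atTop.comp hn)
  simp only [one_div]
  exact tendsto_inv_atTop_nhdsGT_zero.comp h

lemma integrable_fun_mul_of_memLp {α : Type*} {mα : MeasurableSpace α} {μ : Measure α}
    {f g : α → ℝ} (hf : MemLp f 2 μ) (hg : MemLp g 2 μ) : Integrable (fun x => f x * g x) μ :=
  hf.integrable_mul hg

variable {𝒲 : Type*} [MeasurableSpace 𝒲] {S : SubmodelClass 𝒲} {ψ : ProbabilityMeasure 𝒲 → ℝ}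
  {P : ProbabilityMeasure 𝒲} {φ ϕ : 𝒲 → ℝ} {T : (n : ℕ) → (Fin n → 𝒲) → ℝ}

/-- The influence function of a regular asymptotically linear estimator may be modified on a null
set. -/
lemma IsRAL.congr (hT : IsRAL S ψ P T ϕ) {ϕ' : 𝒲 → ℝ} (h : ϕ =ᵐ[(P : Measure 𝒲)] ϕ') :
    IsRAL S ψ P T ϕ' where
  measurable := hT.measurable
  memLp := hT.memLp.ae_eq h
  integral_eq_zero := by rw [← integral_congr_ae h, hT.integral_eq_zero]
  asymptotically_linear ε hε := by
    refine (hT.asymptotically_linear ε hε).congr fun n => measure_congr ?_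
    have hi : ∀ᵐ s ∂(iidLaw P n), ∀ i, ϕ (s i) = ϕ' (s i) := ae_all_iff.2 fun i =>
      (Measure.tendsto_eval_ae_ae (μ := fun _ : Fin n => (P : Measure 𝒲)) (i := i)).eventually h
    filter_upwards [hi] with s hs
    have e : ∑ i, ϕ (s i) = ∑ i, ϕ' (s i) := Finset.sum_congr rfl fun i _ => hs i
    refine propext ?_
    change ε < _ ↔ ε < _
    rw [e]
  regular Q g hQ := by
    rw [← variance_congr h]
    exact hT.regular Q g hQ

/-- The influence function of a regular asymptotically linear estimator is a gradient. -/
lemma IsRAL.integral_mul_score_eq (hT : IsRAL S ψ P T ϕ) (hϕm : Measurable ϕ)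
    {Q : ℝ → ProbabilityMeasure 𝒲} {h : 𝒲 → ℝ} (hS : S Q h) (hhm : Measurable h)
    (hh : MemLp h 2 (P : Measure 𝒲)) (hQ : DiffInQuadraticMean P Q h) {κ : ℝ}
    (hψ : Tendsto (fun t : ℝ => (ψ (Q t) - ψ P) / t) (𝓝[>] 0) (𝓝 κ)) :
    ∫ w, ϕ w * h w ∂(P : Measure 𝒲) = κ := by
  set κ' := ∫ w, ϕ w * h w ∂(P : Measure 𝒲) with hκ'
  set V := ∫ w, ϕ w ^ 2 ∂(P : Measure 𝒲) with hV
  have hV0 : 0 ≤ V := integral_nonneg fun w => sq_nonneg _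
  have hvar : Var[ϕ; (P : Measure 𝒲)] = V :=
    variance_of_integral_eq_zero hϕm.aemeasurable hT.integral_eq_zero
  set t : ℕ → ℝ := fun n => 1 / √(n : ℝ) with ht
  have htend : Tendsto t atTop (𝓝[>] 0) := tendsto_one_div_sqrt tendsto_id
  have hsq : ∀ᶠ n : ℕ in atTop, √(n : ℝ) * t n = 1 := by
    filter_upwards [eventually_gt_atTop 0] with n hn
    have : 0 < √(n : ℝ) := Real.sqrt_pos.2 (Nat.cast_pos.2 hn)
    rw [ht]
    field_simp
  have hX := fun u : ℝ => TendstoInDistribution.tendsto_integral_exp hV0 (hvar ▸ hT.regular Q h hS) u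
  have hY := hQ.tendsto_integral_exp_iid hhm hh htend tendsto_id (hsq.mono fun n hn => hn.le) hϕm
    hT.memLp hT.integral_eq_zero
  set X : (n : ℕ) → (Fin n → 𝒲) → ℝ := fun n s => √(n : ℝ) * (T n s - ψ (Q (t n))) with hXdef
  -- Under the local alternatives the parenthesis is asymptotically centred Gaussian with variance
  -- `V`; what remains is the shift `κ' - κ`, to be shown zero.
  set Y : (n : ℕ) → (Fin n → 𝒲) → ℝ := fun n s =>
    ((√(n : ℝ))⁻¹ * ∑ j, ϕ (s j) - √(n : ℝ) * t n * κ') + (κ' - κ) with hYdef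
  have hXm : ∀ n, Measurable (X n) := fun n => ((hT.measurable n).sub_const _).const_mul _
  have hYm : ∀ n, Measurable (Y n) := fun n =>
    (((Finset.measurable_sum _ fun i _ => hϕm.comp (measurable_pi_apply i)).const_mul _).sub_const
      _).add_const _
  -- Contiguity carries the linear expansion, given under `P` only, to the local alternatives.
  have hAL : ∀ ε : ℝ, 0 < ε → Tendsto (fun n : ℕ => iidLaw (Q (t n)) n
      {s | ε < |√(n : ℝ) * (T n s - ψ P) - (√(n : ℝ))⁻¹ * ∑ i, ϕ (s i)|}) atTop (𝓝 0) :=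
    fun ε hε => hQ.tendsto_pi_zero hhm hh htend (J := fun n => Fin n) (by
      filter_upwards with n
      simp only [ht, Fintype.card_fin]
      rw [div_pow, one_pow, Real.sq_sqrt (Nat.cast_nonneg n), mul_one_div]
      exact div_self_le_one _) (hT.asymptotically_linear ε hε)
  have hrem := tendsto_mul_sub_of_tendsto_div (F := fun t => ψ (Q t)) (a := fun n : ℕ => √(n : ℝ))
    hψ htend (hsq.mono fun n hn => ⟨Real.sqrt_nonneg _, hn.le⟩)
  -- The added term is zero for `n > 0`; it makes the formula for `X - Y` below an identity at `n =
  -- 0` too, where `√n t` is `0` instead of `1`.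
  have hrem' : Tendsto (fun n : ℕ => √(n : ℝ) * (ψ (Q (t n)) - ψ P) - κ
      - (√(n : ℝ) * t n - 1) * κ') atTop (𝓝 0) :=
    hrem.congr' (by
      filter_upwards [hsq] with n hn
      rw [hn]
      ring)
  have hsub : ∀ ε : ℝ, 0 < ε → Tendsto (fun n : ℕ => iidLaw (Q (t n)) n
      {s | ε < |X n s - Y n s|}) atTop (𝓝 0) := fun ε hε => by
    refine (tendsto_measure_lt_abs_sub hAL hrem' hε).congr fun n => congrArg _ ?_
    ext s
    simp only [hXdef, hYdef, Set.mem_ofPred_eq]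
    ring_nf
  -- Regularity and the linear expansion give two limits for the same characteristic functions,
  -- differing by this factor; the Gaussian characteristic function never vanishes and cancels.
  have hexp : ∀ u : ℝ, Complex.exp ((u * (κ' - κ) : ℝ) * Complex.I) = 1 := fun u => by
    have h1 := tendsto_integral_exp_sub (fun n => (hXm n).aemeasurable)
      (fun n => (hYm n).aemeasurable) hsub u
    have h2 := ((hY u).const_mul (Complex.exp ((u * (κ' - κ) : ℝ) * Complex.I)))
    have h3 := (hX u).sub h1
    rw [sub_zero] at h3
    have h4 := tendsto_nhds_unique (h3.congr fun n => ?_) h2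
    · have h5 : Complex.exp (-((u ^ 2 * V / 2 : ℝ) : ℂ)) ≠ 0 := Complex.exp_ne_zero _
      exact (mul_right_cancel₀ h5 (by rw [one_mul]; exact h4)).symm
    · rw [sub_sub_cancel, ← integral_const_mul]
      refine integral_congr_ae (ae_of_all _ fun s => ?_)
      simp only [hYdef, ← Complex.exp_add, id]
      congr 1
      push_cast
      ring
  by_contra hne
  have hδ : κ' - κ ≠ 0 := sub_ne_zero.2 hne
  -- At this `u` the factor is `exp(i π) = -1`.
  have h1 := hexp (Real.pi / (κ' - κ))
  rw [div_mul_cancel₀ _ hδ, Complex.exp_pi_mul_I] at h1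
  norm_num at h1

lemma sqrt_integral_sq_le {f : 𝒲 → ℝ} (hf : MemLp f 2 (P : Measure 𝒲)) {ε : ℝ} (hε : 0 ≤ ε)
    (h : eLpNorm f 2 (P : Measure 𝒲) ≤ ENNReal.ofReal ε) :
    √(∫ w, f w ^ 2 ∂(P : Measure 𝒲)) ≤ ε := by
  rw [hf.eLpNorm_eq_integral_rpow_norm two_ne_zero (by simp), ENNReal.ofReal_le_ofReal_iff hε] at h
  have e : ∀ w, ‖f w‖ ^ (2 : ℝ≥0∞).toReal = f w ^ 2 := fun w => by
    rw [ENNReal.toReal_ofNat, Real.rpow_ofNat, Real.norm_eq_abs, sq_abs]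
  simp_rw [e] at h
  rwa [ENNReal.toReal_ofNat, ← one_div, ← Real.sqrt_eq_rpow] at h

/-- The convolution bound for regular asymptotically linear estimators: the efficient influence
function has the smallest variance. -/
theorem IsEfficientInfluenceFunction.variance_le (hE : IsEfficientInfluenceFunction S ψ P φ)
    (hS : ∀ Q h, S Q h → Measurable h ∧ MemLp h 2 (P : Measure 𝒲) ∧ DiffInQuadraticMean P Q h)
    (hT : IsRAL S ψ P T ϕ) : Var[φ; (P : Measure 𝒲)] ≤ Var[ϕ; (P : Measure 𝒲)] := by
  -- A measurable version of `ϕ`, as the characteristic-function argument requires.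
  set f := hT.memLp.1.mk ϕ with hf
  have hae : ϕ =ᵐ[(P : Measure 𝒲)] f := hT.memLp.1.ae_eq_mk
  have hfm : Measurable f := hT.memLp.1.stronglyMeasurable_mk.measurable
  have hT' := hT.congr hae
  have hd : MemLp (f - φ) 2 (P : Measure 𝒲) := hT'.memLp.sub hE.memLp
  have hspan : ∀ g ∈ Submodule.span ℝ {h : 𝒲 → ℝ | ∃ Q, S Q h},
      MemLp g 2 (P : Measure 𝒲) ∧ ∫ w, (f - φ) w * g w ∂(P : Measure 𝒲) = 0 := by
    intro g hg
    induction hg using Submodule.span_induction with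
    | mem h hh =>
      obtain ⟨Q, hQ⟩ := hh
      obtain ⟨h1, h2, h3⟩ := hS Q h hQ
      refine ⟨h2, ?_⟩
      have h4 := hT'.integral_mul_score_eq hfm hQ h1 h2 h3 (hE.pathwise Q h hQ)
      simp only [Pi.sub_apply, sub_mul]
      rw [integral_sub (integrable_fun_mul_of_memLp hT'.memLp h2) (integrable_fun_mul_of_memLp hE.memLp h2)]
      exact sub_eq_zero.2 h4
    | zero => exact ⟨MemLp.zero', by simp⟩
    | add x y _ _ hx hy =>
      refine ⟨hx.1.add hy.1, ?_⟩
      simp only [Pi.add_apply, mul_add]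
      rw [integral_add (integrable_fun_mul_of_memLp hd hx.1) (integrable_fun_mul_of_memLp hd hy.1)]
      exact (congrArg₂ _ hx.2 hy.2).trans (add_zero 0)
    | smul a x _ hx =>
      refine ⟨hx.1.const_smul a, ?_⟩
      simp only [Pi.smul_apply, smul_eq_mul, mul_left_comm]
      rw [integral_const_mul, hx.2, mul_zero]
  -- Orthogonality to the scores extends to their span by linearity, and to `φ` by approximation
  -- with Cauchy-Schwarz; the `+ 1` in the tolerance covers `f = φ`.
  have horth : ∫ w, (f - φ) w * φ w ∂(P : Measure 𝒲) = 0 := by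
    set A := √(∫ w, (f - φ) w ^ 2 ∂(P : Measure 𝒲)) with hA
    have hA0 : 0 ≤ A := Real.sqrt_nonneg _
    refine abs_eq_zero.1 (le_antisymm (le_of_forall_pos_le_add fun ε hε => ?_) (abs_nonneg _))
    have hδ : 0 < ε / (A + 1) := by positivity
    obtain ⟨g, hg, hgε⟩ := hE.mem_tangent _ (ENNReal.ofReal_pos.2 hδ)
    obtain ⟨hgL, hg0⟩ := hspan g hg
    have hφg : MemLp (φ - g) 2 (P : Measure 𝒲) := hE.memLp.sub hgL
    have e : ∫ w, (f - φ) w * φ w ∂(P : Measure 𝒲)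
        = ∫ w, (f - φ) w * (φ - g) w ∂(P : Measure 𝒲) := by
      simp only [Pi.sub_apply φ g, mul_sub]
      rw [integral_sub (integrable_fun_mul_of_memLp hd hE.memLp) (integrable_fun_mul_of_memLp hd hgL)]
      exact (sub_eq_self.2 hg0).symm
    rw [e, zero_add]
    refine (abs_integral_mul_le_sqrt hd hφg).trans ?_
    refine (mul_le_mul_of_nonneg_left (sqrt_integral_sq_le hφg hδ.le hgε.le) hA0).trans ?_
    rw [mul_div_assoc', div_le_iff₀ (by positivity)]
    nlinarith
  -- Pythagoras for `f = φ + (f - φ)`.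
  have hle : ∫ w, φ w ^ 2 ∂(P : Measure 𝒲) ≤ ∫ w, f w ^ 2 ∂(P : Measure 𝒲) := by
    have h0 : 0 ≤ ∫ w, (f - φ) w ^ 2 ∂(P : Measure 𝒲) := integral_nonneg fun w => sq_nonneg _
    have e : ∀ w, (f - φ) w ^ 2 = f w ^ 2 - φ w ^ 2 - 2 * ((f - φ) w * φ w) := fun w => by
      simp only [Pi.sub_apply]; ring
    have hi : Integrable (fun w => f w ^ 2 - φ w ^ 2) (P : Measure 𝒲) :=
      hT'.memLp.integrable_sq.sub hE.memLp.integrable_sq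
    simp_rw [e] at h0
    rw [integral_sub hi ((integrable_fun_mul_of_memLp hd hE.memLp).const_mul 2),
      integral_sub hT'.memLp.integrable_sq hE.memLp.integrable_sq, integral_const_mul] at h0
    have horth' : ∫ w, (f - φ) w * φ w ∂(P : Measure 𝒲) = 0 := horth
    rw [horth'] at h0
    linarith
  calc Var[φ; (P : Measure 𝒲)] ≤ ∫ w, φ w ^ 2 ∂(P : Measure 𝒲) :=
        variance_le_expectation_sq hE.memLp.1
    _ ≤ ∫ w, f w ^ 2 ∂(P : Measure 𝒲) := hle
    _ = Var[ϕ; (P : Measure 𝒲)] := by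
        rw [variance_congr hae, variance_of_integral_eq_zero hfm.aemeasurable hT'.integral_eq_zero]

end Bound

/-! ## Regularity of the residualized regression -/

section Regularity

/-- Contiguity for pairs of independent samples. -/
lemma DiffInQuadraticMean.tendsto_prod_iidLaw_zero {𝒲 : Type*} [MeasurableSpace 𝒲]
    {P : ProbabilityMeasure 𝒲} {Q : ℝ → ProbabilityMeasure 𝒲} {h : 𝒲 → ℝ}
    (hQ : DiffInQuadraticMean P Q h) (hhm : Measurable h) (hh : MemLp h 2 (P : Measure 𝒲))
    {ι : Type*} {L : Filter ι} {t : ι → ℝ} (ht : Tendsto t L (𝓝[>] 0)) {n m : ι → ℕ}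
    (hnm : ∀ᶠ i in L, ((n i + m i : ℕ) : ℝ) * t i ^ 2 ≤ 1)
    {E : ∀ i, Set ((Fin (n i) → 𝒲) × (Fin (m i) → 𝒲))}
    (hE : Tendsto (fun i => (iidLaw P (n i)).prod (iidLaw P (m i)) (E i)) L (𝓝 0)) :
    Tendsto (fun i => (iidLaw (Q (t i)) (n i)).prod (iidLaw (Q (t i)) (m i)) (E i)) L (𝓝 0) := by
  -- The two independent samples together are one i.i.d. sample indexed by the disjoint union, of
  -- size `n + m`.
  have e : ∀ (R : ProbabilityMeasure 𝒲) i, (iidLaw R (n i)).prod (iidLaw R (m i)) (E i)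
      = Measure.pi (fun _ : Fin (n i) ⊕ Fin (m i) => (R : Measure 𝒲))
        (MeasurableEquiv.sumPiEquivProdPi (fun _ : Fin (n i) ⊕ Fin (m i) => 𝒲) ⁻¹' E i) :=
    fun R i => ((measurePreserving_sumPiEquivProdPi
      fun _ : Fin (n i) ⊕ Fin (m i) => (R : Measure 𝒲)).measure_preimage_equiv (E i)).symm
  simp only [e] at hE ⊢
  exact hQ.tendsto_pi_zero hhm hh ht (J := fun i => Fin (n i) ⊕ Fin (m i))
    (by simpa using hnm) hE

variable {d k l : ℕ} {π : (Fin k → ℝ) → ℝ} {cperp : (Fin d → ℝ) → ℝ}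
  {P : ProbabilityMeasure (ObsData d k l)} {η : ℝ}

lemma measurable_thetaHat (hπm : Measurable π) (hcm : Measurable cperp)
    {muHat : (m : ℕ) → (Fin m → ObsData d k l) → Feat d k l → ℝ}
    (hmeas : ∀ m, Measurable (Function.uncurry (muHat m))) (n m : ℕ) :
    Measurable (thetaHat π cperp muHat n m) := by
  have hc : ∀ i : Fin n, Measurable fun s : (Fin n → ObsData d k l) × (Fin m → ObsData d k l) =>
      cperp (regr (s.1 i)) := fun i =>
    (hcm.comp measurable_regr).comp ((measurable_pi_apply i).comp measurable_fst)
  have hw : ∀ i : Fin n, Measurable fun s : (Fin n → ObsData d k l) × (Fin m → ObsData d k l) =>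
      s.1 i := fun i => (measurable_pi_apply i).comp measurable_fst
  have hmu : ∀ i : Fin n, Measurable fun s : (Fin n → ObsData d k l) × (Fin m → ObsData d k l) =>
      muHat m s.2 (feat (s.1 i)) := fun i =>
    (hmeas m).comp (measurable_snd.prodMk (measurable_feat.comp (hw i)))
  have hA : Measurable fun w : ObsData d k l => annotR w / π (covar w) :=
    measurable_annotR.div (hπm.comp measurable_covar)
  exact (Finset.measurable_sum _ fun i _ => (hc i).mul ((hmu i).add ((hA.comp (hw i)).mul
    ((measurable_outcome.comp (hw i)).sub (hmu i))))).div
    (Finset.measurable_sum _ fun i _ => (hc i).pow_const 2)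

variable (hπm : Measurable π) (hη : 0 < η) (hπ : ∀ x, η ≤ π x) (hcm : Measurable cperp)

include hπm hη hπ hcm in
/-- The residualized regression on the pseudo-outcome is regular: its limit distribution is stable
along regular submodels. -/
theorem IsRegularSubmodel.tendstoInDistribution_thetaHat
    {Q : ℝ → ProbabilityMeasure (ObsData d k l)} {h : ObsData d k l → ℝ}
    (S : IsRegularSubmodel π cperp P Q h) {B : ℝ}
    (hB : ∀ᵐ w ∂(P : Measure (ObsData d k l)), |cperp (regr w)| ≤ B)
    {muHat : (m : ℕ) → (Fin m → ObsData d k l) → Feat d k l → ℝ}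
    (hmeas : ∀ m, Measurable (Function.uncurry (muHat m))) (hMSE : MSEConsistent P muHat) :
    TendstoInDistribution
      (fun (N : ℕ × ℕ) (s : (Fin N.1 → ObsData d k l) × (Fin N.2 → ObsData d k l)) =>
        √(N.1 : ℝ) * (thetaHat π cperp muHat N.1 N.2 s
          - thetaRatio cperp (Q (1 / √((N.1 + N.2 : ℕ) : ℝ)))))
      (atTop ×ˢ atTop) (id : ℝ → ℝ)
      (fun N => splitLaw (Q (1 / √((N.1 + N.2 : ℕ) : ℝ))) N.1 N.2)
      (gaussianReal 0 (Var[phiRatio π cperp P; (P : Measure (ObsData d k l))]).toNNReal) := by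
  have hP : InModel π cperp P := S.at_zero ▸ S.mem_model 0
  set φ := phiRatio π cperp P with hφ
  have hφm : Measurable φ := measurable_phiRatio hπm hcm
  have hφL : MemLp φ 2 (P : Measure (ObsData d k l)) := memLp_phiRatio hP hπm hη hπ hcm
  have hφ0 : ∫ w, φ w ∂(P : Measure (ObsData d k l)) = 0 := integral_phiRatio hP hπm hη hπ hcm
  set κ := ∫ w, φ w * h w ∂(P : Measure (ObsData d k l)) with hκ
  -- At this rate `(n + m) t² ≤ 1`, so that the joint law of both samples stays contiguous; it
  -- follows that `√n t ≤ 1`.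
  set t : ℕ × ℕ → ℝ := fun N => 1 / √((N.1 + N.2 : ℕ) : ℝ) with ht
  have hsum : Tendsto (fun N : ℕ × ℕ => N.1 + N.2) (atTop ×ˢ atTop) atTop :=
    tendsto_atTop_mono (fun N => Nat.le_add_right _ _) tendsto_fst
  have htend : Tendsto t (atTop ×ˢ atTop) (𝓝[>] 0) := tendsto_one_div_sqrt hsum
  have hnt : ∀ N : ℕ × ℕ, √(N.1 : ℝ) * t N ≤ 1 := fun N => by
    rw [ht, mul_one_div]
    exact div_le_one_of_le₀ (Real.sqrt_le_sqrt (by push_cast; linarith [Nat.cast_nonneg (α := ℝ) N.2]))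
      (Real.sqrt_nonneg _)
  have hX : ∀ N : ℕ × ℕ, Measurable
      fun s : (Fin N.1 → ObsData d k l) × (Fin N.2 → ObsData d k l) =>
        √(N.1 : ℝ) * (thetaHat π cperp muHat N.1 N.2 s - thetaRatio cperp (Q (t N))) := fun N =>
    ((measurable_thetaHat hπm hcm hmeas N.1 N.2).sub_const _).const_mul _
  have hY : ∀ N : ℕ × ℕ, Measurable
      fun s : (Fin N.1 → ObsData d k l) × (Fin N.2 → ObsData d k l) =>
        scaledSum φ s.1 - √(N.1 : ℝ) * t N * κ := fun N =>
    ((hφm.scaledSum N.1).comp measurable_fst).sub_const _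
  have hlin : ∀ ε : ℝ, 0 < ε → Tendsto (fun N : ℕ × ℕ => splitLaw (Q (t N)) N.1 N.2
      {s | ε < |√(N.1 : ℝ) * (thetaHat π cperp muHat N.1 N.2 s - thetaRatio cperp P)
        - scaledSum φ s.1|}) (atTop ×ˢ atTop) (𝓝 0) := fun ε hε =>
    S.diff.tendsto_prod_iidLaw_zero S.measurable_score S.memLp_score htend
      (Eventually.of_forall fun N => by
        simp only [ht]
        rw [div_pow, one_pow, Real.sq_sqrt (Nat.cast_nonneg _), mul_one_div]
        exact div_self_le_one _)
      (hP.tendsto_linearization hπm hη hπ hcm hB hmeas hMSE hε)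
  -- The target moves by the same `√n t κ` as the mean of the normalized sum, because `φ` is both
  -- influence function and gradient; the two cancel.
  have hrem : Tendsto (fun N : ℕ × ℕ => √(N.1 : ℝ) * (thetaRatio cperp (Q (t N))
      - thetaRatio cperp P) - √(N.1 : ℝ) * t N * κ) (atTop ×ˢ atTop) (𝓝 0) := tendsto_mul_sub_of_tendsto_div (F := fun t => thetaRatio cperp (Q t))
    (a := fun N : ℕ × ℕ => √(N.1 : ℝ)) (S.tendsto_thetaRatio hπm hη hπ hcm) htend
    (Eventually.of_forall fun N => ⟨Real.sqrt_nonneg _, hnt N⟩)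
  have hvar : Var[φ; (P : Measure (ObsData d k l))] = ∫ w, φ w ^ 2 ∂(P : Measure (ObsData d k l)) :=
    variance_of_integral_eq_zero hφm.aemeasurable hφ0
  rw [hvar]
  refine tendstoInDistribution_gaussianReal_of_tendsto (fun N => (hX N).aemeasurable)
    (integral_nonneg fun w => sq_nonneg _) fun u => ?_
  have h1 := tendsto_integral_exp_sub (fun N => (hX N).aemeasurable) (fun N => (hY N).aemeasurable)
    (L := atTop ×ˢ atTop) (μ := fun N : ℕ × ℕ => splitLaw (Q (t N)) N.1 N.2) (fun ε hε => by
      refine (tendsto_measure_lt_abs_sub hlin hrem hε).congr fun N => congrArg _ ?_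
      ext s
      simp only [Set.mem_ofPred_eq]
      ring_nf) u
  have h2 := S.diff.tendsto_integral_exp_iid S.measurable_score S.memLp_score htend
    (tendsto_fst (f := (atTop : Filter ℕ)) (g := (atTop : Filter ℕ)))
    (Eventually.of_forall hnt) hφm hφL hφ0 u
  have h3 := h1.add h2
  rw [zero_add] at h3
  refine h3.congr fun N => ?_
  -- The linear part involves the estimation sample only, so the training sample integrates out.
  have h4 := integral_fun_fst (μ := iidLaw (Q (t N)) N.1) (ν := iidLaw (Q (t N)) N.2)
    fun s => Complex.exp ((u * (scaledSum φ s - √(N.1 : ℝ) * t N * κ) : ℝ) * Complex.I)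
  rw [probReal_univ, one_smul] at h4
  simp only [scaledSum] at h4 ⊢
  rw [← h4, sub_add_cancel]

/-- The constant path is a regular submodel, with score zero. -/
lemma InModel.isRegularSubmodel_const (hP : InModel π cperp P) :
    IsRegularSubmodel π cperp P (fun _ => P) 0 where
  at_zero := rfl
  mem_model _ := hP
  measurable_score := measurable_const
  memLp_score := MemLp.zero
  diff := by
    refine tendsto_const_nhds.congr fun t => ?_
    simp
  moments_bounded := ⟨max _ _, Eventually.of_forall fun _ => ⟨le_max_left _ _, le_max_right _ _⟩⟩

end Regularity

end

/-! ### The main theorem -/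

theorem mainTheorem5 (d k l : ℕ)
    -- law of a complete unit `(M*, C, A, X, U)`
    (Pfull : ProbabilityMeasure (FullData d k l))
    (hMAR : MissingAtRandom Pfull)
    (π : (Fin k → ℝ) → ℝ) (η : ℝ) (hπ : IsAnnotationScore Pfull π η)
    (θ : Fin d → ℝ) (hlin : LinearModel Pfull θ)
    -- the residualized regressor `C_j^⊥ = cperp C`
    (j : Fin d) (b₀ : ℝ) (b : Fin d → ℝ) (hproj : IsLinearProjection Pfull j b₀ b)
    (cperp : (Fin d → ℝ) → ℝ) (hcperp : cperp = resid j b₀ b)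
    (hbdd : ∃ B : ℝ, ∀ᵐ z ∂(Pfull : Measure (FullData d k l)), |cperp (regr z)| ≤ B)
    (hden : 0 < ∫ z, cperp (regr z) ^ 2 ∂(Pfull : Measure (FullData d k l)))
    (hmom : MemLp (fun z => cperp (regr z) * outcome z) 2
      (Pfull : Measure (FullData d k l)))
    -- the imputation function, as a function of the training sample
    (muHat : (m : ℕ) → (Fin m → ObsData d k l) → Feat d k l → ℝ)
    (hmeas : ∀ m, Measurable (Function.uncurry (muHat m)))
    -- law of an observed unit
    (P : ProbabilityMeasure (ObsData d k l)) (hP : P = obsLaw Pfull)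
    (hMSE : MSEConsistent P muHat) :
    -- the coefficient is identified as a ratio
    (θ j = (∫ z, cperp (regr z) ^ 2 ∂(Pfull : Measure (FullData d k l)))⁻¹
        * ∫ z, cperp (regr z) * outcome z ∂(Pfull : Measure (FullData d k l))) ∧
    θ j = thetaRatio cperp P ∧
    -- asymptotic normality, as both sample sizes tend to infinity
    TendstoInDistribution
      (fun (N : ℕ × ℕ) (s : (Fin N.1 → ObsData d k l) × (Fin N.2 → ObsData d k l)) =>
        √(N.1 : ℝ) * (thetaHat π cperp muHat N.1 N.2 s - θ j))
      (atTop ×ˢ atTop) (id : ℝ → ℝ) (fun N => splitLaw P N.1 N.2)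
      (gaussianReal 0 (Var[phiRatio π cperp P; (P : Measure (ObsData d k l))]).toNNReal) ∧
    -- `P` belongs to the model, and `phiRatio` is the efficient influence function there
    InModel π cperp P ∧
    IsEfficientInfluenceFunction (IsRegularSubmodel π cperp P) (thetaRatio cperp) P
      (phiRatio π cperp P) ∧
    -- efficiency: the estimator is asymptotically linear with influence function `phiRatio`,
    (∀ ε : ℝ, 0 < ε →
      Tendsto (fun N : ℕ × ℕ => splitLaw P N.1 N.2
        {s | ε < |√(N.1 : ℝ) * (thetaHat π cperp muHat N.1 N.2 s - θ j)
          - (√(N.1 : ℝ))⁻¹ * ∑ i, phiRatio π cperp P (s.1 i)|}) (atTop ×ˢ atTop) (𝓝 0)) ∧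
    -- it is regular,
    (∀ Q h, IsRegularSubmodel π cperp P Q h →
      TendstoInDistribution
        (fun (N : ℕ × ℕ) (s : (Fin N.1 → ObsData d k l) × (Fin N.2 → ObsData d k l)) =>
          √(N.1 : ℝ) * (thetaHat π cperp muHat N.1 N.2 s
            - thetaRatio cperp (Q (1 / √((N.1 + N.2 : ℕ) : ℝ)))))
        (atTop ×ˢ atTop) (id : ℝ → ℝ)
        (fun N => splitLaw (Q (1 / √((N.1 + N.2 : ℕ) : ℝ))) N.1 N.2)
        (gaussianReal 0 (Var[phiRatio π cperp P; (P : Measure (ObsData d k l))]).toNNReal)) ∧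
    -- and no regular asymptotically linear estimator has a smaller asymptotic variance
    (∀ T ϕ, IsRAL (IsRegularSubmodel π cperp P) (thetaRatio cperp) P T ϕ →
      Var[phiRatio π cperp P; (P : Measure (ObsData d k l))] ≤ Var[ϕ; (P : Measure (ObsData d k l))]) := by
  subst hcperp hP
  have hcm : Measurable (resid j b₀ b) := measurable_resid j b₀ b
  have hπ' : ∀ x, η ≤ π x := fun x => (hπ.mem_Icc x).1
  have hmodel : InModel π (resid j b₀ b) (obsLaw Pfull) :=
    hMAR.inModel_obsLaw hπ hcm hlin.integrable hbdd hden hmom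
  have hid := hlin.coefficient_eq hproj hbdd hden
  have hθ : θ j = thetaRatio (resid j b₀ b) (obsLaw Pfull) :=
    hid.trans (hMAR.thetaRatio_obsLaw hπ hcm hmodel hmom).symm
  obtain ⟨B, hB⟩ := hbdd
  have hB' : ∀ᵐ w ∂(obsLaw Pfull : Measure (ObsData d k l)), |resid j b₀ b (regr w)| ≤ B :=
    (ae_map_iff measurable_observe.aemeasurable
      (measurableSet_le (hcm.comp measurable_regr).norm measurable_const)).2 hB
  have heif : IsEfficientInfluenceFunction (IsRegularSubmodel π (resid j b₀ b) (obsLaw Pfull))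
      (thetaRatio (resid j b₀ b)) (obsLaw Pfull) (phiRatio π (resid j b₀ b) (obsLaw Pfull)) :=
    ⟨memLp_phiRatio hmodel hπ.measurable hπ.pos hπ' hcm,
      fun _ _ S => S.tendsto_thetaRatio hπ.measurable hπ.pos hπ' hcm,
      fun _ hε => hmodel.phiRatio_mem_tangent hπ.measurable hπ.pos hπ' hcm
        (fun x => (hπ.mem_Icc x).2) hε⟩
  refine ⟨hid, hθ, ?_, hmodel, heif, fun ε hε => ?_, fun Q h S =>
    S.tendstoInDistribution_thetaHat hπ.measurable hπ.pos hπ' hcm hB' hmeas hMSE, fun T ϕ hT =>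
    heif.variance_le (fun Q h S => ⟨S.measurable_score, S.memLp_score, S.diff⟩) hT⟩
  · rw [hθ]
    -- Asymptotic normality under `P` is regularity along the constant path.
    exact hmodel.isRegularSubmodel_const.tendstoInDistribution_thetaHat hπ.measurable hπ.pos hπ' hcm
      hB' hmeas hMSE
  · rw [hθ]
    exact hmodel.tendsto_linearization hπ.measurable hπ.pos hπ' hcm hB' hmeas hMSE hε
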